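/- Work in many-sorted first-order logic with equality, where signatures are at most countable, all sorts of a structure are non-empty, and a theory is a set of sentences. A constraint is a finite conjunction of literals; a primitive formula is a formula $\exists \underline e\,\phi$ with $\phi$ a constraint. A theory is universal if its axioms have the form $\forall \underline x\,\chi$ with $\chi$ quantifier-free. A universal theory $T$ has a model completion if there is a theory $T^*\supseteq T$ in the same signature such that every constraint satisfiable in a model of $T$ is satisfiable in a model of $T^*$, and such that $T^*$ has quantifier elimination (every formula $\varphi(\underline x)$ is $T^*$-equivalent to a quantifier-free formula $\varphi'(\underline x)$); it has an effective model completion if moreover $\varphi'$ can be computed from $\varphi$. A $T$-cover of $\exists\underline e\,\phi(\underline e,\underline y)$ is a quantifier-free formula $\psi(\underline y)$ such that $T\models\phi(\underline e,\underline y)\to\psi(\underline y)$ and such that $T\models\psi(\underline y)\to\theta(\underline y,\underline z)$ for every quantifier-free $\theta(\underline y,\underline z)$ with $T\models\phi(\underline e,\underline y)\to\theta(\underline y,\underline z)$. $T$ is stably infinite with respect to a set $\mathcal S$ of sorts if every $T$-satisfiable constraint is satisfiable in a model of $T$ in which all sorts of $\mathcal S$ are infinite. Let $T_1,T_2$ be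 universal theories in signatures $\Sigma_1,\Sigma_2$ that may share sorts, but share no symbols other than the equality predicates on the shared sorts. Suppose that the combination $T_1\cup T_2$ is tame: no shared sort is a domain sort of a function or relation symbol of $\Sigma_1$ other than equality (shared sorts may be codomain sorts of function symbols of $\Sigma_1$). Suppose that $T_1$ and $T_2$ have model completions and are stably infinite with respect to the set of shared sorts. Then: 1. $T_1\cup T_2$ has a model completion. 2. Covers in $T_1\cup T_2$ are computed by the following algorithm: it has an output on every primitive formula of $\Sigma_1\cup\Sigma_2$, and whatever choices are made, its output is a $T_1\cup T_2$-cover of the input. Let $e,x$ denote variables of sorts of $\Sigma_1$ that are not shared, and $\eta,\xi$ variables of sorts of $\Sigma_2$. (i) Up to the order of quantifiers and literals, write the input as $\exists\underline e\,\exists\underline\eta\,(\phi(\underline e,\underline x)\wedge\psi(\underline\eta,\underline\xi,\underline t(\underline e,\underline x)))$ with $\phi$ a conjunction of $\Sigma_1$-literals, $\psi$ a conjunction of $\Sigma_2$-literals and $\underline t$ terms of $\Sigma_1$ of shared sorts, and flatten it to $\exists\underline e\,\exists\underline\eta\,\exists\underline\eta'\,(\phi(\underline e,\underline x)\wedge\underline\eta'=\underline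 t(\underline e,\underline x)\wedge\psi(\underline\eta,\underline\xi,\underline\eta'))$ with fresh variables $\underline\eta'$. (ii) Take a $T_1$-cover of $\exists\underline e\,(\phi(\underline e,\underline x)\wedge\underline\eta'=\underline t(\underline e,\underline x))$ and put it in disjunctive normal form. Write each disjunct as $\phi_1(\underline x)\wedge\phi_2(\underline\eta',\underline t'(\underline x))$, where $\phi_1$ is a conjunction of $\Sigma_1$-literals in the variables $\underline x$, $\phi_2(\underline\eta',\underline\xi')$ is a conjunction of equalities and disequalities between variables of shared sorts, with $\underline\xi'$ fresh, and $\underline t'(\underline x)$ are $\Sigma_1$-terms of shared sorts. (iii) For each disjunct take a $T_2$-cover $\psi_1(\underline\xi,\underline\xi')$ of $\exists\underline\eta\,\exists\underline\eta'\,(\phi_2(\underline\eta',\underline\xi')\wedge\psi(\underline\eta,\underline\xi,\underline\eta'))$ and form $\phi_1(\underline x)\wedge\psi_1(\underline\xi,\underline t'(\underline x))$. The output is the disjunction of the formulas so obtained. 3. If the model completions of $T_1$ and $T_2$ are effective, then $T_1\cup T_2$ has an effective model completion, and there is a computable function that maps every primitive formula of $\Sigma_1\cup\Sigma_2$ to an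 output of the algorithm in 2. -/

import Mathlib

namespace ManySorted

/-! ### Many-sorted first-order logic with equality -/

/-- A many-sorted signature over the set of sorts `S`.  Equality on every sort is part of the logic
and is not listed among the relation symbols.  Constants are function symbols of arity zero. -/
structure Signature (S : Type) where
  Fn : Type
  Rel : Type
  fnArity : Fn → ℕ
  dom : (f : Fn) → Fin (fnArity f) → S
  cod : Fn → S
  relArity : Rel → ℕ
  relDom : (r : Rel) → Fin (relArity r) → S

/-- Terms, indexed by their sort.  For every sort `s` there are countably many variables
`(s, 0), (s, 1), …`. -/
inductive Term {S : Type} (L : Signature S) : S → Type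
  | var (s : S) (n : ℕ) : Term L s
  | app (f : L.Fn) (ts : (i : Fin (L.fnArity f)) → Term L (L.dom f i)) : Term L (L.cod f)

/-- Atomic formulae: equalities between terms of one sort, and relation symbols applied to terms. -/
inductive Atom {S : Type} (L : Signature S) : Type
  | eq (s : S) (t u : Term L s) : Atom L
  | rel (r : L.Rel) (ts : (i : Fin (L.relArity r)) → Term L (L.relDom r i)) : Atom L

inductive Formula {S : Type} (L : Signature S) : Type
  | bot : Formula L
  | atom (a : Atom L) : Formula L
  | not (φ : Formula L) : Formula L
  | and (φ χ : Formula L) : Formula L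
  | or (φ χ : Formula L) : Formula L
  | all (s : S) (n : ℕ) (φ : Formula L) : Formula L
  | ex (s : S) (n : ℕ) (φ : Formula L) : Formula L

/-- A literal is an atom with a sign (`true` for the atom, `false` for its negation). -/
abbrev Literal {S : Type} (L : Signature S) : Type := Atom L × Bool

section TermsAndFormulae

variable {S : Type} {L : Signature S}

/-- The variables that occur in a term. -/
def Term.vars : {s : S} → Term L s → Set (S × ℕ)
  | _, .var s n => {(s, n)}
  | _, .app _ ts => ⋃ i, (ts i).vars

def Atom.vars : Atom L → Set (S × ℕ)
  | .eq _ t u => t.vars ∪ u.vars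
  | .rel _ ts => ⋃ i, (ts i).vars

/-- The variables that occur free in a formula. -/
def Formula.fv : Formula L → Set (S × ℕ)
  | .bot => ∅
  | .atom a => a.vars
  | .not φ => φ.fv
  | .and φ χ => φ.fv ∪ χ.fv
  | .or φ χ => φ.fv ∪ χ.fv
  | .all s n φ => φ.fv \ {(s, n)}
  | .ex s n φ => φ.fv \ {(s, n)}

/-- Quantifier-free formulae. -/
def Formula.IsQF : Formula L → Prop
  | .bot => True
  | .atom _ => True
  | .not φ => φ.IsQF
  | .and φ χ => φ.IsQF ∧ χ.IsQF
  | .or φ χ => φ.IsQF ∧ χ.IsQF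
  | .all _ _ _ => False
  | .ex _ _ _ => False

/-- Finite conjunction (true when empty). -/
def Formula.conj : List (Formula L) → Formula L
  | [] => .not .bot
  | φ :: l => .and φ (Formula.conj l)

/-- Finite disjunction (false when empty). -/
def Formula.disj : List (Formula L) → Formula L
  | [] => .bot
  | φ :: l => .or φ (Formula.disj l)

/-- Existential quantification over a finite list of variables. -/
def Formula.exs : List (S × ℕ) → Formula L → Formula L
  | [], φ => φ
  | x :: l, φ => .ex x.1 x.2 (Formula.exs l φ)

/-- Universal quantification over a finite list of variables. -/
def Formula.alls : List (S × ℕ) → Formula L → Formula L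
  | [], φ => φ
  | x :: l, φ => .all x.1 x.2 (Formula.alls l φ)

def Literal.toFormula (l : Literal L) : Formula L :=
  if l.2 then .atom l.1 else .not (.atom l.1)

/-- The conjunction of a list of literals, i.e. a constraint. -/
def constraint (ls : List (Literal L)) : Formula L := Formula.conj (ls.map Literal.toFormula)

/-- The variables that occur in a list of literals. -/
def litVars (ls : List (Literal L)) : Set (S × ℕ) := {x | ∃ l ∈ ls, x ∈ l.1.vars}

/-- Simultaneous substitution of terms for variables. -/
def Term.subst (σ : (s : S) → ℕ → Term L s) : {s : S} → Term L s → Term L s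
  | _, .var s n => σ s n
  | _, .app f ts => .app f (fun i => (ts i).subst σ)

def Atom.subst (σ : (s : S) → ℕ → Term L s) : Atom L → Atom L
  | .eq s t u => .eq s (t.subst σ) (u.subst σ)
  | .rel r ts => .rel r (fun i => (ts i).subst σ)

/-- Substitution in a formula.  It is only ever applied to quantifier-free formulae; the clauses for
the quantifiers are there to make the function total. -/
def Formula.subst (σ : (s : S) → ℕ → Term L s) : Formula L → Formula L
  | .bot => .bot
  | .atom a => .atom (a.subst σ)
  | .not φ => .not (φ.subst σ)
  | .and φ χ => .and (φ.subst σ) (χ.subst σ)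
  | .or φ χ => .or (φ.subst σ) (χ.subst σ)
  | .all s n φ => .all s n (φ.subst σ)
  | .ex s n φ => .ex s n (φ.subst σ)

end TermsAndFormulae

/-- A structure; as usual, the interpretation of every sort is non-empty. -/
structure Struct {S : Type} (L : Signature S) where
  carrier : S → Type
  nonempty : ∀ s, Nonempty (carrier s)
  fn : (f : L.Fn) → ((i : Fin (L.fnArity f)) → carrier (L.dom f i)) → carrier (L.cod f)
  rel : (r : L.Rel) → ((i : Fin (L.relArity r)) → carrier (L.relDom r i)) → Prop

section Semantics

variable {S : Type} {L : Signature S}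

/-- Assignments of elements to the variables. -/
abbrev Assignment (M : Struct L) : Type := (s : S) → ℕ → M.carrier s

def Term.eval (M : Struct L) (v : Assignment M) : {s : S} → Term L s → M.carrier s
  | _, .var s n => v s n
  | _, .app f ts => M.fn f (fun i => (ts i).eval M v)

def Atom.Holds (M : Struct L) (v : Assignment M) : Atom L → Prop
  | .eq _ t u => t.eval M v = u.eval M v
  | .rel r ts => M.rel r (fun i => (ts i).eval M v)

/-- The assignments `v` and `w` agree on all variables other than `(s, n)`. -/
def AgreeOff {M : Struct L} (s : S) (n : ℕ) (v w : Assignment M) : Prop :=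
  ∀ s' m, (s', m) ≠ (s, n) → w s' m = v s' m

/-- Truth of a formula in a structure under an assignment. -/
def Formula.Sat (M : Struct L) : Assignment M → Formula L → Prop
  | _, .bot => False
  | v, .atom a => a.Holds M v
  | v, .not φ => ¬ φ.Sat M v
  | v, .and φ χ => φ.Sat M v ∧ χ.Sat M v
  | v, .or φ χ => φ.Sat M v ∨ χ.Sat M v
  | v, .all s n φ => ∀ w : Assignment M, AgreeOff s n v w → φ.Sat M w
  | v, .ex s n φ => ∃ w : Assignment M, AgreeOff s n v w ∧ φ.Sat M w

/-- `T` is a theory: a set of sentences. -/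
def IsTheory (T : Set (Formula L)) : Prop := ∀ φ ∈ T, φ.fv = ∅

/-- `M` is a model of `T`. -/
def Models (M : Struct L) (T : Set (Formula L)) : Prop :=
  ∀ φ ∈ T, ∀ v : Assignment M, φ.Sat M v

/-- `T` is a universal theory: a set of sentences of the form `∀ x₁ … ∀ xₙ χ` with `χ`
quantifier-free. -/
def IsUniversalTheory (T : Set (Formula L)) : Prop :=
  IsTheory T ∧ ∀ φ ∈ T, ∃ (xs : List (S × ℕ)) (χ : Formula L), χ.IsQF ∧ φ = Formula.alls xs χ

/-- `T ⊨ φ → χ`, for formulae that may have free variables. -/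
def Entails (T : Set (Formula L)) (φ χ : Formula L) : Prop :=
  ∀ M : Struct L, Models M T → ∀ v : Assignment M, φ.Sat M v → χ.Sat M v

/-- `φ` is `T`-satisfiable. -/
def Satisfiable (T : Set (Formula L)) (φ : Formula L) : Prop :=
  ∃ M : Struct L, Models M T ∧ ∃ v : Assignment M, φ.Sat M v

/-- `T` is stably infinite with respect to the set of sorts `K`. -/
def StablyInfinite (T : Set (Formula L)) (K : Set S) : Prop :=
  ∀ ls : List (Literal L), Satisfiable T (constraint ls) →
    ∃ M : Struct L, Models M T ∧ (∀ s ∈ K, Infinite (M.carrier s)) ∧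
      ∃ v : Assignment M, (constraint ls).Sat M v

/-- `φ'` is a quantifier-free formula that is `T`-equivalent to `φ`, in the free variables
of `φ`. -/
def IsQFEquivalent (T : Set (Formula L)) (φ φ' : Formula L) : Prop :=
  φ'.IsQF ∧ φ'.fv ⊆ φ.fv ∧ Entails T φ φ' ∧ Entails T φ' φ

def HasQE (T : Set (Formula L)) : Prop := ∀ φ : Formula L, ∃ φ', IsQFEquivalent T φ φ'

/-- `U` is a theory extending `T` such that every constraint satisfiable in a model of `T` is
satisfiable in a model of `U`. -/
def IsCompanion (T U : Set (Formula L)) : Prop :=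
  IsTheory U ∧ T ⊆ U ∧
    ∀ ls : List (Literal L), Satisfiable T (constraint ls) → Satisfiable U (constraint ls)

/-- The (universal) theory `T` has a model completion. -/
def HasModelCompletion (T : Set (Formula L)) : Prop :=
  ∃ U : Set (Formula L), IsCompanion T U ∧ HasQE U

/-- A primitive formula `∃ e φ`: a list `bv` of quantified variables and a list of literals. -/
structure Primitive (L : Signature S) where
  bv : List (S × ℕ)
  lits : List (Literal L)

def Primitive.formula (P : Primitive L) : Formula L := Formula.exs P.bv (constraint P.lits)

/-- All variables, free or quantified, of a primitive formula. -/
def Primitive.vars (P : Primitive L) : Set (S × ℕ) := {x | x ∈ P.bv} ∪ litVars P.lits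

/-- `ψ(y)` is a `T`-cover of the primitive formula `∃ e φ(e, y)`: it is quantifier-free,
`T ⊨ φ(e, y) → ψ(y)`, and `ψ` implies modulo `T` every quantifier-free `θ(y, z)` (in which the
`e` do not occur) such that `T ⊨ φ(e, y) → θ(y, z)`. -/
def IsCover (T : Set (Formula L)) (P : Primitive L) (ψ : Formula L) : Prop :=
  ψ.IsQF ∧ ψ.fv ⊆ P.formula.fv ∧ Entails T (constraint P.lits) ψ ∧
    ∀ θ : Formula L, θ.IsQF → (∀ x ∈ P.bv, x ∉ θ.fv) →
      Entails T (constraint P.lits) θ → Entails T ψ θ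

/-- The disjunction of the constraints in `D` is a disjunctive normal form of `φ`: it is logically
equivalent to `φ` and contains no new variable. -/
def IsDNF (φ : Formula L) (D : List (List (Literal L))) : Prop :=
  (∀ d ∈ D, litVars d ⊆ φ.fv) ∧
    ∀ (M : Struct L) (v : Assignment M), φ.Sat M v ↔ ∃ d ∈ D, (constraint d).Sat M v

end Semantics

/-! ### Effectiveness

Formulae over an encoded signature are coded by natural numbers; the code of a term records the sort
of each of its subterms. -/

section Effective

variable {S : Type} {L : Signature S} [Encodable S] [Encodable L.Fn] [Encodable L.Rel]

def Term.code : {s : S} → Term L s → ℕ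
  | _, .var s n => Nat.pair 0 (Nat.pair (Encodable.encode s) n)
  | _, .app f ts => Nat.pair 1 (Nat.pair (Encodable.encode (L.cod f))
      (Nat.pair (Encodable.encode f) (Encodable.encode (List.ofFn fun i => (ts i).code))))

def Atom.code : Atom L → ℕ
  | .eq s t u => Nat.pair 0 (Nat.pair (Encodable.encode s) (Nat.pair t.code u.code))
  | .rel r ts => Nat.pair 1 (Nat.pair (Encodable.encode r)
      (Encodable.encode (List.ofFn fun i => (ts i).code)))

def Formula.code : Formula L → ℕ
  | .bot => Nat.pair 0 0
  | .atom a => Nat.pair 1 a.code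
  | .not φ => Nat.pair 2 φ.code
  | .and φ χ => Nat.pair 3 (Nat.pair φ.code χ.code)
  | .or φ χ => Nat.pair 4 (Nat.pair φ.code χ.code)
  | .all s n φ => Nat.pair 5 (Nat.pair (Nat.pair (Encodable.encode s) n) φ.code)
  | .ex s n φ => Nat.pair 6 (Nat.pair (Nat.pair (Encodable.encode s) n) φ.code)

/-- Effective quantifier elimination: a computable function maps every formula to an equivalent
quantifier-free one. -/
def HasEffectiveQE (T : Set (Formula L)) : Prop :=
  ∃ g : ℕ → ℕ, Computable g ∧
    ∀ φ : Formula L, ∃ φ', IsQFEquivalent T φ φ' ∧ g φ.code = φ'.code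

/-- `T` has a model completion whose quantifier elimination is effective. -/
def HasEffectiveModelCompletion (T : Set (Formula L)) : Prop :=
  ∃ U : Set (Formula L), IsCompanion T U ∧ HasEffectiveQE U

end Effective

/-! ### Combinations of signatures

`A` is the set of sorts of the first signature only, `B` the set of sorts of the second signature
only, and `C` the set of shared sorts. -/

section Combination

variable {A B C : Type}

/-- The inclusion of the sorts of the first signature into all sorts. -/
def sortLeft : A ⊕ C → A ⊕ (B ⊕ C)
  | .inl a => .inl a
  | .inr c => .inr (.inr c)

/-- The inclusion of the sorts of the second signature into all sorts. -/
def sortRight : B ⊕ C → A ⊕ (B ⊕ C) := Sum.inr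

/-- The union of two signatures that share the sorts in `C` and no symbol but equality. -/
def combine (L₁ : Signature (A ⊕ C)) (L₂ : Signature (B ⊕ C)) : Signature (A ⊕ (B ⊕ C)) where
  Fn := L₁.Fn ⊕ L₂.Fn
  Rel := L₁.Rel ⊕ L₂.Rel
  fnArity
    | .inl f => L₁.fnArity f
    | .inr f => L₂.fnArity f
  dom
    | .inl f => fun i => sortLeft (L₁.dom f i)
    | .inr f => fun i => sortRight (L₂.dom f i)
  cod
    | .inl f => sortLeft (L₁.cod f)
    | .inr f => sortRight (L₂.cod f)
  relArity
    | .inl r => L₁.relArity r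
    | .inr r => L₂.relArity r
  relDom
    | .inl r => fun i => sortLeft (L₁.relDom r i)
    | .inr r => fun i => sortRight (L₂.relDom r i)

variable {L₁ : Signature (A ⊕ C)} {L₂ : Signature (B ⊕ C)}

instance [Encodable L₁.Fn] [Encodable L₂.Fn] : Encodable (combine L₁ L₂).Fn :=
  inferInstanceAs (Encodable (L₁.Fn ⊕ L₂.Fn))

instance [Encodable L₁.Rel] [Encodable L₂.Rel] : Encodable (combine L₁ L₂).Rel :=
  inferInstanceAs (Encodable (L₁.Rel ⊕ L₂.Rel))

/-- The combination is tame: a shared sort is never a domain sort of a function or relation symbol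
of the first signature (it can only be a codomain sort). -/
def Tame (L₁ : Signature (A ⊕ C)) (_L₂ : Signature (B ⊕ C)) : Prop :=
  (∀ (f : L₁.Fn) (i : Fin (L₁.fnArity f)) (c : C), L₁.dom f i ≠ Sum.inr c) ∧
    ∀ (r : L₁.Rel) (i : Fin (L₁.relArity r)) (c : C), L₁.relDom r i ≠ Sum.inr c

/-- A term over the first signature as a term over the union. -/
def Term.left (L₂ : Signature (B ⊕ C)) :
    {s : A ⊕ C} → Term L₁ s → Term (combine L₁ L₂) (sortLeft s)
  | _, .var s n => .var (sortLeft s) n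
  | _, .app f ts => Term.app (L := combine L₁ L₂) (Sum.inl f) (fun i => (ts i).left L₂)

/-- A term over the second signature as a term over the union. -/
def Term.right (L₁ : Signature (A ⊕ C)) :
    {s : B ⊕ C} → Term L₂ s → Term (combine L₁ L₂) (sortRight s)
  | _, .var s n => .var (sortRight s) n
  | _, .app f ts => Term.app (L := combine L₁ L₂) (Sum.inr f) (fun i => (ts i).right L₁)

def Atom.left (L₂ : Signature (B ⊕ C)) : Atom L₁ → Atom (combine L₁ L₂)
  | .eq s t u => .eq (sortLeft s) (t.left L₂) (u.left L₂)
  | .rel r ts => Atom.rel (L := combine L₁ L₂) (Sum.inl r) (fun i => (ts i).left L₂)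

def Atom.right (L₁ : Signature (A ⊕ C)) : Atom L₂ → Atom (combine L₁ L₂)
  | .eq s t u => .eq (sortRight s) (t.right L₁) (u.right L₁)
  | .rel r ts => Atom.rel (L := combine L₁ L₂) (Sum.inr r) (fun i => (ts i).right L₁)

def Formula.left (L₂ : Signature (B ⊕ C)) : Formula L₁ → Formula (combine L₁ L₂)
  | .bot => .bot
  | .atom a => .atom (a.left L₂)
  | .not φ => .not (φ.left L₂)
  | .and φ χ => .and (φ.left L₂) (χ.left L₂)
  | .or φ χ => .or (φ.left L₂) (χ.left L₂)
  | .all s n φ => .all (sortLeft s) n (φ.left L₂)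
  | .ex s n φ => .ex (sortLeft s) n (φ.left L₂)

def Formula.right (L₁ : Signature (A ⊕ C)) : Formula L₂ → Formula (combine L₁ L₂)
  | .bot => .bot
  | .atom a => .atom (a.right L₁)
  | .not φ => .not (φ.right L₁)
  | .and φ χ => .and (φ.right L₁) (χ.right L₁)
  | .or φ χ => .or (φ.right L₁) (χ.right L₁)
  | .all s n φ => .all (sortRight s) n (φ.right L₁)
  | .ex s n φ => .ex (sortRight s) n (φ.right L₁)

/-- The union `T₁ ∪ T₂` of two theories, over the union of their signatures. -/
def unionTheory (T₁ : Set (Formula L₁)) (T₂ : Set (Formula L₂)) : Set (Formula (combine L₁ L₂)) :=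
  Formula.left L₂ '' T₁ ∪ Formula.right L₁ '' T₂

/-! ### The three-step algorithm

Variables of sorts in `A` (sorts of the first signature only) are written `e`, `x`, and variables of
sorts of the second signature are written `η`, `ξ`.  Fresh variables `η'`, `ξ'` are always of shared
sorts, and are given as elements `(c, n)` of `C × ℕ`. -/

/-- All the variables in `V` are of sorts that belong to the first signature only. -/
def PrivateVars (V : Set ((A ⊕ C) × ℕ)) : Prop := ∀ x ∈ V, ∃ a : A, x.1 = Sum.inl a

open Classical in
/-- The substitution, in the union of the signatures, of the terms `t c n` over the first signature
for the variables `(c, n)` in the list `ys`. -/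
noncomputable def substShared (L₂ : Signature (B ⊕ C)) (ys : List (C × ℕ))
    (t : (c : C) → ℕ → Term L₁ (Sum.inr c)) :
    (s : A ⊕ (B ⊕ C)) → ℕ → Term (combine L₁ L₂) s
  | Sum.inl a, n => .var (Sum.inl a) n
  | Sum.inr (Sum.inl b), n => .var (Sum.inr (Sum.inl b)) n
  | Sum.inr (Sum.inr c), n => if (c, n) ∈ ys then (t c n).left L₂ else .var (Sum.inr (Sum.inr c)) n

/-- Step (i).  A flattening of a primitive formula `P` over the union of the signatures.  Up to the
order of the quantifiers and of the literals, `P` is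
`∃ e ∃ η (φ(e, x) ∧ ψ(η, ξ, t(e, x)))`, where `φ` is a list of literals over the first signature, `ψ`
one over the second signature and the `t` are terms over the first signature; it is flattened to
`∃ e ∃ η ∃ η' (φ(e, x) ∧ η' = t(e, x) ∧ ψ(η, ξ, η'))` with fresh variables `η'`. -/
structure Flattening (P : Primitive (combine L₁ L₂)) where
  e : List (A × ℕ)
  η : List ((B ⊕ C) × ℕ)
  φ : List (Literal L₁)
  ψ : List (Literal L₂)
  η' : List (C × ℕ)
  t : (c : C) → ℕ → Term L₁ (Sum.inr c)
  bv_perm : P.bv.Perm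
    (e.map (fun x => (Sum.inl x.1, x.2)) ++ η.map (fun x => (sortRight x.1, x.2)))
  lits_perm : P.lits.Perm
    (φ.map (fun l => (l.1.left L₂, l.2)) ++
      ψ.map (fun l => ((l.1.right L₁).subst (substShared L₂ η' t), l.2)))
  φ_private : PrivateVars (litVars φ)
  t_private : ∀ y ∈ η', PrivateVars (t y.1 y.2).vars
  fresh : ∀ y ∈ η', (Sum.inr (Sum.inr y.1), y.2) ∉ P.vars
  used : ∀ y ∈ η', (Sum.inr y.1, y.2) ∈ litVars ψ

/-- The primitive formula `∃ e (φ(e, x) ∧ η' = t(e, x))` over the first signature. -/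
def Flattening.primitiveOne {P : Primitive (combine L₁ L₂)} (F : Flattening P) : Primitive L₁ where
  bv := F.e.map (fun x => (Sum.inl x.1, x.2))
  lits := F.φ ++ F.η'.map (fun y => (.eq (Sum.inr y.1) (.var (Sum.inr y.1) y.2) (F.t y.1 y.2), true))

/-- A signed equality between two variables `(c, n)` and `(c, m)` of the same shared sort. -/
structure VarEq (C : Type) where
  sort : C
  n : ℕ
  m : ℕ
  sign : Bool

/-- The variables of a list of signed equalities. -/
def varEqVars (l : List (VarEq C)) : Set (C × ℕ) :=
  {y | ∃ q ∈ l, y = (q.sort, q.n) ∨ y = (q.sort, q.m)}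

/-- A signed equality between shared variables as a literal over the second signature. -/
def VarEq.toRight (L₂ : Signature (B ⊕ C)) (q : VarEq C) : Literal L₂ :=
  (.eq (Sum.inr q.sort) (.var (Sum.inr q.sort) q.n) (.var (Sum.inr q.sort) q.m), q.sign)

open Classical in
/-- The literal over the first signature obtained from a signed equality between shared variables by
putting the terms `t c n` for the variables `(c, n)` in the list `ys`. -/
noncomputable def VarEq.instLeft (ys : List (C × ℕ)) (t : (c : C) → ℕ → Term L₁ (Sum.inr c))
    (q : VarEq C) : Literal L₁ :=
  (.eq (Sum.inr q.sort)
    (if (q.sort, q.n) ∈ ys then t q.sort q.n else .var (Sum.inr q.sort) q.n)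
    (if (q.sort, q.m) ∈ ys then t q.sort q.m else .var (Sum.inr q.sort) q.m), q.sign)

/-- Second half of step (ii).  A disjunct `d` of the disjunctive normal form is written, up to the
order of its literals, as `φ₁(x) ∧ φ₂(η', t'(x))`, where `φ₂(η', ξ')` consists of equalities and
disequalities between variables and the `ξ'` are fresh variables for the terms `t'` over the first
signature. -/
structure Separation {P : Primitive (combine L₁ L₂)} (F : Flattening P) (d : List (Literal L₁)) where
  φ₁ : List (Literal L₁)
  φ₂ : List (VarEq C)
  ξ' : List (C × ℕ)
  t' : (c : C) → ℕ → Term L₁ (Sum.inr c)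
  perm : d.Perm (φ₁ ++ φ₂.map (VarEq.instLeft ξ' t'))
  φ₁_private : PrivateVars (litVars φ₁)
  t'_private : ∀ y ∈ ξ', PrivateVars (t' y.1 y.2).vars
  fresh : ∀ y ∈ ξ', (Sum.inr (Sum.inr y.1), y.2) ∉ P.vars ∧ y ∉ F.η'
  used : ∀ y ∈ ξ', y ∈ varEqVars φ₂

/-- The primitive formula `∃ η ∃ η' (φ₂(η', ξ') ∧ ψ(η, ξ, η'))` over the second signature. -/
def Separation.primitiveTwo {P : Primitive (combine L₁ L₂)} {F : Flattening P}
    {d : List (Literal L₁)} (G : Separation F d) : Primitive L₂ where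
  bv := F.η ++ F.η'.map (fun y => (Sum.inr y.1, y.2))
  lits := G.φ₂.map (VarEq.toRight L₂) ++ F.ψ

/-- The formula `φ₁(x) ∧ ψ₁(ξ, t'(x))`. -/
noncomputable def Separation.output {P : Primitive (combine L₁ L₂)} {F : Flattening P}
    {d : List (Literal L₁)} (G : Separation F d) (ψ₁ : Formula L₂) : Formula (combine L₁ L₂) :=
  .and ((constraint G.φ₁).left L₂) ((ψ₁.right L₁).subst (substShared L₂ G.ξ' G.t'))

/-- `out` is an output of the three-step algorithm on the primitive formula `P`: flatten `P`; take a
`T₁`-cover of `∃ e (φ(e, x) ∧ η' = t(e, x))` and put it in disjunctive normal form; for each disjunct,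
separated as `φ₁(x) ∧ φ₂(η', t'(x))`, take a `T₂`-cover `ψ₁(ξ, ξ')` of
`∃ η ∃ η' (φ₂(η', ξ') ∧ ψ(η, ξ, η'))` and form `φ₁(x) ∧ ψ₁(ξ, t'(x))`; `out` is the disjunction of the
formulae so obtained. -/
def IsThreeStepOutput (T₁ : Set (Formula L₁)) (T₂ : Set (Formula L₂))
    (P : Primitive (combine L₁ L₂)) (out : Formula (combine L₁ L₂)) : Prop :=
  ∃ (F : Flattening P) (φt : Formula L₁) (D : List (List (Literal L₁)))
    (outs : List (Formula (combine L₁ L₂))),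
    IsCover T₁ F.primitiveOne φt ∧ IsDNF φt D ∧
    List.Forall₂ (fun d o => ∃ (G : Separation F d) (ψ₁ : Formula L₂),
      IsCover T₂ G.primitiveTwo ψ₁ ∧ o = G.output ψ₁) D outs ∧
    out = Formula.disj outs

end Combination

end ManySorted

open ManySorted

namespace ManySorted

section Basics

variable {S : Type} {L : Signature S}

/-! ### Evaluation, substitution and coincidence -/

/-! Covers and model completions determine each other. In a model completion, a quantifier-free
equivalent of a primitive formula is a cover (`IsCompanion.isCover`). Conversely, if every primitive
formula has a cover, then the models of a universal theory in which covers imply the formulae they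
cover form an elementary class (`models_coverCompletion_iff`). On it, quantifiers are eliminated by
replacing primitive formulae with covers (`Formula.isQFEquivalent_qe`), and a chain of extensions
shows that every satisfiable constraint is satisfiable in the class (`exists_coverModel`).
Everything therefore reduces to two facts about the algorithm: it has outputs, and its outputs are
covers for the union.

The semantic content of a cover is an extension property: a countable model in which the cover holds
embeds into one in which the matrix holds (`IsCover.exists_extension`). This is compactness applied
to the diagram. The compactness theorem takes the part of an ultraproduct generated by the values of
the variables. There Łoś's theorem holds for quantifier-free formulae, universal theories remain
true, and the structure is countable when there are countably many terms.

That the input entails the output is direct: give `η'` and `ξ'` the values of the terms they stand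
for. For the converse, let a disjunct of the output hold in a countable model `M`
(`Separation.exists_extension`). The `T₂`-cover extends the second reduct of `M` to some `N₂` with
values for `η` and `η'`. This may add elements to the shared sorts. By tameness no symbol of the
first signature takes arguments of shared sorts, so the first reduct can simply be given the larger
shared sorts. The result is still a model of `T₁`: stable infiniteness extends the first reduct by
infinitely many shared elements, the enlarged reduct embeds into this extension, and `T₁` is
universal (`amalgam_models_left`). In it the `T₁`-cover holds, so a further extension `N₁` has
values for `e` with `η' = t(e, x)`. Stable infiniteness of `T₂` makes room in an extension of `N₂`
for the new shared elements of `N₁`, and the amalgam of `N₁` with that extension is a model of both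
theories in which the matrix of the input holds.

Outputs exist because, by tameness, a term of a shared sort over the first signature is either a
variable or has variables of private sorts only. For effectiveness the choice of fresh variables is
made canonical: the index of a fresh variable is an offset larger than all indices in the input,
plus twice the code of the term it stands for (for `η'`), or that number plus one (for `ξ'`).
Flattening, separation and substitution then become primitive recursive operations on codes, and
only the given functions that compute covers need more than primitive recursion. -/

theorem Term.eval_congr (M : Struct L) {v w : Assignment M} : ∀ {s : S} (t : Term L s),
    (∀ x ∈ t.vars, v x.1 x.2 = w x.1 x.2) → t.eval M v = t.eval M w
  | _, .var s n, h => h (s, n) rfl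
  | _, .app f ts, h => by
    simp only [Term.eval]
    congr 1
    funext i
    exact Term.eval_congr M (ts i) fun x hx => h x (Set.mem_iUnion.2 ⟨i, hx⟩)

theorem Atom.holds_congr (M : Struct L) {v w : Assignment M} (a : Atom L)
    (h : ∀ x ∈ a.vars, v x.1 x.2 = w x.1 x.2) : a.Holds M v ↔ a.Holds M w := by
  cases a with
  | eq s t u =>
    simp only [Atom.Holds]
    rw [t.eval_congr M fun x hx => h x (Or.inl hx), u.eval_congr M fun x hx => h x (Or.inr hx)]
  | rel r ts =>
    simp only [Atom.Holds]
    rw [show (fun i => (ts i).eval M v) = fun i => (ts i).eval M w from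
      funext fun i => (ts i).eval_congr M fun x hx => h x (Set.mem_iUnion.2 ⟨i, hx⟩)]

open Classical in
-- Serves the quantifier cases of the coincidence lemma: a change of one variable made to `v` is
-- repeated on `v'`, and the results agree wherever `v` and `v'` did, and at the changed variable.
theorem AgreeOff.exists_transfer {M : Struct L} {s : S} {n : ℕ} {v w v' : Assignment M}
    (h : AgreeOff s n v w) : ∃ w' : Assignment M, AgreeOff s n v' w' ∧
      ∀ x : S × ℕ, (x ≠ (s, n) → v x.1 x.2 = v' x.1 x.2) → w x.1 x.2 = w' x.1 x.2 := by
  refine ⟨fun s' m => if (s', m) = (s, n) then w s' m else v' s' m, ?_, ?_⟩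
  · intro s' m hm
    simp [hm]
  · intro x hx
    by_cases hxs : x = (s, n)
    · subst hxs; simp
    · have : (x.1, x.2) ≠ (s, n) := hxs
      simp only [this, if_false]
      rw [h _ _ this, hx hxs]

theorem Formula.sat_congr (M : Struct L) : ∀ (φ : Formula L) {v w : Assignment M},
    (∀ x ∈ φ.fv, v x.1 x.2 = w x.1 x.2) → (φ.Sat M v ↔ φ.Sat M w)
  | .bot, _, _, _ => Iff.rfl
  | .atom a, _, _, h => a.holds_congr M h
  | .not φ, _, _, h => not_congr (φ.sat_congr M h)
  | .and φ χ, _, _, h => and_congr (φ.sat_congr M fun x hx => h x (Or.inl hx))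
      (χ.sat_congr M fun x hx => h x (Or.inr hx))
  | .or φ χ, _, _, h => or_congr (φ.sat_congr M fun x hx => h x (Or.inl hx))
      (χ.sat_congr M fun x hx => h x (Or.inr hx))
  | .all s n φ, v, w, h => by
    constructor
    · intro H u hu
      obtain ⟨u', h1, h2⟩ := hu.exists_transfer (v' := v)
      refine (φ.sat_congr M fun x hx => h2 x fun hne => (h x ⟨hx, hne⟩).symm).2 (H u' h1)
    · intro H u hu
      obtain ⟨u', h1, h2⟩ := hu.exists_transfer (v' := w)
      refine (φ.sat_congr M fun x hx => h2 x fun hne => (h x ⟨hx, hne⟩)).2 (H u' h1)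
  | .ex s n φ, v, w, h => by
    constructor
    · rintro ⟨u, hu, H⟩
      obtain ⟨u', h1, h2⟩ := hu.exists_transfer (v' := w)
      exact ⟨u', h1, (φ.sat_congr M fun x hx => h2 x fun hne => (h x ⟨hx, hne⟩)).1 H⟩
    · rintro ⟨u, hu, H⟩
      obtain ⟨u', h1, h2⟩ := hu.exists_transfer (v' := v)
      exact ⟨u', h1, (φ.sat_congr M fun x hx => h2 x fun hne => (h x ⟨hx, hne⟩).symm).1 H⟩

theorem Term.eval_subst (M : Struct L) (v : Assignment M) (σ : (s : S) → ℕ → Term L s) :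
    ∀ {s : S} (t : Term L s), (t.subst σ).eval M v = t.eval M fun s n => (σ s n).eval M v
  | _, .var _ _ => rfl
  | _, .app f ts => by
    simp only [Term.subst, Term.eval]
    congr 1
    funext i
    exact Term.eval_subst M v σ (ts i)

theorem Atom.holds_subst (M : Struct L) (v : Assignment M) (σ : (s : S) → ℕ → Term L s)
    (a : Atom L) : (a.subst σ).Holds M v ↔ a.Holds M fun s n => (σ s n).eval M v := by
  cases a <;> simp [Atom.subst, Atom.Holds, Term.eval_subst]

/-- Quantifier-freeness is essential: `Formula.subst` neither renames nor protects bound variables.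
-/
theorem Formula.sat_subst (M : Struct L) (v : Assignment M) (σ : (s : S) → ℕ → Term L s) :
    ∀ (φ : Formula L), φ.IsQF →
      ((φ.subst σ).Sat M v ↔ φ.Sat M fun s n => (σ s n).eval M v)
  | .bot, _ => Iff.rfl
  | .atom a, _ => a.holds_subst M v σ
  | .not φ, h => not_congr (φ.sat_subst M v σ h)
  | .and φ χ, h => and_congr (φ.sat_subst M v σ h.1) (χ.sat_subst M v σ h.2)
  | .or φ χ, h => or_congr (φ.sat_subst M v σ h.1) (χ.sat_subst M v σ h.2)

theorem Formula.IsQF.subst (σ : (s : S) → ℕ → Term L s) :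
    ∀ {φ : Formula L}, φ.IsQF → (φ.subst σ).IsQF
  | .bot, _ => trivial
  | .atom _, _ => trivial
  | .not φ, h => Formula.IsQF.subst (φ := φ) σ h
  | .and _ _, h => ⟨Formula.IsQF.subst σ h.1, Formula.IsQF.subst σ h.2⟩
  | .or _ _, h => ⟨Formula.IsQF.subst σ h.1, Formula.IsQF.subst σ h.2⟩

theorem Term.vars_subst (σ : (s : S) → ℕ → Term L s) : ∀ {s : S} (t : Term L s),
    (t.subst σ).vars = ⋃ x ∈ t.vars, (σ x.1 x.2).vars
  | _, .var _ _ => by simp [Term.subst, Term.vars]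
  | _, .app f ts => by
    ext y
    simp only [Term.subst, Term.vars, Set.mem_iUnion, Term.vars_subst σ (ts _)]
    constructor
    · rintro ⟨i, x, hx, hy⟩; exact ⟨x, ⟨i, hx⟩, hy⟩
    · rintro ⟨x, ⟨i, hx⟩, hy⟩; exact ⟨i, x, hx, hy⟩

theorem Atom.vars_subst (σ : (s : S) → ℕ → Term L s) (a : Atom L) :
    (a.subst σ).vars = ⋃ x ∈ a.vars, (σ x.1 x.2).vars := by
  cases a with
  | eq s t u => simp only [Atom.subst, Atom.vars, Term.vars_subst, Set.biUnion_union]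
  | rel r ts =>
    ext y
    simp only [Atom.subst, Atom.vars, Set.mem_iUnion, Term.vars_subst σ (ts _)]
    constructor
    · rintro ⟨i, x, hx, hy⟩; exact ⟨x, ⟨i, hx⟩, hy⟩
    · rintro ⟨x, ⟨i, hx⟩, hy⟩; exact ⟨i, x, hx, hy⟩

theorem Formula.fv_subst (σ : (s : S) → ℕ → Term L s) : ∀ {φ : Formula L}, φ.IsQF →
    (φ.subst σ).fv = ⋃ x ∈ φ.fv, (σ x.1 x.2).vars
  | .bot, _ => by simp [Formula.subst, Formula.fv]
  | .atom a, _ => a.vars_subst σ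
  | .not φ, h => Formula.fv_subst (φ := φ) σ h
  | .and _ _, h => by
    simp only [Formula.subst, Formula.fv, Formula.fv_subst σ h.1, Formula.fv_subst σ h.2,
      Set.biUnion_union]
  | .or _ _, h => by
    simp only [Formula.subst, Formula.fv, Formula.fv_subst σ h.1, Formula.fv_subst σ h.2,
      Set.biUnion_union]

theorem Term.vars_finite : ∀ {s : S} (t : Term L s), t.vars.Finite
  | _, .var _ _ => Set.finite_singleton _
  | _, .app _ ts => Set.finite_iUnion fun i => (ts i).vars_finite

theorem Atom.vars_finite (a : Atom L) : a.vars.Finite := by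
  cases a with
  | eq s t u => exact t.vars_finite.union u.vars_finite
  | rel r ts => exact Set.finite_iUnion fun i => (ts i).vars_finite

theorem Formula.fv_finite : ∀ φ : Formula L, φ.fv.Finite
  | .bot => Set.finite_empty
  | .atom a => a.vars_finite
  | .not φ => φ.fv_finite
  | .and φ χ => φ.fv_finite.union χ.fv_finite
  | .or φ χ => φ.fv_finite.union χ.fv_finite
  | .all _ _ φ => φ.fv_finite.sdiff
  | .ex _ _ φ => φ.fv_finite.sdiff

theorem exists_index_bound {V : Set (S × ℕ)} (h : V.Finite) : ∃ K, ∀ x ∈ V, x.2 < K := by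
  obtain ⟨K, hK⟩ := (h.image Prod.snd).bddAbove
  exact ⟨K + 1, fun x hx => Nat.lt_succ_of_le (hK ⟨x, hx, rfl⟩)⟩

/-! ### Finite conjunctions, disjunctions and quantifier blocks -/

@[simp] theorem Formula.sat_conj (M : Struct L) (v : Assignment M) (l : List (Formula L)) :
    (Formula.conj l).Sat M v ↔ ∀ φ ∈ l, φ.Sat M v := by
  induction l with
  | nil => simp [Formula.conj, Formula.Sat]
  | cons φ l ih => simp [Formula.conj, Formula.Sat, ih]

@[simp] theorem Formula.sat_disj (M : Struct L) (v : Assignment M) (l : List (Formula L)) :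
    (Formula.disj l).Sat M v ↔ ∃ φ ∈ l, φ.Sat M v := by
  induction l with
  | nil => simp [Formula.disj, Formula.Sat]
  | cons φ l ih => simp [Formula.disj, Formula.Sat, ih]

theorem Formula.isQF_conj {l : List (Formula L)} (h : ∀ φ ∈ l, φ.IsQF) :
    (Formula.conj l).IsQF := by
  induction l with
  | nil => trivial
  | cons φ l ih =>
    exact ⟨h φ (by simp), ih fun χ hχ => h χ (by simp [hχ])⟩

theorem Formula.isQF_disj {l : List (Formula L)} (h : ∀ φ ∈ l, φ.IsQF) :
    (Formula.disj l).IsQF := by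
  induction l with
  | nil => trivial
  | cons φ l ih =>
    exact ⟨h φ (by simp), ih fun χ hχ => h χ (by simp [hχ])⟩

theorem Formula.mem_fv_conj {l : List (Formula L)} {x : S × ℕ} :
    x ∈ (Formula.conj l).fv ↔ ∃ φ ∈ l, x ∈ φ.fv := by
  induction l with
  | nil => simp [Formula.conj, Formula.fv]
  | cons φ l ih => simp [Formula.conj, Formula.fv, ih]

theorem Formula.mem_fv_disj {l : List (Formula L)} {x : S × ℕ} :
    x ∈ (Formula.disj l).fv ↔ ∃ φ ∈ l, x ∈ φ.fv := by
  induction l with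
  | nil => simp [Formula.disj, Formula.fv]
  | cons φ l ih => simp [Formula.disj, Formula.fv, ih]

/-- Truth of a literal. -/
def Literal.Holds (M : Struct L) (v : Assignment M) (l : Literal L) : Prop :=
  l.1.Holds M v ↔ l.2 = true

theorem Literal.sat_toFormula (M : Struct L) (v : Assignment M) (l : Literal L) :
    (Literal.toFormula l).Sat M v ↔ Literal.Holds M v l := by
  obtain ⟨a, b⟩ := l
  cases b <;> simp [Literal.toFormula, Literal.Holds, Formula.Sat]

theorem Literal.isQF_toFormula (l : Literal L) : (Literal.toFormula l).IsQF := by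
  obtain ⟨a, b⟩ := l
  cases b <;> simp [Literal.toFormula, Formula.IsQF]

theorem Literal.fv_toFormula (l : Literal L) : (Literal.toFormula l).fv = l.1.vars := by
  obtain ⟨a, b⟩ := l
  cases b <;> simp [Literal.toFormula, Formula.fv]

theorem sat_constraint (M : Struct L) (v : Assignment M) (ls : List (Literal L)) :
    (constraint ls).Sat M v ↔ ∀ l ∈ ls, Literal.Holds M v l := by
  simp only [constraint, Formula.sat_conj, List.forall_mem_map, Literal.sat_toFormula]

theorem isQF_constraint (ls : List (Literal L)) : (constraint ls).IsQF :=
  Formula.isQF_conj fun φ hφ => by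
    obtain ⟨l, _, rfl⟩ := List.mem_map.1 hφ
    exact l.isQF_toFormula

theorem fv_constraint (ls : List (Literal L)) : (constraint ls).fv = litVars ls := by
  ext x
  simp only [constraint, Formula.mem_fv_conj, List.mem_map, litVars, Set.mem_ofPred_eq]
  constructor
  · rintro ⟨_, ⟨l, hl, rfl⟩, hx⟩; exact ⟨l, hl, l.fv_toFormula ▸ hx⟩
  · rintro ⟨l, hl, hx⟩; exact ⟨_, ⟨l, hl, rfl⟩, l.fv_toFormula.symm ▸ hx⟩

theorem litVars_finite (ls : List (Literal L)) : (litVars ls).Finite :=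
  fv_constraint ls ▸ Formula.fv_finite _

theorem litVars_append (l l' : List (Literal L)) : litVars (l ++ l') = litVars l ∪ litVars l' := by
  ext x
  simp only [litVars, List.mem_append, Set.mem_ofPred_eq, Set.mem_union]
  constructor
  · rintro ⟨a, h | h, hx⟩
    exacts [Or.inl ⟨a, h, hx⟩, Or.inr ⟨a, h, hx⟩]
  · rintro (⟨a, h, hx⟩ | ⟨a, h, hx⟩)
    exacts [⟨a, Or.inl h, hx⟩, ⟨a, Or.inr h, hx⟩]

theorem litVars_perm {l l' : List (Literal L)} (h : l.Perm l') : litVars l = litVars l' := by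
  ext x
  simp only [litVars, h.mem_iff]

theorem sat_constraint_perm (M : Struct L) (v : Assignment M) {l l' : List (Literal L)}
    (h : l.Perm l') : (constraint l).Sat M v ↔ (constraint l').Sat M v := by
  simp only [sat_constraint, h.mem_iff]

theorem Formula.mem_fv_exs {xs : List (S × ℕ)} {φ : Formula L} {x : S × ℕ} :
    x ∈ (Formula.exs xs φ).fv ↔ x ∈ φ.fv ∧ x ∉ xs := by
  induction xs with
  | nil => simp [Formula.exs]
  | cons y l ih => simp [Formula.exs, Formula.fv, ih]; tauto

theorem Formula.mem_fv_alls {xs : List (S × ℕ)} {φ : Formula L} {x : S × ℕ} :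
    x ∈ (Formula.alls xs φ).fv ↔ x ∈ φ.fv ∧ x ∉ xs := by
  induction xs with
  | nil => simp [Formula.alls]
  | cons y l ih => simp [Formula.alls, Formula.fv, ih]; tauto

theorem Primitive.mem_fv_formula {P : Primitive L} {x : S × ℕ} :
    x ∈ P.formula.fv ↔ x ∈ litVars P.lits ∧ x ∉ P.bv := by
  rw [Primitive.formula, Formula.mem_fv_exs, fv_constraint]

open Classical in
theorem Formula.sat_exs (M : Struct L) {xs : List (S × ℕ)} {φ : Formula L} {v : Assignment M} :
    (Formula.exs xs φ).Sat M v ↔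
      ∃ w : Assignment M, (∀ s n, (s, n) ∉ xs → w s n = v s n) ∧ φ.Sat M w := by
  induction xs generalizing v with
  | nil =>
    constructor
    · intro h; exact ⟨v, fun _ _ _ => rfl, h⟩
    · rintro ⟨w, hw, h⟩
      obtain rfl : w = v := by funext s n; exact hw s n (by simp)
      exact h
  | cons y l ih =>
    simp only [Formula.exs, Formula.Sat, ih]
    constructor
    · rintro ⟨u, hu, w, hw, h⟩
      refine ⟨w, fun s n hn => ?_, h⟩
      simp only [List.mem_cons, not_or] at hn
      rw [hw s n hn.2, hu s n hn.1]
    · rintro ⟨w, hw, h⟩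
      refine ⟨fun s n => if (s, n) = y then w s n else v s n, fun s n hn => ?_, w, ?_, h⟩
      · have : (s, n) ≠ y := hn
        simp [this]
      · intro s n hn
        by_cases hy : (s, n) = y
        · simp [hy]
        · simp only [hy, if_false]
          exact hw s n (by simp [hy, hn])

/-- Validity under all assignments absorbs a universal prefix, so models of universal theories can
be discussed through quantifier-free matrices alone. -/
theorem Formula.forall_sat_alls (M : Struct L) {xs : List (S × ℕ)} {φ : Formula L} :
    (∀ v : Assignment M, (Formula.alls xs φ).Sat M v) ↔ ∀ v : Assignment M, φ.Sat M v := by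
  induction xs with
  | nil => rfl
  | cons y l ih =>
    rw [← ih]
    constructor
    · intro h v
      exact h v v fun _ _ _ => rfl
    · intro h v w _
      exact h w

theorem IsUniversalTheory.models_iff {T : Set (Formula L)} (hT : IsUniversalTheory T)
    (M : Struct L) : Models M T ↔ ∀ (xs : List (S × ℕ)) (χ : Formula L), χ.IsQF →
      Formula.alls xs χ ∈ T → ∀ v : Assignment M, χ.Sat M v := by
  constructor
  · intro h xs χ _ hm
    exact (Formula.forall_sat_alls M).1 (h _ hm)
  · intro h φ hφ
    obtain ⟨xs, χ, hχ, rfl⟩ := hT.2 φ hφ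
    exact (Formula.forall_sat_alls M).2 (h xs χ hχ hφ)

/-! ### Disjunctive normal forms -/

/-- All unions of a member of the first list with a member of the second. -/
def listProd {α : Type*} (l l' : List (List α)) : List (List α) :=
  l.flatMap fun a => l'.map fun b => a ++ b

/-- A disjunctive normal form of a quantifier-free formula and one of its negation. -/
def Formula.dnfPair : Formula L → List (List (Literal L)) × List (List (Literal L))
  | .bot => ([], [[]])
  | .atom a => ([[(a, true)]], [[(a, false)]])
  | .not φ => (φ.dnfPair.2, φ.dnfPair.1)
  | .and φ χ => (listProd φ.dnfPair.1 χ.dnfPair.1, φ.dnfPair.2 ++ χ.dnfPair.2)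
  | .or φ χ => (φ.dnfPair.1 ++ χ.dnfPair.1, listProd φ.dnfPair.2 χ.dnfPair.2)
  | .all _ _ _ => ([], [])
  | .ex _ _ _ => ([], [])

def Formula.dnf (φ : Formula L) : List (List (Literal L)) := φ.dnfPair.1

theorem exists_mem_listProd {α : Type*} {l l' : List (List α)} {p : α → Prop} :
    (∃ d ∈ listProd l l', ∀ a ∈ d, p a) ↔ (∃ d ∈ l, ∀ a ∈ d, p a) ∧ ∃ d ∈ l', ∀ a ∈ d, p a := by
  simp only [listProd, List.mem_flatMap, List.mem_map]
  constructor
  · rintro ⟨_, ⟨a, ha, b, hb, rfl⟩, h⟩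
    exact ⟨⟨a, ha, fun x hx => h x (by simp [hx])⟩, ⟨b, hb, fun x hx => h x (by simp [hx])⟩⟩
  · rintro ⟨⟨a, ha, h⟩, b, hb, h'⟩
    refine ⟨_, ⟨a, ha, b, hb, rfl⟩, fun x hx => ?_⟩
    rcases List.mem_append.1 hx with hx | hx
    exacts [h x hx, h' x hx]

/-- A formula and its negation are treated together because negation exchanges the two normal forms.
-/
theorem Formula.sat_dnfPair (M : Struct L) (v : Assignment M) : ∀ φ : Formula L, φ.IsQF →
    ((∃ d ∈ φ.dnfPair.1, ∀ l ∈ d, Literal.Holds M v l) ↔ φ.Sat M v) ∧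
    ((∃ d ∈ φ.dnfPair.2, ∀ l ∈ d, Literal.Holds M v l) ↔ ¬ φ.Sat M v)
  | .bot, _ => by simp [Formula.dnfPair, Formula.Sat]
  | .atom a, _ => by simp [Formula.dnfPair, Formula.Sat, Literal.Holds]
  | .not φ, h => by
    obtain ⟨h1, h2⟩ := φ.sat_dnfPair M v h
    simp only [Formula.dnfPair, Formula.Sat, h1, h2, not_not, and_self]
  | .and φ χ, h => by
    obtain ⟨h1, h2⟩ := φ.sat_dnfPair M v h.1
    obtain ⟨h3, h4⟩ := χ.sat_dnfPair M v h.2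
    simp only [Formula.dnfPair, Formula.Sat, exists_mem_listProd, h1, h3, List.mem_append, or_and_right,
      exists_or, h2, h4]
    tauto
  | .or φ χ, h => by
    obtain ⟨h1, h2⟩ := φ.sat_dnfPair M v h.1
    obtain ⟨h3, h4⟩ := χ.sat_dnfPair M v h.2
    simp only [Formula.dnfPair, Formula.Sat, exists_mem_listProd, h1, h3, List.mem_append, or_and_right,
      exists_or, h2, h4]
    tauto

theorem Formula.dnfPair_vars : ∀ φ : Formula L, φ.IsQF →
    ∀ d, (d ∈ φ.dnfPair.1 ∨ d ∈ φ.dnfPair.2) → litVars d ⊆ φ.fv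
  | .bot, _ => by
    rintro d (h | h) x ⟨l, hl, -⟩ <;> simp [Formula.dnfPair] at h
    simp [h] at hl
  | .atom a, _ => by
    rintro d (h | h) x ⟨l, hl, hx⟩ <;> simp only [Formula.dnfPair, List.mem_singleton] at h <;>
    · subst h
      simp only [List.mem_singleton] at hl
      subst hl
      exact hx
  | .not φ, h => fun d hd => φ.dnfPair_vars h d hd.symm
  | .and φ χ, h => by
    have h1 := φ.dnfPair_vars h.1
    have h2 := χ.dnfPair_vars h.2
    rintro d (hd | hd) x hx
    · simp only [Formula.dnfPair, listProd, List.mem_flatMap, List.mem_map] at hd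
      obtain ⟨a, ha, b, hb, rfl⟩ := hd
      rw [litVars_append] at hx
      exact hx.imp (fun hx => h1 a (Or.inl ha) hx) fun hx => h2 b (Or.inl hb) hx
    · rcases List.mem_append.1 hd with hd | hd
      exacts [Or.inl (h1 d (Or.inr hd) hx), Or.inr (h2 d (Or.inr hd) hx)]
  | .or φ χ, h => by
    have h1 := φ.dnfPair_vars h.1
    have h2 := χ.dnfPair_vars h.2
    rintro d (hd | hd) x hx
    · rcases List.mem_append.1 hd with hd | hd
      exacts [Or.inl (h1 d (Or.inl hd) hx), Or.inr (h2 d (Or.inl hd) hx)]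
    · simp only [Formula.dnfPair, listProd, List.mem_flatMap, List.mem_map] at hd
      obtain ⟨a, ha, b, hb, rfl⟩ := hd
      rw [litVars_append] at hx
      exact hx.imp (fun hx => h1 a (Or.inr ha) hx) fun hx => h2 b (Or.inr hb) hx

theorem Formula.isDNF_dnf {φ : Formula L} (h : φ.IsQF) : IsDNF φ φ.dnf :=
  ⟨fun d hd => φ.dnfPair_vars h d (Or.inl hd), fun M v => by
    rw [← (φ.sat_dnfPair M v h).1]
    simp only [Formula.dnf, sat_constraint]⟩

/-! ### Embeddings -/

/-- Embeddings of structures. -/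
structure Emb (M N : Struct L) where
  toFun : ∀ s, M.carrier s → N.carrier s
  inj : ∀ s, Function.Injective (toFun s)
  map_fn : ∀ f a, toFun _ (M.fn f a) = N.fn f fun i => toFun _ (a i)
  map_rel : ∀ r a, N.rel r (fun i => toFun _ (a i)) ↔ M.rel r a

theorem Emb.eval {M N : Struct L} (h : Emb M N) (v : Assignment M) : ∀ {s : S} (t : Term L s),
    t.eval N (fun s n => h.toFun s (v s n)) = h.toFun s (t.eval M v)
  | _, .var _ _ => rfl
  | _, .app f ts => by
    simp only [Term.eval, h.map_fn]
    congr 1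
    funext i
    exact h.eval v (ts i)

theorem Emb.holds {M N : Struct L} (h : Emb M N) (v : Assignment M) (a : Atom L) :
    a.Holds N (fun s n => h.toFun s (v s n)) ↔ a.Holds M v := by
  cases a with
  | eq s t u => simp only [Atom.Holds, h.eval, (h.inj s).eq_iff]
  | rel r ts => simp only [Atom.Holds, h.eval, h.map_rel]

theorem Emb.sat {M N : Struct L} (h : Emb M N) (v : Assignment M) : ∀ (φ : Formula L), φ.IsQF →
    (φ.Sat N (fun s n => h.toFun s (v s n)) ↔ φ.Sat M v)
  | .bot, _ => Iff.rfl
  | .atom a, _ => h.holds v a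
  | .not φ, hφ => not_congr (h.sat v φ hφ)
  | .and φ χ, hφ => and_congr (h.sat v φ hφ.1) (h.sat v χ hφ.2)
  | .or φ χ, hφ => or_congr (h.sat v φ hφ.1) (h.sat v χ hφ.2)

/-- Universal theories pass to substructures: a failure of the matrix in `M` is carried into `N` by
the embedding. -/
theorem IsUniversalTheory.models_of_emb {T : Set (Formula L)} (hT : IsUniversalTheory T)
    {M N : Struct L} (h : Emb M N) (hN : Models N T) : Models M T := by
  rw [hT.models_iff] at hN ⊢
  intro xs χ hχ hm v
  exact (h.sat v χ hχ).1 (hN xs χ hχ hm _)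

/-! ### Limits of structures along an ultrafilter -/

section Limit

variable {I : Type*} (𝒰 : Ultrafilter I) (M : I → Struct L) (v : ∀ i, Assignment (M i))

/-- Two terms are identified when they have equal values in almost all structures. -/
def limitSetoid (s : S) : Setoid (Term L s) where
  r t u := ∀ᶠ i in (𝒰 : Filter I), t.eval (M i) (v i) = u.eval (M i) (v i)
  iseqv :=
    { refl := fun _ => Filter.Eventually.of_forall fun _ => rfl
      symm := fun h => h.mono fun _ => Eq.symm
      trans := fun h h' => (h.and h').mono fun _ h => h.1.trans h.2 }

/-- The structure of values of terms in almost all of the given structures. -/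
noncomputable def limitStruct : Struct L where
  carrier s := Quotient (limitSetoid 𝒰 M v s)
  nonempty s := ⟨Quotient.mk _ (.var s 0)⟩
  fn f a := Quotient.mk _ (.app f fun i => (a i).out)
  rel r a := ∀ᶠ i in (𝒰 : Filter I), (M i).rel r fun j => (a j).out.eval (M i) (v i)

/-- The assignment of its own class to each variable. -/
def limitAssignment : Assignment (limitStruct 𝒰 M v) := fun s n => Quotient.mk _ (.var s n)

/-- The functions and relations of the limit are defined through chosen representatives; up to a
null set the choice does not matter. -/
theorem limit_out (s : S) (t : Term L s) : ∀ᶠ i in (𝒰 : Filter I),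
    (Quotient.mk (limitSetoid 𝒰 M v s) t).out.eval (M i) (v i) = t.eval (M i) (v i) :=
  Quotient.exact (Quotient.out_eq (Quotient.mk (limitSetoid 𝒰 M v s) t))

/-- The limit is generated by its variables: each of its elements is the value of a term under the
canonical assignment. -/
theorem limit_eval : ∀ {s : S} (t : Term L s),
    t.eval (limitStruct 𝒰 M v) (limitAssignment 𝒰 M v) = Quotient.mk (limitSetoid 𝒰 M v s) t
  | _, .var _ _ => rfl
  | _, .app f ts => by
    simp only [Term.eval, limit_eval (ts _)]
    refine Quotient.sound ?_
    have := Filter.eventually_all.2 fun j => limit_out 𝒰 M v _ (ts j)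
    refine this.mono fun i hi => ?_
    simp only [Term.eval]
    congr 1
    funext j
    exact hi j

theorem limit_holds (a : Atom L) : a.Holds (limitStruct 𝒰 M v) (limitAssignment 𝒰 M v) ↔
    ∀ᶠ i in (𝒰 : Filter I), a.Holds (M i) (v i) := by
  cases a with
  | eq s t u =>
    simp only [Atom.Holds, limit_eval]
    exact ⟨fun h => Quotient.exact h, fun h => Quotient.sound h⟩
  | rel r ts =>
    simp only [Atom.Holds, limit_eval]
    refine Filter.eventually_congr
      ((Filter.eventually_all.2 fun j => limit_out 𝒰 M v _ (ts j)).mono fun i hi => ?_)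
    rw [show (fun j => (Quotient.mk (limitSetoid 𝒰 M v _) (ts j)).out.eval (M i) (v i)) =
      fun j => (ts j).eval (M i) (v i) from funext hi]

/-- Łoś's theorem for quantifier-free formulae. The maximality of the ultrafilter enters for
negations and disjunctions. Quantifiers are excluded because a witness need not be the value of one
term in almost all structures. -/
theorem limit_sat : ∀ φ : Formula L, φ.IsQF →
    (φ.Sat (limitStruct 𝒰 M v) (limitAssignment 𝒰 M v) ↔
      ∀ᶠ i in (𝒰 : Filter I), φ.Sat (M i) (v i))
  | .bot, _ => by simpa [Formula.Sat] using 𝒰.neBot.ne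
  | .atom a, _ => limit_holds 𝒰 M v a
  | .not φ, h => by
    simp only [Formula.Sat, limit_sat φ h, Ultrafilter.eventually_not]
  | .and φ χ, h => by
    simp only [Formula.Sat, limit_sat φ h.1, limit_sat χ h.2, Filter.eventually_and]
  | .or φ χ, h => by
    simp only [Formula.Sat, limit_sat φ h.1, limit_sat χ h.2, Ultrafilter.eventually_or]

/-- An arbitrary assignment in the limit is a substitution of terms followed by the canonical
assignment, so each instance of a universal axiom reduces to a quantifier-free formula true in all
the given structures. -/
theorem limit_models {T : Set (Formula L)} (hT : IsUniversalTheory T)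
    (hM : ∀ i, Models (M i) T) : Models (limitStruct 𝒰 M v) T := by
  rw [hT.models_iff]
  intro xs χ hχ hm u
  have hu : u = fun s n =>
      (u s n).out.eval (limitStruct 𝒰 M v) (limitAssignment 𝒰 M v) := by
    funext s n
    rw [limit_eval]
    exact (Quotient.out_eq (u s n)).symm
  rw [hu, ← Formula.sat_subst _ _ _ χ hχ, limit_sat _ _ _ _ (hχ.subst _)]
  refine Filter.Eventually.of_forall fun i => ?_
  rw [Formula.sat_subst _ _ _ χ hχ]
  exact (hT.models_iff _).1 (hM i) xs χ hχ hm _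

instance limit_countable [∀ s, Countable (Term L s)] (s : S) :
    Countable ((limitStruct 𝒰 M v).carrier s) :=
  inferInstanceAs (Countable (Quotient (limitSetoid 𝒰 M v s)))

end Limit

/-- Compactness for universal theories and quantifier-free formulae. -/
theorem IsUniversalTheory.compactness [∀ s, Countable (Term L s)] {T : Set (Formula L)}
    (hT : IsUniversalTheory T) (φ : Formula L) (hφ : φ.IsQF) (Γ : Set (Formula L))
    (hΓ : ∀ θ ∈ Γ, θ.IsQF)
    (H : ∀ F : Finset (Formula L), (∀ θ ∈ F, θ ∈ Γ) →
      ∃ M : Struct L, Models M T ∧ ∃ v : Assignment M, φ.Sat M v ∧ ∀ θ ∈ F, θ.Sat M v) :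
    ∃ N : Struct L, Models N T ∧ (∀ s, Countable (N.carrier s)) ∧
      ∃ w : Assignment N, φ.Sat N w ∧ ∀ θ ∈ Γ, θ.Sat N w := by
  classical
  choose M hM v hv using fun F : Finset Γ => H (F.map (Function.Embedding.subtype _)) (by
    intro θ hθ
    simp only [Finset.mem_map, Function.Embedding.coe_subtype] at hθ
    obtain ⟨a, -, rfl⟩ := hθ
    exact a.2)
  -- This ultrafilter contains, for each `θ ∈ Γ`, the family of finite subsets containing `θ`, so
  -- each `θ` holds in almost all of the chosen models.
  let 𝒰 : Ultrafilter (Finset Γ) := Ultrafilter.of Filter.atTop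
  refine ⟨limitStruct 𝒰 M v, limit_models 𝒰 M v hT hM, inferInstance, limitAssignment 𝒰 M v,
    (limit_sat 𝒰 M v φ hφ).2 (Filter.Eventually.of_forall fun F => (hv F).1), fun θ hθ => ?_⟩
  refine (limit_sat 𝒰 M v θ (hΓ θ hθ)).2 ?_
  have h1 : ∀ᶠ F in (Filter.atTop : Filter (Finset Γ)), θ.Sat (M F) (v F) :=
    (Filter.eventually_ge_atTop {⟨θ, hθ⟩}).mono fun F hF =>
      (hv F).2 θ (by simpa [hθ] using hF)
  exact (Ultrafilter.of_le (Filter.atTop : Filter (Finset Γ))) h1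

/-- Every satisfiable quantifier-free formula is satisfiable in a countable model. -/
theorem IsUniversalTheory.exists_countable [∀ s, Countable (Term L s)] {T : Set (Formula L)}
    (hT : IsUniversalTheory T) {φ : Formula L} (hφ : φ.IsQF) (h : Satisfiable T φ) :
    ∃ N : Struct L, Models N T ∧ (∀ s, Countable (N.carrier s)) ∧
      ∃ w : Assignment N, φ.Sat N w := by
  obtain ⟨M, hM, v, hv⟩ := h
  obtain ⟨N, hN, hc, w, hw, -⟩ := hT.compactness φ hφ ∅ (by simp) fun F hF =>
    ⟨M, hM, v, hv, fun θ hθ => (hF θ hθ).elim⟩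
  exact ⟨N, hN, hc, w, hw⟩

end Basics

end ManySorted

namespace ManySorted

/-! ### Injectivity of codes and countability of the syntax -/

section Codes

variable {S : Type} {L : Signature S} [Encodable S] [Encodable L.Fn] [Encodable L.Rel]

omit [Encodable L.Rel] in
-- The conclusion is heterogeneous because the sort is an index of the type of terms; equality of
-- the sorts is recovered from the codes along with that of the terms.
theorem Term.heq_of_code_eq : ∀ {s : S} (t : Term L s) {s' : S} (t' : Term L s'),
    t.code = t'.code → s = s' ∧ t ≍ t'
  | s, .var _ n, s', .var _ n', h => by
    simp only [Term.code, Nat.pair_eq_pair, Encodable.encode_inj, true_and] at h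
    obtain ⟨rfl, rfl⟩ := h
    exact ⟨rfl, HEq.rfl⟩
  | _, .var _ _, _, .app _ _, h => by simp [Term.code] at h
  | _, .app _ _, _, .var _ _, h => by simp [Term.code] at h
  | _, .app f ts, _, .app f' ts', h => by
    simp only [Term.code, Nat.pair_eq_pair, Encodable.encode_inj, true_and] at h
    obtain ⟨-, rfl, h⟩ := h
    rw [List.ofFn_inj] at h
    have : ts = ts' := funext fun i => eq_of_heq ((ts i).heq_of_code_eq (ts' i) (congrFun h i)).2
    subst this
    exact ⟨rfl, HEq.rfl⟩

omit [Encodable L.Rel] in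
theorem Term.code_injective (s : S) : Function.Injective (Term.code : Term L s → ℕ) :=
  fun t t' h => eq_of_heq (t.heq_of_code_eq t' h).2

instance Term.countable (s : S) : Countable (Term L s) := (Term.code_injective s).countable

theorem Atom.code_injective : Function.Injective (Atom.code : Atom L → ℕ) := by
  rintro (⟨s, t, u⟩ | ⟨r, ts⟩) (⟨s', t', u'⟩ | ⟨r', ts'⟩) h
  · simp only [Atom.code, Nat.pair_eq_pair, Encodable.encode_inj, true_and] at h
    obtain ⟨rfl, h1, h2⟩ := h
    rw [Term.code_injective s h1, Term.code_injective s h2]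
  · simp [Atom.code] at h
  · simp [Atom.code] at h
  · simp only [Atom.code, Nat.pair_eq_pair, Encodable.encode_inj, true_and] at h
    obtain ⟨rfl, h⟩ := h
    rw [List.ofFn_inj] at h
    have : ts = ts' := funext fun i => Term.code_injective _ (congrFun h i)
    rw [this]

instance Atom.countable : Countable (Atom L) := Atom.code_injective.countable

instance Primitive.countable : Countable (Primitive L) :=
  Function.Injective.countable (f := fun P : Primitive L => (P.bv, P.lits)) (by
    rintro ⟨a, b⟩ ⟨c, d⟩ h
    simpa using h)

end Codes

/-! ### Extensions of countable models, from covers and from stable infiniteness -/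

section Extensions

variable {S : Type} {L : Signature S} [∀ s, Countable (Term L s)]

/-- The extension property of covers: a countable model of `T` in which a cover of `P` holds embeds
into a model of `T` in which the matrix of `P` holds, for suitable values of the bound variables. -/
theorem IsCover.exists_extension {T : Set (Formula L)} (hT : IsUniversalTheory T)
    {P : Primitive L} {ψ : Formula L} (hψ : IsCover T P ψ) (M : Struct L) (hM : Models M T)
    [∀ s, Countable (M.carrier s)] (v : Assignment M) (hv : ψ.Sat M v) :
    ∃ N : Struct L, Models N T ∧ (∀ s, Countable (N.carrier s)) ∧
      ∃ (h : Emb M N) (w : Assignment N), (constraint P.lits).Sat N w ∧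
        ∀ s n, (s, n) ∉ P.bv → w s n = h.toFun s (v s n) := by
  classical
  obtain ⟨K, hK⟩ := exists_index_bound
    ((P.bv.finite_toSet.union (litVars_finite P.lits)).union ψ.fv_finite)
  have hne := M.nonempty
  choose enum henum using fun s => exists_surjective_nat (M.carrier s)
  choose idx hidx using henum
  -- Indices below `K` suffice for everything that occurs in `P` and `ψ`. The variables from `K` on
  -- enumerate `M`, so that the quantifier-free formulae true under `v₀` include the diagram of `M`.
  let v₀ : Assignment M := fun s n => if n < K then v s n else enum s (n - K)
  have hv₀ : ∀ s n, n < K → v₀ s n = v s n := fun s n h => by simp [v₀, h]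
  have hv₁ : ∀ s m, v₀ s (K + idx s m) = m := fun s m => by simp [v₀, hidx]
  have hψ₀ : ψ.Sat M v₀ := by
    refine (ψ.sat_congr M fun x hx => ?_).2 hv
    exact hv₀ _ _ (hK x (Or.inr hx))
  obtain ⟨N, hN, hc, w, hw, hΓ⟩ := hT.compactness (constraint P.lits) (isQF_constraint _)
    {θ | θ.IsQF ∧ (∀ x ∈ P.bv, x ∉ θ.fv) ∧ θ.Sat M v₀} (fun θ h => h.1) (by
      intro F hF
      by_contra hcon
      push Not at hcon
      -- If the matrix were inconsistent with finitely many formulae of the diagram, it would entail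
      -- the negation of their conjunction. The bound variables do not occur there, so the cover
      -- would entail it too, contrary to the truth of the cover under `v₀`.
      have := hψ.2.2.2 (.not (Formula.conj F.toList))
        (Formula.isQF_conj fun θ hθ => (hF θ (by simpa using hθ)).1)
        (by
          intro x hx hfv
          obtain ⟨θ, hθ, hxθ⟩ := Formula.mem_fv_conj.1 hfv
          exact (hF θ (by simpa using hθ)).2.1 x hx hxθ)
        (by
          intro M' hM' v' hv' hcj
          obtain ⟨θ, hθ, hn⟩ := hcon M' hM' v' hv'
          exact hn ((Formula.sat_conj _ _ _).1 hcj θ (by simpa using hθ)))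
        M hM v₀ hψ₀
      refine this ((Formula.sat_conj _ _ _).2 fun θ hθ => ?_)
      exact (hF θ (by simpa using hθ)).2.2)
  have hbv : ∀ s k, (s, K + k) ∉ P.bv := fun s k hm => by
    have := hK _ (Or.inl (Or.inl hm))
    simp at this
  -- The diagram contains either the atom or its negation, so truth is both preserved and reflected.
  have key : ∀ a : Atom L, (∀ x ∈ P.bv, x ∉ a.vars) → (a.Holds N w ↔ a.Holds M v₀) := by
    intro a ha
    constructor
    · intro h
      by_contra hn
      exact hΓ (.not (.atom a)) ⟨trivial, ha, hn⟩ h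
    · intro h
      exact hΓ (.atom a) ⟨trivial, ha, h⟩
  let h : Emb M N :=
    { toFun := fun s m => w s (K + idx s m)
      inj := fun s m m' hm => by
        have := (key (.eq s (.var s (K + idx s m)) (.var s (K + idx s m'))) (by
          rintro x hx (rfl | rfl) <;> exact hbv _ _ hx)).1 hm
        simpa [Atom.Holds, Term.eval, hv₁] using this
      map_fn := fun f a => by
        have := (key (.eq _ (.var _ (K + idx _ (M.fn f a)))
          (.app f fun i => .var _ (K + idx _ (a i)))) (by
            rintro x hx (rfl | hx')
            · exact hbv _ _ hx
            · obtain ⟨i, rfl⟩ := Set.mem_iUnion.1 hx'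
              exact hbv _ _ hx)).2 (by simp [Atom.Holds, Term.eval, hv₁])
        simpa [Atom.Holds, Term.eval] using this
      map_rel := fun r a => by
        have := key (.rel r fun i => .var _ (K + idx _ (a i))) (by
            rintro x hx hx'
            obtain ⟨i, rfl⟩ := Set.mem_iUnion.1 hx'
            exact hbv _ _ hx)
        simpa [Atom.Holds, Term.eval, hv₁] using this }
  have hh : ∀ s n, (s, n) ∉ P.bv → w s n = h.toFun s (v₀ s n) := by
    intro s n hn
    refine (key (.eq s (.var s n) (.var s (K + idx s (v₀ s n)))) ?_).2 ?_
    · rintro x hx (rfl | rfl)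
      exacts [hn hx, hbv _ _ hx]
    · simp [Atom.Holds, Term.eval, hv₁]
  -- Outside the bound variables the required values come from `v`, not from `v₀`; the two differ
  -- only at indices from `K` on, which do not occur in the matrix.
  refine ⟨N, hN, hc, h, fun s n => if (s, n) ∈ P.bv then w s n else h.toFun s (v s n), ?_,
    fun s n hn => by simp [hn]⟩
  refine ((constraint P.lits).sat_congr N fun x hx => ?_).2 hw
  by_cases hxb : (x.1, x.2) ∈ P.bv
  · simp [hxb]
  · simp only [hxb, if_false]
    rw [hh _ _ hxb, hv₀ _ _ (hK x (Or.inl (Or.inr (fv_constraint P.lits ▸ hx))))]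

omit [∀ s, Countable (Term L s)] in
-- Stable infiniteness speaks of constraints; a true disjunct of a disjunctive normal form carries
-- it to quantifier-free formulae.
theorem StablyInfinite.exists_infinite {T : Set (Formula L)} {K : Set S} (h : StablyInfinite T K)
    {φ : Formula L} (hφ : φ.IsQF) (hs : Satisfiable T φ) :
    ∃ M : Struct L, Models M T ∧ (∀ s ∈ K, Infinite (M.carrier s)) ∧
      ∃ v : Assignment M, φ.Sat M v := by
  obtain ⟨M, hM, v, hv⟩ := hs
  obtain ⟨d, hd, hdv⟩ := ((Formula.isDNF_dnf hφ).2 M v).1 hv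
  obtain ⟨N, hN, hi, w, hw⟩ := h d ⟨M, hM, v, hdv⟩
  exact ⟨N, hN, hi, w, ((Formula.isDNF_dnf hφ).2 N w).2 ⟨d, hd, hw⟩⟩

/-- For a universal theory that is stably infinite with respect to `K`, every countable model embeds
into one with infinitely many new elements in all the sorts of `K`. -/
theorem StablyInfinite.exists_extension {T : Set (Formula L)} (hT : IsUniversalTheory T)
    {K : Set S} (si : StablyInfinite T K) (M : Struct L) (hM : Models M T)
    [∀ s, Countable (M.carrier s)] :
    ∃ N : Struct L, Models N T ∧ (∀ s, Countable (N.carrier s)) ∧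
      ∃ h : Emb M N, ∀ s ∈ K, (Set.range (h.toFun s))ᶜ.Infinite := by
  classical
  have hne := M.nonempty
  choose enum henum using fun s => exists_surjective_nat (M.carrier s)
  choose idx hidx using henum
  -- Variables of even index name all elements of `M`; those of odd index are kept for the new
  -- elements. `Γ₀` is the diagram in even variables, and `Γ₁` makes each odd variable of a sort in
  -- `K` differ from every other variable of that sort.
  let v₀ : Assignment M := fun s n => enum s (n / 2)
  have hv₁ : ∀ s m, v₀ s (2 * idx s m) = m := fun s m => by simp [v₀, hidx]
  let Γ₀ : Set (Formula L) := {θ | θ.IsQF ∧ (∀ x ∈ θ.fv, Even x.2) ∧ θ.Sat M v₀}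
  let Γ₁ : Set (Formula L) := {θ | ∃ s ∈ K, ∃ m n, n ≠ 2 * m + 1 ∧
    θ = .not (.atom (.eq s (.var s (2 * m + 1)) (.var s n)))}
  obtain ⟨N, hN, hc, w, -, hΓ⟩ := hT.compactness (.not .bot) trivial (Γ₀ ∪ Γ₁)
    (by
      rintro θ (h | ⟨s, -, m, n, -, rfl⟩)
      exacts [h.1, trivial]) (by
      intro F hF
      -- The part of the diagram in the finite set `F` is true in `M`, hence also satisfiable in a
      -- model with infinite sorts in `K`. There the odd variables can take distinct values that
      -- avoid the finitely many values of the variables with indices below `B`.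
      obtain ⟨M', hM', hi, v', hv'⟩ := si.exists_infinite
        (φ := Formula.conj (F.filter (· ∈ Γ₀)).toList)
        (Formula.isQF_conj fun θ hθ => (Finset.mem_filter.1 (Finset.mem_toList.1 hθ)).2.1)
        ⟨M, hM, v₀, (Formula.sat_conj _ _ _).2 fun θ hθ =>
          (Finset.mem_filter.1 (Finset.mem_toList.1 hθ)).2.2.2⟩
      obtain ⟨B, hB⟩ := exists_index_bound (V := ⋃ θ ∈ F, θ.fv)
        (F.finite_toSet.biUnion fun θ _ => θ.fv_finite)
      have hinf : ∀ s, ∃ u : ℕ → M'.carrier s, s ∈ K →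
          Function.Injective u ∧ ∀ m n, n < B → u m ≠ v' s n := by
        intro s
        by_cases hs : s ∈ K
        · have := hi s hs
          have hfin : ((fun n => v' s n) '' Set.Iio B).Finite := (Set.finite_Iio B).image _
          have := hfin.infinite_compl
          refine ⟨fun m => (this.natEmbedding _ m).1, fun _ => ⟨fun a b hab => ?_, ?_⟩⟩
          · exact (this.natEmbedding _).injective (Subtype.ext hab)
          · intro m n hn he
            exact (this.natEmbedding _ m).2 ⟨n, hn, he.symm⟩
        · exact ⟨fun m => v' s 0, fun h => (hs h).elim⟩
      choose u hu using hinf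
      refine ⟨M', hM', fun s n => if Even n then v' s n else u s (n / 2), by simp [Formula.Sat], ?_⟩
      intro θ hθ
      rcases hF θ hθ with h0 | ⟨s, hs, m, n, hn, rfl⟩
      · refine (θ.sat_congr M' fun x hx => ?_).2 ((Formula.sat_conj _ _ _).1 hv' θ
          (Finset.mem_toList.2 (Finset.mem_filter.2 ⟨hθ, h0⟩)))
        simp [h0.2.1 x hx]
      · have hnB : n < B := hB (s, n) (Set.mem_biUnion hθ (Or.inr rfl))
        have hodd : ¬ Even (2 * m + 1) := by simp
        have hm : (2 * m + 1) / 2 = m := by omega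
        simp only [Formula.Sat, Atom.Holds, Term.eval, hodd, if_false, hm]
        by_cases he : Even n
        · simp only [he, if_true]
          exact (hu s hs).2 m n hnB
        · simp only [he, if_false]
          intro h
          have := (hu s hs).1 h
          rw [Nat.not_even_iff_odd] at he
          obtain ⟨k, rfl⟩ := he
          omega)
  have key : ∀ a : Atom L, (∀ x ∈ a.vars, Even x.2) → (a.Holds N w ↔ a.Holds M v₀) := by
    intro a ha
    constructor
    · intro h
      by_contra hn
      exact hΓ (.not (.atom a)) (Or.inl ⟨trivial, ha, hn⟩) h
    · intro h
      exact hΓ (.atom a) (Or.inl ⟨trivial, ha, h⟩)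
  have hev : ∀ k, Even (2 * k) := fun k => even_two_mul k
  let h : Emb M N :=
    { toFun := fun s m => w s (2 * idx s m)
      inj := fun s m m' hm => by
        have := (key (.eq s (.var s (2 * idx s m)) (.var s (2 * idx s m'))) (by
          rintro x (rfl | rfl) <;> exact hev _)).1 (by simpa [Atom.Holds, Term.eval] using hm)
        simpa [Atom.Holds, Term.eval, hv₁] using this
      map_fn := fun f a => by
        have := (key (.eq _ (.var _ (2 * idx _ (M.fn f a)))
          (.app f fun i => .var _ (2 * idx _ (a i)))) (by
            rintro x (rfl | hx')
            · exact hev _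
            · obtain ⟨i, rfl⟩ := Set.mem_iUnion.1 hx'
              exact hev _)).2 (by simp [Atom.Holds, Term.eval, hv₁])
        simpa [Atom.Holds, Term.eval] using this
      map_rel := fun r a => by
        have := key (.rel r fun i => .var _ (2 * idx _ (a i))) (by
            rintro x hx'
            obtain ⟨i, rfl⟩ := Set.mem_iUnion.1 hx'
            exact hev _)
        simpa [Atom.Holds, Term.eval, hv₁] using this }
  refine ⟨N, hN, hc, h, fun s hs => ?_⟩
  have hne' : ∀ m n, n ≠ 2 * m + 1 → w s (2 * m + 1) ≠ w s n := fun m n hn =>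
    hΓ _ (Or.inr ⟨s, hs, m, n, hn, rfl⟩)
  -- The values of the odd variables are pairwise distinct and differ from those of the even ones,
  -- which give the image of `M`.
  refine Set.infinite_of_injective_forall_mem (f := fun m => w s (2 * m + 1)) ?_ ?_
  · intro m m' he
    by_contra hmm
    exact hne' m (2 * m' + 1) (by omega) he
  · rintro m ⟨y, hy⟩
    exact hne' m (2 * idx s y) (by omega) hy.symm

end Extensions

/-! ### Reducts, unions of theories, and amalgams along the shared sorts -/

section Amalgam

variable {A B C : Type} {L₁ : Signature (A ⊕ C)} {L₂ : Signature (B ⊕ C)}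

/-- The reduct of a structure to the first signature. -/
def Struct.left (M : Struct (combine L₁ L₂)) : Struct L₁ where
  carrier s := M.carrier (sortLeft s)
  nonempty _ := M.nonempty _
  fn f a := M.fn (Sum.inl f) a
  rel r a := M.rel (Sum.inl r) a

/-- The reduct of a structure to the second signature. -/
def Struct.right (M : Struct (combine L₁ L₂)) : Struct L₂ where
  carrier s := M.carrier (sortRight s)
  nonempty _ := M.nonempty _
  fn f a := M.fn (Sum.inr f) a
  rel r a := M.rel (Sum.inr r) a

def Assignment.left {M : Struct (combine L₁ L₂)} (v : Assignment M) : Assignment M.left :=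
  fun s n => v (sortLeft s) n

def Assignment.right {M : Struct (combine L₁ L₂)} (v : Assignment M) : Assignment M.right :=
  fun s n => v (sortRight s) n

theorem Term.eval_left (M : Struct (combine L₁ L₂)) (v : Assignment M) : ∀ {s} (t : Term L₁ s),
    (t.left L₂).eval M v = t.eval M.left (Assignment.left v)
  | _, .var _ _ => rfl
  | _, .app f ts => by
    simp only [Term.left, Term.eval, Struct.left]
    congr 1
    funext i
    exact Term.eval_left M v (ts i)

theorem Term.eval_right (M : Struct (combine L₁ L₂)) (v : Assignment M) : ∀ {s} (t : Term L₂ s),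
    (t.right L₁).eval M v = t.eval M.right (Assignment.right v)
  | _, .var _ _ => rfl
  | _, .app f ts => by
    simp only [Term.right, Term.eval, Struct.right]
    congr 1
    funext i
    exact Term.eval_right M v (ts i)

theorem Atom.holds_left (M : Struct (combine L₁ L₂)) (v : Assignment M) (a : Atom L₁) :
    (a.left L₂).Holds M v ↔ a.Holds M.left (Assignment.left v) := by
  cases a with
  | eq s t u => simp only [Atom.left, Atom.Holds, Term.eval_left]; rfl
  | rel r ts =>
    exact iff_of_eq (congrArg (M.rel (Sum.inl r)) (funext fun i => Term.eval_left M v (ts i)))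

theorem Atom.holds_right (M : Struct (combine L₁ L₂)) (v : Assignment M) (a : Atom L₂) :
    (a.right L₁).Holds M v ↔ a.Holds M.right (Assignment.right v) := by
  cases a with
  | eq s t u => simp only [Atom.right, Atom.Holds, Term.eval_right]; rfl
  | rel r ts =>
    exact iff_of_eq (congrArg (M.rel (Sum.inr r)) (funext fun i => Term.eval_right M v (ts i)))

theorem Formula.sat_left (M : Struct (combine L₁ L₂)) (v : Assignment M) :
    ∀ φ : Formula L₁, φ.IsQF → ((φ.left L₂).Sat M v ↔ φ.Sat M.left (Assignment.left v))
  | .bot, _ => Iff.rfl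
  | .atom a, _ => a.holds_left M v
  | .not φ, h => not_congr (φ.sat_left M v h)
  | .and φ χ, h => and_congr (φ.sat_left M v h.1) (χ.sat_left M v h.2)
  | .or φ χ, h => or_congr (φ.sat_left M v h.1) (χ.sat_left M v h.2)

theorem Formula.sat_right (M : Struct (combine L₁ L₂)) (v : Assignment M) :
    ∀ φ : Formula L₂, φ.IsQF → ((φ.right L₁).Sat M v ↔ φ.Sat M.right (Assignment.right v))
  | .bot, _ => Iff.rfl
  | .atom a, _ => a.holds_right M v
  | .not φ, h => not_congr (φ.sat_right M v h)
  | .and φ χ, h => and_congr (φ.sat_right M v h.1) (χ.sat_right M v h.2)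
  | .or φ χ, h => or_congr (φ.sat_right M v h.1) (χ.sat_right M v h.2)

theorem Formula.IsQF.left : ∀ {φ : Formula L₁}, φ.IsQF → (φ.left L₂).IsQF
  | .bot, _ => trivial
  | .atom _, _ => trivial
  | .not φ, h => Formula.IsQF.left (φ := φ) h
  | .and _ _, h => ⟨Formula.IsQF.left h.1, Formula.IsQF.left h.2⟩
  | .or _ _, h => ⟨Formula.IsQF.left h.1, Formula.IsQF.left h.2⟩

theorem Formula.IsQF.right : ∀ {φ : Formula L₂}, φ.IsQF → (φ.right L₁).IsQF
  | .bot, _ => trivial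
  | .atom _, _ => trivial
  | .not φ, h => Formula.IsQF.right (φ := φ) h
  | .and _ _, h => ⟨Formula.IsQF.right h.1, Formula.IsQF.right h.2⟩
  | .or _ _, h => ⟨Formula.IsQF.right h.1, Formula.IsQF.right h.2⟩

theorem Term.vars_left : ∀ {s} (t : Term L₁ s),
    (t.left L₂).vars = (fun x => (sortLeft x.1, x.2)) '' t.vars
  | _, .var _ _ => by simp [Term.left, Term.vars]
  | _, .app f ts => by
    simp only [Term.left, Term.vars, Set.image_iUnion]
    exact Set.iUnion_congr fun i => (ts i).vars_left

theorem Term.vars_right : ∀ {s} (t : Term L₂ s),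
    (t.right L₁).vars = (fun x => (sortRight x.1, x.2)) '' t.vars
  | _, .var _ _ => by simp [Term.right, Term.vars]
  | _, .app f ts => by
    simp only [Term.right, Term.vars, Set.image_iUnion]
    exact Set.iUnion_congr fun i => (ts i).vars_right

theorem Atom.vars_left (a : Atom L₁) :
    (a.left L₂).vars = (fun x => (sortLeft x.1, x.2)) '' a.vars := by
  cases a with
  | eq s t u => simp only [Atom.left, Atom.vars, Term.vars_left, Set.image_union]
  | rel r ts =>
    simp only [Atom.left, Atom.vars, Set.image_iUnion]
    exact Set.iUnion_congr fun i => (ts i).vars_left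

theorem Atom.vars_right (a : Atom L₂) :
    (a.right L₁).vars = (fun x => (sortRight x.1, x.2)) '' a.vars := by
  cases a with
  | eq s t u => simp only [Atom.right, Atom.vars, Term.vars_right, Set.image_union]
  | rel r ts =>
    simp only [Atom.right, Atom.vars, Set.image_iUnion]
    exact Set.iUnion_congr fun i => (ts i).vars_right

theorem Formula.fv_left_subset : ∀ φ : Formula L₁,
    (φ.left L₂).fv ⊆ (fun x => (sortLeft x.1, x.2)) '' φ.fv
  | .bot => by simp [Formula.left, Formula.fv]
  | .atom a => (a.vars_left (L₂ := L₂)).subset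
  | .not φ => φ.fv_left_subset
  | .and φ χ => by
    rw [Formula.fv, Set.image_union]
    exact Set.union_subset_union φ.fv_left_subset χ.fv_left_subset
  | .or φ χ => by
    rw [Formula.fv, Set.image_union]
    exact Set.union_subset_union φ.fv_left_subset χ.fv_left_subset
  | .all s n φ => by
    rintro x ⟨hx, hn⟩
    obtain ⟨y, hy, rfl⟩ := φ.fv_left_subset hx
    exact ⟨y, ⟨hy, fun h => hn (by rw [Set.mem_singleton_iff.1 h]; rfl)⟩, rfl⟩
  | .ex s n φ => by
    rintro x ⟨hx, hn⟩
    obtain ⟨y, hy, rfl⟩ := φ.fv_left_subset hx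
    exact ⟨y, ⟨hy, fun h => hn (by rw [Set.mem_singleton_iff.1 h]; rfl)⟩, rfl⟩

theorem Formula.fv_right_subset : ∀ φ : Formula L₂,
    (φ.right L₁).fv ⊆ (fun x => (sortRight x.1, x.2)) '' φ.fv
  | .bot => by simp [Formula.right, Formula.fv]
  | .atom a => (a.vars_right (L₁ := L₁)).subset
  | .not φ => φ.fv_right_subset
  | .and φ χ => by
    rw [Formula.fv, Set.image_union]
    exact Set.union_subset_union φ.fv_right_subset χ.fv_right_subset
  | .or φ χ => by
    rw [Formula.fv, Set.image_union]
    exact Set.union_subset_union φ.fv_right_subset χ.fv_right_subset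
  | .all s n φ => by
    rintro x ⟨hx, hn⟩
    obtain ⟨y, hy, rfl⟩ := φ.fv_right_subset hx
    exact ⟨y, ⟨hy, fun h => hn (by rw [Set.mem_singleton_iff.1 h]; rfl)⟩, rfl⟩
  | .ex s n φ => by
    rintro x ⟨hx, hn⟩
    obtain ⟨y, hy, rfl⟩ := φ.fv_right_subset hx
    exact ⟨y, ⟨hy, fun h => hn (by rw [Set.mem_singleton_iff.1 h]; rfl)⟩, rfl⟩

theorem Formula.left_alls (xs : List ((A ⊕ C) × ℕ)) (χ : Formula L₁) :
    (Formula.alls xs χ).left L₂ =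
      Formula.alls (xs.map fun x => (sortLeft x.1, x.2)) (χ.left L₂) := by
  induction xs with
  | nil => rfl
  | cons x l ih => simp only [Formula.alls, Formula.left, ih, List.map_cons]

theorem Formula.right_alls (xs : List ((B ⊕ C) × ℕ)) (χ : Formula L₂) :
    (Formula.alls xs χ).right L₁ =
      Formula.alls (xs.map fun x => (sortRight x.1, x.2)) (χ.right L₁) := by
  induction xs with
  | nil => rfl
  | cons x l ih => simp only [Formula.alls, Formula.right, ih, List.map_cons]

theorem isUniversalTheory_union {T₁ : Set (Formula L₁)} {T₂ : Set (Formula L₂)}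
    (h₁ : IsUniversalTheory T₁) (h₂ : IsUniversalTheory T₂) :
    IsUniversalTheory (unionTheory T₁ T₂) := by
  constructor
  · rintro _ (⟨φ, hφ, rfl⟩ | ⟨φ, hφ, rfl⟩)
    · have := φ.fv_left_subset (L₂ := L₂)
      rwa [h₁.1 φ hφ, Set.image_empty, Set.subset_empty_iff] at this
    · have := φ.fv_right_subset (L₁ := L₁)
      rwa [h₂.1 φ hφ, Set.image_empty, Set.subset_empty_iff] at this
  · rintro _ (⟨φ, hφ, rfl⟩ | ⟨φ, hφ, rfl⟩)
    · obtain ⟨xs, χ, hχ, rfl⟩ := h₁.2 φ hφ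
      exact ⟨_, _, hχ.left, Formula.left_alls xs χ⟩
    · obtain ⟨xs, χ, hχ, rfl⟩ := h₂.2 φ hφ
      exact ⟨_, _, hχ.right, Formula.right_alls xs χ⟩

/-- The sorts missing from the first signature are non-empty, so their variables can be given
arbitrary values. -/
theorem exists_assignment_left (M : Struct (combine L₁ L₂)) (u : Assignment M.left) :
    ∃ v : Assignment M, Assignment.left v = u := by
  have hne := M.nonempty
  refine ⟨fun s => match s with
    | .inl a => u (.inl a)
    | .inr (.inl b) => fun _ => (hne (.inr (.inl b))).some
    | .inr (.inr c) => u (.inr c), ?_⟩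
  funext s n
  rcases s with a | c <;> rfl

theorem exists_assignment_right (M : Struct (combine L₁ L₂)) (u : Assignment M.right) :
    ∃ v : Assignment M, Assignment.right v = u := by
  have hne := M.nonempty
  refine ⟨fun s => match s with
    | .inl a => fun _ => (hne (.inl a)).some
    | .inr s => u s, ?_⟩
  rfl

/-- For quantifier-free formulae truth in a structure and in its reduct coincide, and assignments of
the reducts lift; universality reduces the axioms to this case. -/
theorem models_union_iff {T₁ : Set (Formula L₁)} {T₂ : Set (Formula L₂)}
    (h₁ : IsUniversalTheory T₁) (h₂ : IsUniversalTheory T₂) (M : Struct (combine L₁ L₂)) :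
    Models M (unionTheory T₁ T₂) ↔ Models M.left T₁ ∧ Models M.right T₂ := by
  have e₁ : ∀ φ ∈ T₁, (∀ v : Assignment M, (φ.left L₂).Sat M v) ↔
      ∀ u : Assignment M.left, φ.Sat M.left u := by
    intro φ hφ
    obtain ⟨xs, χ, hχ, rfl⟩ := h₁.2 φ hφ
    rw [Formula.left_alls, Formula.forall_sat_alls, Formula.forall_sat_alls]
    constructor
    · intro h u
      obtain ⟨v, rfl⟩ := exists_assignment_left M u
      exact (χ.sat_left M v hχ).1 (h v)
    · intro h v
      exact (χ.sat_left M v hχ).2 (h _)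
  have e₂ : ∀ φ ∈ T₂, (∀ v : Assignment M, (φ.right L₁).Sat M v) ↔
      ∀ u : Assignment M.right, φ.Sat M.right u := by
    intro φ hφ
    obtain ⟨xs, χ, hχ, rfl⟩ := h₂.2 φ hφ
    rw [Formula.right_alls, Formula.forall_sat_alls, Formula.forall_sat_alls]
    constructor
    · intro h u
      obtain ⟨v, rfl⟩ := exists_assignment_right M u
      exact (χ.sat_right M v hχ).1 (h v)
    · intro h v
      exact (χ.sat_right M v hχ).2 (h _)
  constructor
  · intro h
    exact ⟨fun φ hφ => (e₁ φ hφ).1 (h _ (Or.inl ⟨φ, hφ, rfl⟩)),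
      fun φ hφ => (e₂ φ hφ).1 (h _ (Or.inr ⟨φ, hφ, rfl⟩))⟩
  · rintro ⟨H₁, H₂⟩ _ (⟨φ, hφ, rfl⟩ | ⟨φ, hφ, rfl⟩)
    exacts [(e₁ φ hφ).2 (H₁ φ hφ), (e₂ φ hφ).2 (H₂ φ hφ)]

variable (N₁ : Struct L₁) (N₂ : Struct L₂)

/-- The sorts of the amalgam of two structures: the shared ones are taken from the second. -/
def amalgamCarrier : A ⊕ (B ⊕ C) → Type
  | .inl a => N₁.carrier (.inl a)
  | .inr s => N₂.carrier s

variable {N₁ N₂}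

/-- The map from the first structure to the amalgam. -/
def amalgamMap (k : ∀ c, N₁.carrier (.inr c) → N₂.carrier (.inr c)) :
    ∀ s : A ⊕ C, N₁.carrier s → amalgamCarrier N₁ N₂ (sortLeft s)
  | .inl _, x => x
  | .inr c, x => k c x

/-- On sorts of the first signature only, the amalgam has the elements of the first structure. -/
def amalgamBack : ∀ s : A ⊕ C, (∀ c, s ≠ .inr c) → amalgamCarrier N₁ N₂ (sortLeft s) → N₁.carrier s
  | .inl _, _, x => x
  | .inr c, h, _ => (h c rfl).elim

/-- The amalgam of a structure for the first signature and one for the second, along a map between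
their shared sorts. -/
def amalgam (tame : Tame L₁ L₂) (N₁ : Struct L₁) (N₂ : Struct L₂)
    (k : ∀ c, N₁.carrier (.inr c) → N₂.carrier (.inr c)) : Struct (combine L₁ L₂) where
  carrier := amalgamCarrier N₁ N₂
  nonempty
    | .inl a => N₁.nonempty (.inl a)
    | .inr s => N₂.nonempty s
  fn
    -- By tameness the arguments lie in private sorts, where the amalgam has the elements of `N₁`.
    -- Only the value may have a shared sort and need to be moved by `k`.
    | .inl f => fun a => amalgamMap k (L₁.cod f)
        (N₁.fn f fun i => amalgamBack (L₁.dom f i) (tame.1 f i) (a i))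
    | .inr f => fun a => N₂.fn f a
  rel
    | .inl r => fun a => N₁.rel r fun i => amalgamBack (L₁.relDom r i) (tame.2 r i) (a i)
    | .inr r => fun a => N₂.rel r a

theorem amalgamBack_map (k : ∀ c, N₁.carrier (.inr c) → N₂.carrier (.inr c)) (s : A ⊕ C)
    (h : ∀ c, s ≠ .inr c) (x : N₁.carrier s) : amalgamBack s h (amalgamMap k s x) = x := by
  rcases s with a | c
  · rfl
  · exact (h c rfl).elim

/-- The first structure embeds into the amalgam. -/
def amalgamEmb (tame : Tame L₁ L₂) (k : ∀ c, N₁.carrier (.inr c) → N₂.carrier (.inr c))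
    (hk : ∀ c, Function.Injective (k c)) : Emb N₁ (amalgam tame N₁ N₂ k).left where
  toFun := amalgamMap k
  inj
    | .inl _ => fun _ _ h => h
    | .inr c => hk c
  map_fn f a := by
    simp only [Struct.left, amalgam, amalgamBack_map]
  map_rel r a := by
    simp only [Struct.left, amalgam, amalgamBack_map]

/-- An injection extends along another one into a countable set, if it leaves out infinitely many
elements. -/
theorem exists_injective_extension {X Y Z : Type*} [Countable Y] {f : X → Y} {g : X → Z}
    (hf : Function.Injective f) (hg : Function.Injective g) (hinf : (Set.range g)ᶜ.Infinite) :
    ∃ k : Y → Z, Function.Injective k ∧ ∀ x, k (f x) = g x := by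
  classical
  obtain ⟨code, hcode⟩ := Countable.exists_injective_nat Y
  have hj : ∀ x y, g x ≠ (hinf.natEmbedding _ (code y)).1 := fun x y hxy =>
    (hinf.natEmbedding _ (code y)).2 ⟨x, hxy⟩
  -- Elements outside the range of `f` are numbered injectively and sent to distinct elements
  -- outside the range of `g`.
  refine ⟨fun y => if hy : ∃ x, f x = y then g hy.choose else (hinf.natEmbedding _ (code y)).1,
    fun x y hxy => ?_, fun x => ?_⟩
  · by_cases hx : ∃ x', f x' = x <;> by_cases hy : ∃ y', f y' = y
    · simp only [hx, hy, dif_pos] at hxy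
      rw [← hx.choose_spec, ← hy.choose_spec, hg hxy]
    · simp only [hx, hy, dif_pos] at hxy
      exact (hj _ _ hxy).elim
    · simp only [hx, hy, dif_pos] at hxy
      exact (hj _ _ hxy.symm).elim
    · simp only [hx, hy] at hxy
      exact hcode ((hinf.natEmbedding _).injective (Subtype.ext hxy))
  · have hy : ∃ x', f x' = f x := ⟨x, rfl⟩
    simp only [hy, dif_pos]
    rw [hf hy.choose_spec]

/-- In an amalgam of countable structures the first theory remains true. -/
theorem amalgam_models_left [∀ s, Countable (Term L₁ s)] (tame : Tame L₁ L₂)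
    {T₁ : Set (Formula L₁)} (h₁ : IsUniversalTheory T₁)
    (si₁ : StablyInfinite T₁ (Set.range Sum.inr)) (hN₁ : Models N₁ T₁)
    [∀ s, Countable (N₁.carrier s)] [∀ s, Countable (N₂.carrier s)]
    (k : ∀ c, N₁.carrier (.inr c) → N₂.carrier (.inr c)) (hk : ∀ c, Function.Injective (k c)) :
    Models (amalgam tame N₁ N₂ k).left T₁ := by
  obtain ⟨N, hN, -, h, hinf⟩ := si₁.exists_extension h₁ N₁ hN₁
  -- `N` extends `N₁` by infinitely many elements in each shared sort, so the countable shared sorts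
  -- of `N₂` can be mapped injectively into those of `N`, compatibly with `N₁`.
  choose g' hg' hgk using fun c =>
    exists_injective_extension (hk c) (h.inj (.inr c)) (hinf _ ⟨c, rfl⟩)
  let g : ∀ s, (amalgam tame N₁ N₂ k).left.carrier s → N.carrier s := fun s => match s with
    | .inl a => h.toFun (.inl a)
    | .inr c => g' c
  have hgm : ∀ s x, g s (amalgamMap k s x) = h.toFun s x := by
    rintro (a | c) x
    · rfl
    · exact hgk c x
  have hgb : ∀ s (hs : ∀ c, s ≠ Sum.inr c) x, h.toFun s (amalgamBack s hs x) = g s x := by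
    rintro (a | c) hs x
    · rfl
    · exact (hs c rfl).elim
  -- No symbol of the first signature has an argument of shared sort, so the choice of images for
  -- the new shared elements cannot violate any function or relation: the reduct of the amalgam
  -- embeds into `N`.
  refine h₁.models_of_emb (N := N) ⟨g, ?_, ?_, ?_⟩ hN
  · rintro (a | c)
    exacts [h.inj _, hg' c]
  · intro f a
    refine (hgm _ _).trans ?_
    rw [h.map_fn]
    congr 1
    funext i
    exact hgb _ _ _
  · intro r a
    refine Iff.trans ?_ (h.map_rel r _)
    rw [iff_iff_eq]
    congr 1
    funext i
    exact (hgb _ _ _).symm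

/-- Embeddings of the two reducts that agree on the shared sorts form an embedding. -/
def Emb.combine {M N : Struct (combine L₁ L₂)} (e : Emb M.left N.left) (e' : Emb M.right N.right)
    (h : ∀ c, e.toFun (.inr c) = e'.toFun (.inr c)) : Emb M N where
  toFun
    | .inl a => e.toFun (.inl a)
    | .inr s => e'.toFun s
  inj
    | .inl a => e.inj (.inl a)
    | .inr s => e'.inj s
  map_fn
    | .inl f => fun a => by
      -- Along `sortLeft` the combined map is `e`; on shared sorts, where it is defined as `e'`,
      -- this is the assumed agreement.
      have key : ∀ s : A ⊕ C, (match (motive := ∀ s, M.carrier s → N.carrier s) sortLeft s with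
          | .inl a => e.toFun (.inl a)
          | .inr s => e'.toFun s) = e.toFun s := by
        rintro (a | c)
        exacts [rfl, (h c).symm]
      refine (congrFun (key (L₁.cod f)) _).trans ((e.map_fn f a).trans ?_)
      refine congrArg (N.fn (Sum.inl f)) (funext fun i => ?_)
      exact (congrFun (key (L₁.dom f i)) _).symm
    | .inr f => fun a => e'.map_fn f a
  map_rel
    | .inl r => fun a => by
      have key : ∀ s : A ⊕ C, (match (motive := ∀ s, M.carrier s → N.carrier s) sortLeft s with
          | .inl a => e.toFun (.inl a)
          | .inr s => e'.toFun s) = e.toFun s := by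
        rintro (a | c)
        exacts [rfl, (h c).symm]
      refine Iff.trans (iff_of_eq ?_) (e.map_rel r a)
      refine congrArg (N.rel (Sum.inl r)) (funext fun i => ?_)
      exact congrFun (key (L₁.relDom r i)) _
    | .inr r => fun a => e'.map_rel r a

def Emb.trans {S : Type} {L : Signature S} {M N K : Struct L} (e : Emb M N) (e' : Emb N K) :
    Emb M K where
  toFun s x := e'.toFun s (e.toFun s x)
  inj s := (e'.inj s).comp (e.inj s)
  map_fn f a := by rw [e.map_fn, e'.map_fn]
  map_rel r a := by rw [e'.map_rel, e.map_rel]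

end Amalgam

end ManySorted

namespace ManySorted

/-! ### Outputs of the three-step algorithm are covers -/

section ThreeStep

variable {A B C : Type} {L₁ : Signature (A ⊕ C)} {L₂ : Signature (B ⊕ C)}

theorem Term.eval_of_private {M : Struct L₁} {u v : Assignment M} {s : A ⊕ C} (t : Term L₁ s)
    (ht : PrivateVars t.vars) (h : ∀ a n, u (.inl a) n = v (.inl a) n) :
    t.eval M u = t.eval M v :=
  t.eval_congr M fun x hx => by
    obtain ⟨a, ha⟩ := ht x hx
    obtain ⟨s, n⟩ := x
    subst ha
    exact h a n

theorem sat_constraint_of_private {M : Struct L₁} {u v : Assignment M} {ls : List (Literal L₁)}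
    (ht : PrivateVars (litVars ls)) (h : ∀ a n, u (.inl a) n = v (.inl a) n) :
    (constraint ls).Sat M u ↔ (constraint ls).Sat M v :=
  Formula.sat_congr M _ fun x hx => by
    obtain ⟨a, ha⟩ := ht x (fv_constraint ls ▸ hx)
    obtain ⟨s, n⟩ := x
    subst ha
    exact h a n

theorem substShared_of_mem (ys : List (C × ℕ)) (t : (c : C) → ℕ → Term L₁ (.inr c)) {c : C} {n : ℕ}
    (h : (c, n) ∈ ys) : substShared L₂ ys t (.inr (.inr c)) n = (t c n).left L₂ :=
  if_pos h

theorem substShared_of_forall_ne (ys : List (C × ℕ)) (t : (c : C) → ℕ → Term L₁ (.inr c))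
    {s : B ⊕ C} {n : ℕ} (h : ∀ c, s = .inr c → (c, n) ∉ ys) :
    substShared L₂ ys t (.inr s) n = .var (Sum.inr s) n := by
  rcases s with b | c
  · rfl
  · exact if_neg (h c rfl)

/-- The assignment obtained from `v` by giving the shared variables in `ys` the values of the terms
`t`. -/
noncomputable def assignShared {M : Struct (combine L₁ L₂)} (v : Assignment M) (ys : List (C × ℕ))
    (t : (c : C) → ℕ → Term L₁ (.inr c)) : Assignment M :=
  fun s n => (substShared L₂ ys t s n).eval M v

section AssignShared

variable {M : Struct (combine L₁ L₂)} (v : Assignment M) (ys : List (C × ℕ))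
    (t : (c : C) → ℕ → Term L₁ (.inr c))

theorem assignShared_of_mem {c : C} {n : ℕ} (h : (c, n) ∈ ys) :
    assignShared v ys t (.inr (.inr c)) n = (t c n).eval M.left (Assignment.left v) :=
  (congrArg (Term.eval M v) (substShared_of_mem ys t h)).trans (Term.eval_left M v _)

theorem assignShared_of_forall_ne {s : B ⊕ C} {n : ℕ}
    (h : ∀ c, s = .inr c → (c, n) ∉ ys) : assignShared v ys t (.inr s) n = v (.inr s) n :=
  congrArg (Term.eval M v) (substShared_of_forall_ne ys t h)

end AssignShared

theorem vars_substShared_of_mem (ys : List (C × ℕ)) (t : (c : C) → ℕ → Term L₁ (.inr c)) {c : C}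
    {n : ℕ} (h : (c, n) ∈ ys) : (substShared L₂ ys t (.inr (.inr c)) n).vars =
      (fun x => (sortLeft x.1, x.2)) '' (t c n).vars := by
  rw [substShared_of_mem _ _ h]
  exact Term.vars_left _

theorem holds_substShared {M : Struct (combine L₁ L₂)} (v : Assignment M) (ys : List (C × ℕ))
    (t : (c : C) → ℕ → Term L₁ (.inr c)) (a : Atom L₂) :
    ((a.right L₁).subst (substShared L₂ ys t)).Holds M v ↔
      a.Holds M.right (Assignment.right (assignShared v ys t)) := by
  rw [Atom.holds_subst, Atom.holds_right]
  rfl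

namespace Flattening

variable {P : Primitive (combine L₁ L₂)} (F : Flattening P)

/-- Putting the terms back for `η'` amounts to evaluating the second-signature literals with `η'`
set to the values of the terms; the matrix thus splits into one condition on each reduct. -/
theorem sat_iff {M : Struct (combine L₁ L₂)} (v : Assignment M) :
    (constraint P.lits).Sat M v ↔ (constraint F.φ).Sat M.left (Assignment.left v) ∧
      (constraint F.ψ).Sat M.right (Assignment.right (assignShared v F.η' F.t)) := by
  rw [sat_constraint_perm M v F.lits_perm]
  simp only [sat_constraint, List.forall_mem_append, List.forall_mem_map]
  refine and_congr (forall₂_congr fun l _ => ?_) (forall₂_congr fun l _ => ?_)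
  · simp only [Literal.Holds, Atom.holds_left]
  · simp only [Literal.Holds, holds_substShared]

theorem mem_bv_inl {a : A} {n : ℕ} : (Sum.inl a, n) ∈ P.bv ↔ (a, n) ∈ F.e := by
  rw [F.bv_perm.mem_iff]
  simp [sortRight]

theorem mem_bv_inr {s : B ⊕ C} {n : ℕ} : (Sum.inr s, n) ∈ P.bv ↔ (s, n) ∈ F.η := by
  rw [F.bv_perm.mem_iff]
  simp [sortRight]

theorem mem_litVars_of_φ {a : A} {n : ℕ} (h : (Sum.inl a, n) ∈ litVars F.φ) :
    (Sum.inl a, n) ∈ litVars P.lits := by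
  rw [litVars_perm F.lits_perm, litVars_append]
  obtain ⟨l, hl, hx⟩ := h
  exact Or.inl ⟨_, List.mem_map_of_mem hl, by rw [Atom.vars_left]; exact ⟨_, hx, rfl⟩⟩

/-- Since each `η'` occurs in `ψ`, its term really occurs in the input, and flattening introduces no
foreign private variables. -/
theorem mem_litVars_of_t {y : C × ℕ} (hy : y ∈ F.η') {a : A} {n : ℕ}
    (h : (Sum.inl a, n) ∈ (F.t y.1 y.2).vars) : (Sum.inl a, n) ∈ litVars P.lits := by
  rw [litVars_perm F.lits_perm, litVars_append]
  obtain ⟨l, hl, hx⟩ := F.used y hy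
  refine Or.inr ⟨_, List.mem_map_of_mem hl, ?_⟩
  rw [Atom.vars_subst, Atom.vars_right]
  refine Set.mem_biUnion ⟨_, hx, rfl⟩ ?_
  change _ ∈ (substShared L₂ F.η' F.t (.inr (.inr y.1)) y.2).vars
  rw [vars_substShared_of_mem _ _ hy]
  exact ⟨_, h, rfl⟩

theorem mem_litVars_of_ψ {s : B ⊕ C} {n : ℕ} (h : (s, n) ∈ litVars F.ψ)
    (hs : ∀ c, s = .inr c → (c, n) ∉ F.η') : (Sum.inr s, n) ∈ litVars P.lits := by
  rw [litVars_perm F.lits_perm, litVars_append]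
  obtain ⟨l, hl, hx⟩ := h
  refine Or.inr ⟨_, List.mem_map_of_mem hl, ?_⟩
  rw [Atom.vars_subst, Atom.vars_right]
  refine Set.mem_biUnion ⟨_, hx, rfl⟩ ?_
  change _ ∈ (substShared L₂ F.η' F.t (.inr s) n).vars
  rw [substShared_of_forall_ne _ _ hs]
  rfl

theorem mem_primitiveOne_bv {s : A ⊕ C} {n : ℕ} :
    (s, n) ∈ F.primitiveOne.bv ↔ ∃ a, s = .inl a ∧ (a, n) ∈ F.e := by
  simp only [primitiveOne, List.mem_map, Prod.exists, Prod.mk.injEq]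
  constructor
  · rintro ⟨a, m, h, rfl, rfl⟩; exact ⟨a, rfl, h⟩
  · rintro ⟨a, rfl, h⟩; exact ⟨a, n, h, rfl, rfl⟩

theorem mem_primitiveTwo_bv {d : List (Literal L₁)} (G : Separation F d) {s : B ⊕ C} {n : ℕ} :
    (s, n) ∈ G.primitiveTwo.bv ↔ (s, n) ∈ F.η ∨ ∃ c, s = .inr c ∧ (c, n) ∈ F.η' := by
  simp only [Separation.primitiveTwo, List.mem_append, List.mem_map, Prod.exists, Prod.mk.injEq]
  refine or_congr Iff.rfl ⟨?_, ?_⟩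
  · rintro ⟨a, m, h, rfl, rfl⟩; exact ⟨a, rfl, h⟩
  · rintro ⟨a, rfl, h⟩; exact ⟨a, n, h, rfl, rfl⟩

theorem sat_primitiveOne {M : Struct L₁} (u : Assignment M) :
    (constraint F.primitiveOne.lits).Sat M u ↔ (constraint F.φ).Sat M u ∧
      ∀ y ∈ F.η', u (.inr y.1) y.2 = (F.t y.1 y.2).eval M u := by
  simp only [primitiveOne, sat_constraint, List.forall_mem_append, List.forall_mem_map]
  refine and_congr Iff.rfl (forall₂_congr fun y _ => ?_)
  simp [Literal.Holds, Atom.Holds, Term.eval]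

/-- The only shared variables that the `T₁`-cover can mention are the `η'`, because `φ` and the
terms `t` have private variables only. -/
theorem mem_fv_primitiveOne {x : (A ⊕ C) × ℕ} (hx : x ∈ F.primitiveOne.formula.fv) :
    (∃ a n, x = (.inl a, n) ∧ (Sum.inl a, n) ∈ litVars P.lits ∧ (Sum.inl a, n) ∉ P.bv) ∨
      ∃ c n, x = (.inr c, n) ∧ (c, n) ∈ F.η' := by
  obtain ⟨h, hb⟩ := Primitive.mem_fv_formula.1 hx
  obtain ⟨s, n⟩ := x
  rw [mem_primitiveOne_bv] at hb
  have hpriv : ∀ a, s = .inl a → (Sum.inl a, n) ∈ litVars P.lits →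
      (∃ a' n', (s, n) = (.inl a', n') ∧ (Sum.inl a', n') ∈ litVars P.lits ∧
        (Sum.inl a', n') ∉ P.bv) := by
    rintro a rfl ha
    exact ⟨a, n, rfl, ha, fun h => hb ⟨a, rfl, F.mem_bv_inl.1 h⟩⟩
  rw [primitiveOne, litVars_append] at h
  rcases h with h | ⟨l, hl, hx⟩
  · obtain ⟨a, ha⟩ := F.φ_private _ h
    change s = _ at ha
    subst ha
    exact Or.inl (hpriv a rfl (F.mem_litVars_of_φ h))
  · obtain ⟨y, hy, rfl⟩ := List.mem_map.1 hl
    rcases hx with hx | hx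
    · simp only [Term.vars, Set.mem_singleton_iff, Prod.mk.injEq] at hx
      exact Or.inr ⟨y.1, y.2, by rw [hx.1, hx.2], hy⟩
    · obtain ⟨a, ha⟩ := F.t_private y hy _ hx
      change s = _ at ha
      subst ha
      exact Or.inl (hpriv a rfl (F.mem_litVars_of_t hy hx))

end Flattening

namespace Separation

variable {P : Primitive (combine L₁ L₂)} {F : Flattening P} {d : List (Literal L₁)}
  (G : Separation F d)

open Classical in
/-- The term that is put for a shared variable in a separated disjunct. -/
noncomputable def term (c : C) (n : ℕ) : Term L₁ (.inr c) :=
  if (c, n) ∈ G.ξ' then G.t' c n else .var (Sum.inr c) n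

theorem sat_iff {M : Struct L₁} (u : Assignment M) :
    (constraint d).Sat M u ↔ (constraint G.φ₁).Sat M u ∧ ∀ q ∈ G.φ₂,
      ((G.term q.sort q.n).eval M u = (G.term q.sort q.m).eval M u ↔ q.sign = true) := by
  rw [sat_constraint_perm M u G.perm]
  simp only [sat_constraint, List.forall_mem_append, List.forall_mem_map]
  rfl

theorem sat_primitiveTwo {M : Struct L₂} (u : Assignment M) :
    (constraint G.primitiveTwo.lits).Sat M u ↔ (∀ q ∈ G.φ₂,
      (u (.inr q.sort) q.n = u (.inr q.sort) q.m ↔ q.sign = true)) ∧ (constraint F.ψ).Sat M u := by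
  simp only [primitiveTwo, sat_constraint, List.forall_mem_append, List.forall_mem_map]
  rfl

theorem mem_litVars_of_φ₁ {x : (A ⊕ C) × ℕ} (h : x ∈ litVars G.φ₁) : x ∈ litVars d := by
  rw [litVars_perm G.perm, litVars_append]
  exact Or.inl h

theorem mem_litVars_of_term {y : C × ℕ} (hy : y ∈ varEqVars G.φ₂) {x : (A ⊕ C) × ℕ}
    (h : x ∈ (G.term y.1 y.2).vars) : x ∈ litVars d := by
  rw [litVars_perm G.perm, litVars_append]
  obtain ⟨q, hq, h' | h'⟩ := hy
  · subst h'
    exact Or.inr ⟨_, List.mem_map_of_mem hq, Or.inl h⟩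
  · subst h'
    exact Or.inr ⟨_, List.mem_map_of_mem hq, Or.inr h⟩

theorem mem_varEqVars_of_litVars {x : (B ⊕ C) × ℕ}
    (h : x ∈ litVars (G.φ₂.map (VarEq.toRight L₂))) :
    ∃ c n, x = (.inr c, n) ∧ (c, n) ∈ varEqVars G.φ₂ := by
  obtain ⟨l, hl, hx⟩ := h
  obtain ⟨q, hq, rfl⟩ := List.mem_map.1 hl
  rcases hx with rfl | rfl
  exacts [⟨_, _, rfl, q, hq, Or.inl rfl⟩, ⟨_, _, rfl, q, hq, Or.inr rfl⟩]

variable (hd : litVars d ⊆ F.primitiveOne.formula.fv)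
include hd

/-- A variable of `φ₂` for which no term is put occurs in the disjunct itself, hence in the
`T₁`-cover, whose shared variables are all among the `η'`. -/
theorem mem_η' {y : C × ℕ} (hy : y ∈ varEqVars G.φ₂) (hn : y ∉ G.ξ') : y ∈ F.η' := by
  have : ((Sum.inr y.1 : A ⊕ C), y.2) ∈ (G.term y.1 y.2).vars := by
    simp only [term, hn, if_false]; rfl
  rcases F.mem_fv_primitiveOne (hd (G.mem_litVars_of_term hy this)) with ⟨a, n, h, -⟩ | ⟨c, n, h, h'⟩
  · simp at h
  · simp only [Prod.mk.injEq, Sum.inr.injEq] at h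
    obtain ⟨rfl, rfl⟩ := h
    exact h'

omit hd in
-- A variable of `ψ` is either an `η'` or a variable of the input, and the `ξ'` avoid both.
theorem notMem_of_litVars_ψ {c : C} {n : ℕ} (h : (Sum.inr c, n) ∈ litVars F.ψ) :
    (c, n) ∉ G.ξ' := by
  intro hξ
  obtain ⟨h1, h2⟩ := G.fresh _ hξ
  exact h1 (Or.inr (F.mem_litVars_of_ψ h (by
    rintro c' hc
    obtain rfl := Sum.inr.inj hc
    exact h2)))

/-- Classifies the parameters of the `T₂`-cover: fresh `ξ'`, to be replaced by terms, and free
variables of the input, which the substitution leaves alone. -/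
theorem mem_fv_primitiveTwo {s : B ⊕ C} {n : ℕ} (h : (s, n) ∈ G.primitiveTwo.formula.fv) :
    (∃ c, s = .inr c ∧ (c, n) ∈ G.ξ') ∨
      ((∀ c, s = .inr c → (c, n) ∉ G.ξ') ∧ (∀ c, s = .inr c → (c, n) ∉ F.η') ∧
        (Sum.inr s, n) ∈ P.formula.fv) := by
  obtain ⟨h, hb⟩ := Primitive.mem_fv_formula.1 h
  rw [Flattening.mem_primitiveTwo_bv] at hb
  push Not at hb
  rw [or_iff_not_imp_left]
  intro hξ
  push Not at hξ
  refine ⟨hξ, hb.2, Primitive.mem_fv_formula.2 ⟨?_, fun h => hb.1 (F.mem_bv_inr.1 h)⟩⟩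
  rw [primitiveTwo, litVars_append] at h
  rcases h with h | h
  · obtain ⟨c, m, he, hc⟩ := G.mem_varEqVars_of_litVars h
    simp only [Prod.mk.injEq] at he
    obtain ⟨rfl, rfl⟩ := he
    exact (hb.2 c rfl (G.mem_η' hd hc (hξ c rfl))).elim
  · exact F.mem_litVars_of_ψ h hb.2

theorem fv_output {T₂ : Set (Formula L₂)} {ψ₁ : Formula L₂} (hψ : IsCover T₂ G.primitiveTwo ψ₁) :
    (G.output ψ₁).fv ⊆ P.formula.fv := by
  have hpriv : ∀ x ∈ litVars d, (∃ a, x.1 = .inl a) → (sortLeft x.1, x.2) ∈ P.formula.fv := by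
    rintro ⟨s, n⟩ hx ⟨a, ha⟩
    change s = _ at ha
    subst ha
    rcases F.mem_fv_primitiveOne (hd hx) with ⟨a', n', h, h1, h2⟩ | ⟨c, n', h, h'⟩
    · simp only [Prod.mk.injEq, Sum.inl.injEq] at h
      obtain ⟨rfl, rfl⟩ := h
      exact Primitive.mem_fv_formula.2 ⟨h1, h2⟩
    · simp at h
  rintro x (hx | hx)
  · obtain ⟨y, hy, rfl⟩ := Formula.fv_left_subset _ hx
    rw [fv_constraint] at hy
    exact hpriv y (G.mem_litVars_of_φ₁ hy) (G.φ₁_private y hy)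
  · rw [Formula.fv_subst _ hψ.1.right] at hx
    simp only [Set.mem_iUnion, exists_prop] at hx
    obtain ⟨z, hz, hx⟩ := hx
    obtain ⟨⟨s, n⟩, hy, rfl⟩ := Formula.fv_right_subset _ hz
    change x ∈ (substShared L₂ G.ξ' G.t' (.inr s) n).vars at hx
    rcases G.mem_fv_primitiveTwo hd (hψ.2.1 hy) with ⟨c, rfl, hc⟩ | ⟨h1, -, h3⟩
    · rw [vars_substShared_of_mem _ _ hc] at hx
      obtain ⟨y, hyt, rfl⟩ := hx
      refine hpriv y (G.mem_litVars_of_term (G.used _ hc) ?_) (G.t'_private _ hc y hyt)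
      simp only [term, hc, if_true]
      exact hyt
    · rw [substShared_of_forall_ne _ _ h1] at hx
      rw [Set.mem_singleton_iff.1 hx]
      exact h3

omit hd in
theorem sat_output {ψ₁ : Formula L₂} (hψ : ψ₁.IsQF) {M : Struct (combine L₁ L₂)}
    (v : Assignment M) : (G.output ψ₁).Sat M v ↔
      (constraint G.φ₁).Sat M.left (Assignment.left v) ∧
        ψ₁.Sat M.right (Assignment.right (assignShared v G.ξ' G.t')) := by
  simp only [output, Formula.Sat]
  rw [Formula.sat_left _ _ _ (isQF_constraint _), Formula.sat_subst _ _ _ _ hψ.right,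
    Formula.sat_right _ _ _ hψ]
  rfl

/-- The matrix of the input together with a disjunct of the cover entails the corresponding part of
the output. -/
theorem output_of_sat {T₂ : Set (Formula L₂)} {ψ₁ : Formula L₂}
    (hψ : IsCover T₂ G.primitiveTwo ψ₁) {M : Struct (combine L₁ L₂)} (hM : Models M.right T₂)
    {v : Assignment M}
    (h₁ : (constraint d).Sat M.left (Assignment.left (assignShared v F.η' F.t)))
    (h₂ : (constraint F.ψ).Sat M.right (Assignment.right (assignShared v F.η' F.t))) :
    (G.output ψ₁).Sat M v := by
  obtain ⟨hφ₁, hφ₂⟩ := (G.sat_iff _).1 h₁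
  rw [G.sat_output hψ.1]
  let u := assignShared v F.η' F.t
  refine ⟨(sat_constraint_of_private (u := Assignment.left u) (v := Assignment.left v)
    G.φ₁_private fun a n => rfl).1 hφ₁, ?_⟩
  -- `u` sets `η'` to the values of `t`, and `z` moreover sets `ξ'` to the values of `t'`. Under `z`
  -- the matrix of the second primitive formula holds.
  let z := assignShared u G.ξ' G.t'
  have hz : ψ₁.Sat M.right (Assignment.right z) := by
    refine hψ.2.2.1 _ hM _ ((G.sat_primitiveTwo _).2 ⟨fun q hq => ?_, ?_⟩)
    · have hval : ∀ c n, z (.inr (.inr c)) n = (G.term c n).eval M.left (Assignment.left u) := by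
        intro c n
        by_cases hc : (c, n) ∈ G.ξ'
        · refine (assignShared_of_mem u _ _ hc).trans ?_
          simp only [term, hc, if_true]
          rfl
        · simp only [term, hc, if_false]
          refine assignShared_of_forall_ne _ _ _ fun c' h => ?_
          obtain rfl := Sum.inr.inj h
          exact hc
      have := hφ₂ q hq
      rw [← hval, ← hval] at this
      exact this
    · refine (Formula.sat_congr _ _ fun x hx => ?_).1 h₂
      rw [fv_constraint] at hx
      refine (assignShared_of_forall_ne _ _ _ fun c hc => ?_).symm
      obtain ⟨s, n⟩ := x
      change s = _ at hc
      subst hc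
      exact G.notMem_of_litVars_ψ hx
  -- The `η'` are bound in the second primitive formula and the `t'` have private variables only, so
  -- resetting `η'` does not affect the `T₂`-cover.
  refine (Formula.sat_congr _ _ fun x hx => ?_).1 hz
  obtain ⟨s, n⟩ := x
  change z (.inr s) n = assignShared v G.ξ' G.t' (.inr s) n
  rcases G.mem_fv_primitiveTwo hd (hψ.2.1 hx) with ⟨c, rfl, hc⟩ | ⟨h1, h2, -⟩
  · refine (assignShared_of_mem u _ _ hc).trans (Eq.trans ?_ (assignShared_of_mem v _ _ hc).symm)
    exact Term.eval_of_private _ (G.t'_private _ hc) fun a n => rfl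
  · refine (assignShared_of_forall_ne u _ _ h1).trans
      (Eq.trans ?_ (assignShared_of_forall_ne v _ _ h1).symm)
    exact assignShared_of_forall_ne _ _ _ h2

end Separation

/-- A countable model in which a disjunct of the output holds embeds into a model in which the matrix
of the input holds. -/
theorem Separation.exists_extension [∀ s, Countable (Term L₁ s)] [∀ s, Countable (Term L₂ s)]
    (tame : Tame L₁ L₂) {T₁ : Set (Formula L₁)} {T₂ : Set (Formula L₂)}
    (h₁ : IsUniversalTheory T₁) (h₂ : IsUniversalTheory T₂)
    (si₁ : StablyInfinite T₁ (Set.range Sum.inr)) (si₂ : StablyInfinite T₂ (Set.range Sum.inr))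
    {P : Primitive (combine L₁ L₂)} {F : Flattening P} {d : List (Literal L₁)} {φt : Formula L₁}
    (hφt : IsCover T₁ F.primitiveOne φt) (G : Separation F d)
    (hdφ : ∀ (M : Struct L₁) (u : Assignment M), (constraint d).Sat M u → φt.Sat M u)
    {ψ₁ : Formula L₂} (hψ : IsCover T₂ G.primitiveTwo ψ₁)
    {M : Struct (combine L₁ L₂)} (hM : Models M (unionTheory T₁ T₂)) [∀ s, Countable (M.carrier s)]
    {v : Assignment M} (hv : (G.output ψ₁).Sat M v) :
    ∃ K : Struct (combine L₁ L₂), Models K (unionTheory T₁ T₂) ∧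
      ∃ (E : Emb M K) (W : Assignment K), (constraint P.lits).Sat K W ∧
        ∀ s n, (s, n) ∉ P.bv → W s n = E.toFun s (v s n) := by
  classical
  obtain ⟨hM₁, hM₂⟩ := (models_union_iff h₁ h₂ M).1 hM
  obtain ⟨hφ₁, hψ₁⟩ := (G.sat_output hψ.1 v).1 hv
  have : ∀ s, Countable (M.left.carrier s) := fun s => inferInstanceAs (Countable (M.carrier _))
  have : ∀ s, Countable (M.right.carrier s) := fun s => inferInstanceAs (Countable (M.carrier _))
  -- The `T₂`-cover provides values for `η` and `η'`, at the cost of enlarging the second reduct and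
  -- with it the shared sorts.
  obtain ⟨N₂, hN₂, cN₂, e₂, w₂, hw₂, hwv₂⟩ := hψ.exists_extension h₂ M.right hM₂ _ hψ₁
  obtain ⟨hφ₂w, hψw⟩ := (G.sat_primitiveTwo _).1 hw₂
  let k₀ : ∀ c, M.left.carrier (.inr c) → N₂.carrier (.inr c) := fun c => e₂.toFun (.inr c)
  have hk₀ : ∀ c, Function.Injective (k₀ c) := fun c => e₂.inj (.inr c)
  -- The first reduct of `M` with its shared sorts enlarged to those of `N₂`; it is a model of `T₁`,
  -- so the `T₁`-cover can be used over it.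
  let K₀ := amalgam tame M.left N₂ k₀
  let g : Emb M.left K₀.left := amalgamEmb tame k₀ hk₀
  have hK₀ : Models K₀.left T₁ := amalgam_models_left tame h₁ si₁ hM₁ k₀ hk₀
  have : ∀ s, Countable (K₀.left.carrier s) := by
    rintro (a | c)
    exacts [inferInstanceAs (Countable (M.carrier (.inl a))), cN₂ (.inr c)]
  let u : Assignment K₀.left := fun s => match s with
    | .inl a => v (.inl a)
    | .inr c => w₂ (.inr c)
  have hgu : ∀ a n, u (.inl a) n = g.toFun (.inl a) (Assignment.left v (.inl a) n) :=
    fun a n => rfl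
  -- Each term in the disjunct has the value that `w₂` gives to its variable: for `ξ'` because `w₂`
  -- extends the assignment with `ξ' = t'`, for `η'` by the choice of `u`. Hence `φ₂` under `w₂`
  -- becomes the shared part of the disjunct under `u`.
  have hval : ∀ y ∈ varEqVars G.φ₂, (G.term y.1 y.2).eval K₀.left u = w₂ (.inr y.1) y.2 := by
    intro y hy
    by_cases hc : (y.1, y.2) ∈ G.ξ'
    · simp only [Separation.term, hc, if_true]
      rw [Term.eval_of_private (v := fun s n => g.toFun s (Assignment.left v s n)) _
        (G.t'_private _ hc) hgu, g.eval]
      have hb : (Sum.inr y.1, y.2) ∉ G.primitiveTwo.bv := by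
        rw [Flattening.mem_primitiveTwo_bv]
        rintro (h | ⟨c, h, h'⟩)
        · exact (G.fresh _ hc).1 (Or.inl (F.mem_bv_inr.2 h))
        · obtain rfl := Sum.inr.inj h
          exact (G.fresh _ hc).2 h'
      rw [hwv₂ _ _ hb]
      refine congrArg (e₂.toFun (.inr y.1)) ?_
      exact (assignShared_of_mem v G.ξ' G.t' hc).symm
    · simp only [Separation.term, hc, if_false]
      rfl
  have hdu : (constraint d).Sat K₀.left u := by
    refine (G.sat_iff u).2 ⟨?_, fun q hq => ?_⟩
    · exact (sat_constraint_of_private G.φ₁_private hgu).2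
        ((g.sat _ _ (isQF_constraint _)).2 hφ₁)
    · rw [hval (q.sort, q.n) ⟨q, hq, Or.inl rfl⟩, hval (q.sort, q.m) ⟨q, hq, Or.inr rfl⟩]
      exact hφ₂w q hq
  obtain ⟨N₁, hN₁, cN₁, e₁, w₁, hw₁, hwu₁⟩ :=
    hφt.exists_extension h₁ K₀.left hK₀ u (hdφ _ _ hdu)
  obtain ⟨hφw, htw⟩ := (F.sat_primitiveOne _).1 hw₁
  -- Passing from `K₀` to `N₁` may have added shared elements once more; the extension of `N₂` has
  -- room for them.
  obtain ⟨N₂', hN₂', cN₂', e₂', hinf⟩ := si₂.exists_extension h₂ N₂ hN₂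
  choose k hk hke using fun c => exists_injective_extension (f := e₁.toFun (.inr c))
    (g := e₂'.toFun (.inr c)) (e₁.inj _) (e₂'.inj _) (hinf _ ⟨c, rfl⟩)
  let K := amalgam tame N₁ N₂' k
  let g' : Emb N₁ K.left := amalgamEmb tame k hk
  have hK : Models K (unionTheory T₁ T₂) := (models_union_iff h₁ h₂ K).2
    ⟨amalgam_models_left tame h₁ si₁ hN₁ k hk, hN₂'⟩
  -- On the shared sorts the two routes from `M` to `K` agree because `k` composed with `e₁` is
  -- `e₂'`.
  let E : Emb M K := Emb.combine ((g.trans e₁).trans g') (e₂.trans e₂')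
    (fun c => funext fun x => hke c _)
  let W : Assignment K := fun s n => if (s, n) ∈ P.bv then
      (match (motive := ∀ s, K.carrier s) s with
        | .inl a => w₁ (.inl a) n
        | .inr s => e₂'.toFun s (w₂ s n))
    else E.toFun s (v s n)
  have hWv : ∀ s n, (s, n) ∉ P.bv → W s n = E.toFun s (v s n) := fun s n h => by simp [W, h]
  have hWl : ∀ a n, W (.inl a) n = w₁ (.inl a) n := by
    intro a n
    by_cases h : ((Sum.inl a : A ⊕ (B ⊕ C)), n) ∈ P.bv
    · exact if_pos h
    · rw [hWv _ _ h, hwu₁ _ _ fun hm => h ?_]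
      · rfl
      · obtain ⟨a', ha, hm⟩ := F.mem_primitiveOne_bv.1 hm
        obtain rfl := Sum.inl.inj ha
        exact F.mem_bv_inl.2 hm
  have hWg : ∀ a n, Assignment.left W (.inl a) n = g'.toFun (.inl a) (w₁ (.inl a) n) := hWl
  refine ⟨K, hK, E, W, (F.sat_iff W).2 ⟨?_, ?_⟩, hWv⟩
  · exact (sat_constraint_of_private F.φ_private hWg).2 ((g'.sat _ _ (isQF_constraint _)).2 hφw)
  -- It remains to compare the values of the variables of `ψ` with their images from `N₂`. For `η'`,
  -- the value of its term in `N₁` is the image of `w₂ η'` under `e₁`, which `k` sends to the image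
  -- under `e₂'`.
  · refine (Formula.sat_congr _ _ fun x hx => ?_).2 ((e₂'.sat _ _ (isQF_constraint _)).2 hψw)
    rw [fv_constraint] at hx
    obtain ⟨s, n⟩ := x
    change assignShared W F.η' F.t (.inr s) n = e₂'.toFun s (w₂ s n)
    by_cases hs : ∃ c, s = .inr c ∧ (c, n) ∈ F.η'
    · obtain ⟨c, rfl, hc⟩ := hs
      refine (assignShared_of_mem _ _ _ hc).trans
        ((Term.eval_of_private (v := fun s n => g'.toFun s (w₁ s n)) _ (F.t_private _ hc) hWg).trans
          ((g'.eval _ _).trans ?_))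
      rw [← htw _ hc, hwu₁ _ _ fun hm => by
        obtain ⟨a, ha, -⟩ := F.mem_primitiveOne_bv.1 hm
        cases ha]
      exact hke c _
    · push Not at hs
      rw [assignShared_of_forall_ne _ _ _ hs]
      by_cases hb : ((Sum.inr s : A ⊕ (B ⊕ C)), n) ∈ P.bv
      · exact if_pos hb
      · rw [hWv _ _ hb]
        have hb₂ : (s, n) ∉ G.primitiveTwo.bv := by
          rw [Flattening.mem_primitiveTwo_bv]
          rintro (h | ⟨c, rfl, h⟩)
          exacts [hb (F.mem_bv_inr.2 h), hs c rfl h]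
        rw [hwv₂ _ _ hb₂]
        refine congrArg (fun x => e₂'.toFun s (e₂.toFun s x)) ?_
        refine (assignShared_of_forall_ne v G.ξ' G.t' ?_).symm
        rintro c rfl
        exact G.notMem_of_litVars_ψ hx

/-- Entailment by the matrix is evaluation of the fresh variables at their terms. For strength, a
counterexample to an entailment `θ` can be taken countable and extended to a model of the matrix;
there `θ` holds, and as a quantifier-free formula it holds already in the smaller model. -/
theorem IsThreeStepOutput.isCover [Encodable A] [Encodable B] [Encodable C]
    [Encodable L₁.Fn] [Encodable L₁.Rel] [Encodable L₂.Fn] [Encodable L₂.Rel]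
    (tame : Tame L₁ L₂) {T₁ : Set (Formula L₁)} {T₂ : Set (Formula L₂)}
    (h₁ : IsUniversalTheory T₁) (h₂ : IsUniversalTheory T₂)
    (si₁ : StablyInfinite T₁ (Set.range Sum.inr)) (si₂ : StablyInfinite T₂ (Set.range Sum.inr))
    {P : Primitive (combine L₁ L₂)} {out : Formula (combine L₁ L₂)}
    (h : IsThreeStepOutput T₁ T₂ P out) : IsCover (unionTheory T₁ T₂) P out := by
  obtain ⟨F, φt, D, outs, hφt, hD, hall, rfl⟩ := h
  have hmem : ∀ o ∈ outs, ∃ d ∈ D, ∃ (G : Separation F d) (ψ₁ : Formula L₂),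
      IsCover T₂ G.primitiveTwo ψ₁ ∧ o = G.output ψ₁ := by
    clear hD
    induction hall with
    | nil => simp
    | cons h _ ih =>
      intro o ho
      rcases List.mem_cons.1 ho with rfl | ho
      · exact ⟨_, by simp, h⟩
      · obtain ⟨d, hd, h⟩ := ih o ho
        exact ⟨d, by simp [hd], h⟩
  have hmem' : ∀ d ∈ D, ∃ o ∈ outs, ∃ (G : Separation F d) (ψ₁ : Formula L₂),
      IsCover T₂ G.primitiveTwo ψ₁ ∧ o = G.output ψ₁ := by
    clear hD hmem
    induction hall with
    | nil => simp
    | cons h _ ih =>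
      intro d hd
      rcases List.mem_cons.1 hd with rfl | hd
      · exact ⟨_, by simp, h⟩
      · obtain ⟨o, ho, h⟩ := ih d hd
        exact ⟨o, by simp [ho], h⟩
  have hlv : ∀ d ∈ D, litVars d ⊆ F.primitiveOne.formula.fv := fun d hd =>
    (hD.1 d hd).trans hφt.2.1
  have hqf : (Formula.disj outs).IsQF := Formula.isQF_disj fun o ho => by
    obtain ⟨d, hd, G, ψ₁, hψ, rfl⟩ := hmem o ho
    exact ⟨(isQF_constraint _).left, hψ.1.right.subst _⟩
  refine ⟨hqf, ?_, ?_, ?_⟩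
  · intro x hx
    obtain ⟨o, ho, hx⟩ := Formula.mem_fv_disj.1 hx
    obtain ⟨d, hd, G, ψ₁, hψ, rfl⟩ := hmem o ho
    exact G.fv_output (hlv d hd) hψ hx
  · intro M hM v hv
    obtain ⟨hM₁, hM₂⟩ := (models_union_iff h₁ h₂ M).1 hM
    obtain ⟨hφ, hψ⟩ := (F.sat_iff v).1 hv
    have h1 : φt.Sat M.left (Assignment.left (assignShared v F.η' F.t)) := by
      refine hφt.2.2.1 _ hM₁ _ ((F.sat_primitiveOne _).2 ⟨?_, fun y hy => ?_⟩)
      · exact (sat_constraint_of_private (u := Assignment.left v)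
          (v := Assignment.left (assignShared v F.η' F.t)) F.φ_private fun a n => rfl).1 hφ
      · exact (assignShared_of_mem v F.η' F.t hy).trans
          (Term.eval_of_private _ (F.t_private y hy) fun a n => rfl)
    obtain ⟨d, hd, hdv⟩ := (hD.2 _ _).1 h1
    obtain ⟨o, ho, G, ψ₁, hψ₁, rfl⟩ := hmem' d hd
    exact (Formula.sat_disj _ _ _).2 ⟨_, ho, G.output_of_sat (hlv d hd) hψ₁ hM₂ hdv hψ⟩
  · intro θ hθ hbv hent M hM v hv
    by_contra hn
    obtain ⟨M, hM, cM, v, hv, hn⟩ := (isUniversalTheory_union h₁ h₂).exists_countable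
      (φ := .and (Formula.disj outs) (.not θ)) ⟨hqf, hθ⟩ ⟨M, hM, v, hv, hn⟩
    obtain ⟨o, ho, hv⟩ := (Formula.sat_disj _ _ _).1 hv
    obtain ⟨d, hd, G, ψ₁, hψ, rfl⟩ := hmem o ho
    obtain ⟨K, hK, E, W, hW, hWv⟩ := G.exists_extension tame h₁ h₂ si₁ si₂ hφt
      (fun M u h => (hD.2 M u).2 ⟨d, hd, h⟩) hψ hM hv
    refine hn ((E.sat v θ hθ).1 ((θ.sat_congr K fun x hx => ?_).1 (hent K hK W hW)))
    exact hWv _ _ fun h => hbv _ h hx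

end ThreeStep

end ManySorted

namespace ManySorted

/-! ### Covers from model completions, and quantifier elimination from covers -/

section Completion

variable {S : Type} {L : Signature S}

theorem IsCompanion.satisfiable {T U : Set (Formula L)} (h : IsCompanion T U) {φ : Formula L}
    (hφ : φ.IsQF) (hs : Satisfiable T φ) : Satisfiable U φ := by
  obtain ⟨M, hM, v, hv⟩ := hs
  obtain ⟨d, hd, hdv⟩ := ((Formula.isDNF_dnf hφ).2 M v).1 hv
  obtain ⟨N, hN, w, hw⟩ := h.2.2 d ⟨M, hM, v, hdv⟩
  exact ⟨N, hN, w, ((Formula.isDNF_dnf hφ).2 N w).2 ⟨d, hd, hw⟩⟩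

/-- A quantifier-free equivalent of a primitive formula in a model completion is a cover. -/
theorem IsCompanion.isCover {T U : Set (Formula L)} (h : IsCompanion T U) {P : Primitive L}
    {ψ : Formula L} (hψ : IsQFEquivalent U P.formula ψ) : IsCover T P ψ := by
  obtain ⟨hq, hfv, h1, h2⟩ := hψ
  refine ⟨hq, hfv, ?_, ?_⟩
  · intro M hM v hv
    by_contra hn
    obtain ⟨N, hN, w, hw, hwn⟩ := h.satisfiable (φ := .and (constraint P.lits) (.not ψ))
      ⟨isQF_constraint _, hq⟩ ⟨M, hM, v, hv, hn⟩
    exact hwn (h1 N hN w ((Formula.sat_exs N).2 ⟨w, fun _ _ _ => rfl, hw⟩))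
  · intro θ hθ hb hent M hM v hv
    by_contra hn
    obtain ⟨N, hN, w, hw, hwn⟩ := h.satisfiable (φ := .and ψ (.not θ)) ⟨hq, hθ⟩
      ⟨M, hM, v, hv, hn⟩
    obtain ⟨u, hu, hc⟩ := (Formula.sat_exs N).1 (h2 N hN w hw)
    refine hwn ((θ.sat_congr N fun x hx => hu _ _ fun hxb => hb _ hxb hx).1 ?_)
    exact hent N (fun φ hφ => hN φ (h.2.1 hφ)) u hc

/-- The models of `T` in which every cover of a primitive formula implies the formula. -/
def IsCoverModel (T : Set (Formula L)) (N : Struct L) : Prop :=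
  Models N T ∧ ∀ P ψ, IsCover T P ψ → ∀ v : Assignment N, ψ.Sat N v → P.formula.Sat N v

/-- The theory of the models in which covers imply the formulae they cover. -/
def coverCompletion (T : Set (Formula L)) : Set (Formula L) :=
  {σ | σ.fv = ∅ ∧ ∀ N, IsCoverModel T N → ∀ v : Assignment N, σ.Sat N v}

theorem Formula.exists_closure (φ : Formula L) : ∃ xs, (Formula.alls xs φ).fv = ∅ := by
  refine ⟨φ.fv_finite.toFinset.toList, Set.eq_empty_of_forall_notMem fun x hx => ?_⟩
  rw [Formula.mem_fv_alls] at hx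
  simp at hx

/-- The class of cover models is elementary: besides `T`, it suffices to have the universal closures
of all implications from covers to the formulae they cover. -/
theorem models_coverCompletion_iff {T : Set (Formula L)} (hT : IsTheory T) (N : Struct L) :
    Models N (coverCompletion T) ↔ IsCoverModel T N := by
  refine ⟨fun h => ⟨fun φ hφ => h φ ⟨hT φ hφ, fun N hN => hN.1 φ hφ⟩, ?_⟩, fun h φ hφ => hφ.2 N h⟩
  intro P ψ hψ v hv
  obtain ⟨xs, hxs⟩ := (Formula.or (.not ψ) P.formula).exists_closure
  have := (Formula.forall_sat_alls N).1 (h _ ⟨hxs, fun N hN => (Formula.forall_sat_alls N).2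
    fun v => (em (ψ.Sat N v)).symm.imp id fun hv => hN.2 P ψ hψ v hv⟩) v
  exact this.resolve_left fun hn => hn hv

/-- The converse implication holds in all models of `T`, because the bound variables are not free in
the cover. -/
theorem IsCover.sat_iff {T : Set (Formula L)} {N : Struct L} (hN : IsCoverModel T N)
    {P : Primitive L} {ψ : Formula L} (h : IsCover T P ψ) (v : Assignment N) :
    ψ.Sat N v ↔ P.formula.Sat N v := by
  refine ⟨hN.2 P ψ h v, fun hv => ?_⟩
  obtain ⟨w, hw, hc⟩ := (Formula.sat_exs N).1 hv
  refine (ψ.sat_congr N fun x hx => ?_).1 (h.2.2.1 N hN.1 w hc)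
  exact hw _ _ (Primitive.mem_fv_formula.1 (h.2.1 hx)).2

/-! ### Quantifier elimination -/

/-- Quantifier elimination by means of a function `c` that gives covers of primitive formulae. -/
def Formula.qe (c : Primitive L → Formula L) : Formula L → Formula L
  | .bot => .bot
  | .atom a => .atom a
  | .not φ => .not (φ.qe c)
  | .and φ χ => .and (φ.qe c) (χ.qe c)
  | .or φ χ => .or (φ.qe c) (χ.qe c)
  | .all s n φ => .not (.disj ((φ.qe c).dnfPair.2.map fun d => c ⟨[(s, n)], d⟩))
  | .ex s n φ => .disj ((φ.qe c).dnfPair.1.map fun d => c ⟨[(s, n)], d⟩)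

variable {T : Set (Formula L)} {c : Primitive L → Formula L} (hc : ∀ P, IsCover T P (c P))
include hc

theorem Formula.isQF_qe : ∀ φ : Formula L, (φ.qe c).IsQF
  | .bot => trivial
  | .atom _ => trivial
  | .not φ => φ.isQF_qe
  | .and φ χ => ⟨φ.isQF_qe, χ.isQF_qe⟩
  | .or φ χ => ⟨φ.isQF_qe, χ.isQF_qe⟩
  | .all s n φ => Formula.isQF_disj fun χ h => by
    obtain ⟨d, -, rfl⟩ := List.mem_map.1 h
    exact (hc _).1
  | .ex s n φ => Formula.isQF_disj fun χ h => by
    obtain ⟨d, -, rfl⟩ := List.mem_map.1 h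
    exact (hc _).1

theorem Formula.fv_disj_cover_subset {s : S} {n : ℕ} {V : Set (S × ℕ)} {D : List (List (Literal L))}
    (hD : ∀ d ∈ D, litVars d ⊆ V) :
    (Formula.disj (D.map fun d => c ⟨[(s, n)], d⟩)).fv ⊆ V \ {(s, n)} := by
  intro x hx
  obtain ⟨χ, hχ, hx⟩ := Formula.mem_fv_disj.1 hx
  obtain ⟨d, hd, rfl⟩ := List.mem_map.1 hχ
  obtain ⟨h1, h2⟩ := Primitive.mem_fv_formula.1 ((hc _).2.1 hx)
  exact ⟨hD d hd h1, by simpa using h2⟩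

theorem Formula.fv_qe_subset : ∀ φ : Formula L, (φ.qe c).fv ⊆ φ.fv
  | .bot => subset_rfl
  | .atom _ => subset_rfl
  | .not φ => φ.fv_qe_subset
  | .and φ χ => Set.union_subset_union φ.fv_qe_subset χ.fv_qe_subset
  | .or φ χ => Set.union_subset_union φ.fv_qe_subset χ.fv_qe_subset
  | .all _ _ φ => Formula.fv_disj_cover_subset hc fun d hd =>
    ((φ.qe c).dnfPair_vars (φ.isQF_qe hc) d (Or.inr hd)).trans φ.fv_qe_subset
  | .ex _ _ φ => Formula.fv_disj_cover_subset hc fun d hd =>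
    ((φ.qe c).dnfPair_vars (φ.isQF_qe hc) d (Or.inl hd)).trans φ.fv_qe_subset

/-- An existential quantifier distributes over a disjunctive normal form, leaving one-variable
primitive formulae. The predicate `p` is a parameter so that the same argument serves `∃ φ` and, for
universal quantifiers, `∃ ¬ φ`. -/
theorem Formula.sat_disj_cover {N : Struct L} (hN : IsCoverModel T N) {s : S} {n : ℕ}
    {p : Assignment N → Prop} {D : List (List (Literal L))}
    (hD : ∀ v : Assignment N, (∃ d ∈ D, ∀ l ∈ d, Literal.Holds N v l) ↔ p v) (v : Assignment N) :
    (Formula.disj (D.map fun d => c ⟨[(s, n)], d⟩)).Sat N v ↔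
      ∃ w : Assignment N, AgreeOff s n v w ∧ p w := by
  simp only [Formula.sat_disj, List.mem_map, exists_exists_and_eq_and, (hc _).sat_iff hN,
    Primitive.formula, Formula.exs, Formula.Sat, sat_constraint, ← hD]
  constructor
  · rintro ⟨d, hd, w, hw, h⟩; exact ⟨w, hw, d, hd, h⟩
  · rintro ⟨w, hw, d, hd, h⟩; exact ⟨d, hd, w, hw, h⟩

theorem Formula.sat_qe {N : Struct L} (hN : IsCoverModel T N) :
    ∀ (φ : Formula L) (v : Assignment N), (φ.qe c).Sat N v ↔ φ.Sat N v
  | .bot, _ => Iff.rfl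
  | .atom _, _ => Iff.rfl
  | .not φ, v => not_congr (φ.sat_qe hN v)
  | .and φ χ, v => and_congr (φ.sat_qe hN v) (χ.sat_qe hN v)
  | .or φ χ, v => or_congr (φ.sat_qe hN v) (χ.sat_qe hN v)
  | .all s n φ, v => by
    refine (not_congr (Formula.sat_disj_cover hc hN (fun u =>
      ((φ.qe c).sat_dnfPair N u (φ.isQF_qe hc)).2) v)).trans ?_
    simp only [Formula.Sat, φ.sat_qe hN]
    push Not
    rfl
  | .ex s n φ, v => by
    refine (Formula.sat_disj_cover hc hN (fun u =>
      ((φ.qe c).sat_dnfPair N u (φ.isQF_qe hc)).1) v).trans ?_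
    simp only [Formula.Sat, φ.sat_qe hN]

theorem Formula.isQFEquivalent_qe (hT : IsTheory T) (φ : Formula L) :
    IsQFEquivalent (coverCompletion T) φ (φ.qe c) := by
  refine ⟨φ.isQF_qe hc, φ.fv_qe_subset hc, fun N hN v hv => ?_, fun N hN v hv => ?_⟩
  · exact (φ.sat_qe hc ((models_coverCompletion_iff hT N).1 hN) v).2 hv
  · exact (φ.sat_qe hc ((models_coverCompletion_iff hT N).1 hN) v).1 hv

end Completion

/-! ### A chain of extensions in which all covers come to imply what they cover -/

section Chain

variable {S : Type} {L : Signature S}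

/-- The level of the variables with index `n`. -/
def varLevel (n : ℕ) : ℕ := n.unpair.1

/-- A countable model of `T` with an assignment. -/
structure PointedModel (T : Set (Formula L)) where
  M : Struct L
  w : Assignment M
  models : Models M T
  countable : ∀ s, Countable (M.carrier s)

/-- Every element is the value of a variable of level at most `k`. -/
def PointedModel.Named {T : Set (Formula L)} (p : PointedModel T) (k : ℕ) : Prop :=
  ∀ s (x : p.M.carrier s), ∃ n, varLevel n ≤ k ∧ p.w s n = x

/-- An extension that leaves the values of the variables of level at most `k` unchanged, and that
realizes the matrix of `P` over the values of the variables `ρ x`, if the cover of `P` holds there. -/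
structure PointedModel.Step {T : Set (Formula L)} (c : Primitive L → Formula L) (k : ℕ)
    (P : Primitive L) (ρ : (S × ℕ) →₀ ℕ) (p q : PointedModel T) where
  h : Emb p.M q.M
  eq : ∀ s n, varLevel n ≤ k → q.w s n = h.toFun s (p.w s n)
  realize : (c P).Sat p.M (fun s n => p.w s (ρ (s, n))) → ∃ u : Assignment q.M,
    (constraint P.lits).Sat q.M u ∧
      ∀ s n, (s, n) ∉ P.bv → u s n = h.toFun s (p.w s (ρ (s, n)))

/-- The extension property of covers meets one request; if the cover fails at the requested
parameters, the structure stays as it is. -/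
theorem PointedModel.exists_step [∀ s, Countable (Term L s)] {T : Set (Formula L)}
    (hT : IsUniversalTheory T) {c : Primitive L → Formula L} (hc : ∀ P, IsCover T P (c P)) (k : ℕ)
    (P : Primitive L) (ρ : (S × ℕ) →₀ ℕ) (p : PointedModel T) :
    ∃ q : PointedModel T, q.Named (k + 1) ∧ Nonempty (PointedModel.Step c k P ρ p q) := by
  classical
  have := p.countable
  obtain ⟨N, hN, cN, h, hr⟩ : ∃ N : Struct L, Models N T ∧ (∀ s, Countable (N.carrier s)) ∧
      ∃ h : Emb p.M N, (c P).Sat p.M (fun s n => p.w s (ρ (s, n))) → ∃ u : Assignment N,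
        (constraint P.lits).Sat N u ∧
          ∀ s n, (s, n) ∉ P.bv → u s n = h.toFun s (p.w s (ρ (s, n))) := by
    by_cases hs : (c P).Sat p.M (fun s n => p.w s (ρ (s, n)))
    · obtain ⟨N, hN, cN, h, u, hu⟩ := (hc P).exists_extension hT p.M p.models _ hs
      exact ⟨N, hN, cN, h, fun _ => ⟨u, hu⟩⟩
    · exact ⟨p.M, p.models, p.countable, ⟨fun _ x => x, fun _ _ _ h => h, fun _ _ => rfl,
        fun _ _ => Iff.rfl⟩, fun h => (hs h).elim⟩
  have := N.nonempty
  choose enum henum using fun s => exists_surjective_nat (N.carrier s)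
  -- Variables of level at most `k` are carried along by the embedding; those of level `k + 1` are
  -- free to enumerate the new model.
  refine ⟨⟨N, fun s n => if varLevel n ≤ k then h.toFun s (p.w s n) else enum s n.unpair.2, hN, cN⟩,
    fun s x => ?_, ⟨⟨h, fun s n hn => if_pos hn, hr⟩⟩⟩
  obtain ⟨i, rfl⟩ := henum s x
  refine ⟨Nat.pair (k + 1) i, by simp [varLevel], ?_⟩
  simp [varLevel]

/-- If every primitive formula has a cover, then every satisfiable quantifier-free formula is
satisfiable in a model in which covers imply the formulae they cover. -/
theorem exists_coverModel [Countable S] [∀ s, Countable (Term L s)] [Countable (Primitive L)]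
    {T : Set (Formula L)}
    (hT : IsUniversalTheory T) {c : Primitive L → Formula L} (hc : ∀ P, IsCover T P (c P))
    {φ : Formula L} (hφ : φ.IsQF) (hs : Satisfiable T φ) :
    ∃ N, IsCoverModel T N ∧ ∃ v : Assignment N, φ.Sat N v := by
  classical
  obtain ⟨M₀, hM₀, cM₀, v₀, hv₀⟩ := hT.exists_countable hφ hs
  have := M₀.nonempty
  choose enum henum using fun s => exists_surjective_nat (M₀.carrier s)
  have : Nonempty (Primitive L × ((S × ℕ) →₀ ℕ)) := ⟨⟨[], []⟩, 0⟩
  obtain ⟨req, hreq⟩ := exists_surjective_nat (Primitive L × ((S × ℕ) →₀ ℕ))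
  choose next hnamed hstep using fun k P ρ (p : PointedModel T) => p.exists_step hT hc k P ρ
  -- Stage `k` meets the request numbered `k.unpair.1`, so each request recurs at arbitrarily late
  -- stages.
  let seq : ℕ → PointedModel T := fun k => Nat.rec
    ⟨M₀, fun s n => enum s n.unpair.2, hM₀, cM₀⟩
    (fun k p => next k (req k.unpair.1).1 (req k.unpair.1).2 p) k
  have named : ∀ k, (seq k).Named k := by
    rintro (_ | k)
    · intro s x
      obtain ⟨i, rfl⟩ := henum s x
      refine ⟨Nat.pair 0 i, by simp [varLevel], ?_⟩
      change enum s _ = _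
      simp
    · exact hnamed _ _ _ _
  have step : ∀ k, Nonempty (PointedModel.Step c k (req k.unpair.1).1 (req k.unpair.1).2
      (seq k) (seq (k + 1))) := fun k => hstep _ _ _ _
  -- the values of frozen variables satisfy the same formulae at all later stages
  have frozen : ∀ k (θ : Formula L), θ.IsQF → (∀ x ∈ θ.fv, varLevel x.2 ≤ k) → ∀ j, k ≤ j →
      (θ.Sat (seq j).M (seq j).w ↔ θ.Sat (seq k).M (seq k).w) := by
    intro k θ hθ hl j hj
    induction j, hj using Nat.le_induction with
    | base => rfl
    | succ j hj ih =>
      rw [← ih]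
      obtain ⟨st⟩ := step j
      rw [← st.h.sat _ _ hθ]
      exact θ.sat_congr _ fun x hx => st.eq _ _ ((hl x hx).trans hj)
  -- Truth of a quantifier-free formula is constant once its variables are frozen, so along a
  -- non-principal ultrafilter the limit plays the role of the union of the chain.
  let 𝒰 : Ultrafilter ℕ := Filter.hyperfilter ℕ
  have h𝒰 : (𝒰 : Filter ℕ) ≤ Filter.atTop := Nat.hyperfilter_le_atTop
  let N := limitStruct 𝒰 (fun k => (seq k).M) (fun k => (seq k).w)
  let w : Assignment N := limitAssignment 𝒰 (fun k => (seq k).M) (fun k => (seq k).w)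
  have hN : Models N T := limit_models _ _ _ hT fun k => (seq k).models
  have hlim : ∀ k (θ : Formula L), θ.IsQF → (∀ x ∈ θ.fv, varLevel x.2 ≤ k) →
      (θ.Sat N w ↔ θ.Sat (seq k).M (seq k).w) := by
    intro k θ hθ hl
    rw [limit_sat _ _ _ _ hθ]
    have hev : ∀ᶠ j in (𝒰 : Filter ℕ),
        (θ.Sat (seq j).M (seq j).w ↔ θ.Sat (seq k).M (seq k).w) :=
      h𝒰 ((Filter.eventually_ge_atTop k).mono fun j hj => frozen k θ hθ hl j hj)
    rw [Filter.eventually_congr hev]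
    exact Filter.eventually_const
  choose name hname using named
  -- Stage `k` is mapped into the limit by giving each element the limit value of a frozen variable
  -- that names it.
  let e : ∀ k s, (seq k).M.carrier s → N.carrier s := fun k s x => w s (name k s x)
  have hsub : ∀ k (θ : Formula L) (hθ : θ.IsQF) (r : S → ℕ → ℕ),
      (∀ s n, varLevel (r s n) ≤ k) →
      (θ.Sat N (fun s n => w s (r s n)) ↔
        θ.Sat (seq k).M (fun s n => (seq k).w s (r s n))) := by
    intro k θ hθ r hr
    have h1 := Formula.sat_subst N w (fun s n => .var s (r s n)) θ hθ
    have h2 := Formula.sat_subst (seq k).M (seq k).w (fun s n => .var s (r s n)) θ hθ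
    refine h1.symm.trans (Iff.trans (hlim k _ (hθ.subst _) fun x hx => ?_) h2)
    rw [Formula.fv_subst _ hθ] at hx
    simp only [Set.mem_iUnion, Term.vars, Set.mem_singleton_iff] at hx
    obtain ⟨y, -, rfl⟩ := hx
    exact hr _ _
  have he : ∀ k (θ : Formula L), θ.IsQF → ∀ v : Assignment (seq k).M,
      (θ.Sat N (fun s n => e k s (v s n)) ↔ θ.Sat (seq k).M v) := by
    intro k θ hθ v
    refine (hsub k θ hθ (fun s n => name k s (v s n)) fun s n => (hname k s _).1).trans ?_
    simp only [(hname k _ _).2]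
  have hew : ∀ k s n, varLevel n ≤ k → e k s ((seq k).w s n) = w s n := by
    intro k s n hn
    refine (hlim k (.atom (.eq s (.var s (name k s ((seq k).w s n))) (.var s n))) trivial ?_).2 ?_
    · rintro x (rfl | rfl)
      exacts [(hname k s _).1, hn]
    · exact (hname k s _).2
  -- Every element of the limit comes from a stage: a term has a value once its variables are
  -- frozen, and that value is named by a variable.
  have hvar : ∀ s (x : N.carrier s), ∃ n, w s n = x := by
    intro s x
    obtain ⟨t, rfl⟩ := Quotient.exists_rep x
    obtain ⟨k, hk⟩ := exists_index_bound t.vars_finite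
    have ht : ∀ y ∈ t.vars, varLevel y.2 ≤ k := fun y hy =>
      (Nat.unpair_left_le _).trans (hk y hy).le
    refine ⟨name k s (t.eval (seq k).M (seq k).w), ?_⟩
    rw [← limit_eval]
    refine (hlim k (.atom (.eq s (.var s (name k s (t.eval (seq k).M (seq k).w))) t))
      trivial ?_).2 ?_
    · rintro x (rfl | hx)
      exacts [(hname k s _).1, ht x hx]
    · exact (hname k s _).2
  refine ⟨N, ⟨hN, fun P ψ hψ v hv => ?_⟩, _, (he 0 φ hφ v₀).2 hv₀⟩
  -- Cover models are asked to respect every cover, while the chain uses only the chosen ones; any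
  -- cover of `P` entails the chosen one modulo `T`.
  have hcv : (c P).Sat N v := hψ.2.2.2 (c P) (hc P).1
    (fun x hx hf => (Primitive.mem_fv_formula.1 ((hc P).2.1 hf)).2 hx) (hc P).2.2.1 N hN v hv
  choose r hr using hvar
  let V := P.formula.fv_finite.toFinset
  -- Only the finitely many free variables of `P` need names for their values. Finite support keeps
  -- the set of requests countable.
  let ρ : (S × ℕ) →₀ ℕ := Finsupp.onFinset V
    (fun x => if x ∈ V then r x.1 (v x.1 x.2) else 0) fun x hx => by
      by_contra hn
      simp [hn] at hx
  have hρ : ∀ x ∈ P.formula.fv, w x.1 (ρ x) = v x.1 x.2 := by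
    intro x hx
    have : x ∈ V := by simpa [V] using hx
    simp only [ρ, Finsupp.onFinset_apply, this, if_true]
    exact hr _ _
  obtain ⟨K, hK⟩ := (Set.finite_range fun x : V => ρ x.1).bddAbove
  have hρK : ∀ x, ρ x ≤ K := by
    intro x
    by_cases hx : x ∈ V
    · exact hK ⟨⟨x, hx⟩, rfl⟩
    · simp [ρ, hx]
  obtain ⟨i, hi⟩ := hreq (P, ρ)
  -- This stage meets the request `(P, ρ)`, and `K ≤ Nat.pair i K` guarantees that the parameters
  -- are already frozen.
  let j := Nat.pair i K
  have hj : ∀ x, varLevel (ρ x) ≤ j := fun x =>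
    (Nat.unpair_left_le _).trans ((hρK x).trans (Nat.right_le_pair i K))
  obtain ⟨st⟩ := step j
  have hij : req j.unpair.1 = (P, ρ) := by simp [j, hi]
  rw [hij] at st
  obtain ⟨u, hu, huw⟩ := st.realize (by
    refine (hsub j (c P) (hc P).1 (fun s n => ρ (s, n)) fun s n => hj _).1 ?_
    exact ((c P).sat_congr N fun x hx => hρ x ((hc P).2.1 hx)).2 hcv)
  refine (Formula.sat_congr N _ fun x hx => ?_).1
    ((Formula.sat_exs N).2 ⟨_, fun _ _ _ => rfl, (he (j + 1) _ (isQF_constraint _) u).2 hu⟩)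
  obtain ⟨s, n⟩ := x
  change e (j + 1) s (u s n) = v s n
  rw [huw s n (Primitive.mem_fv_formula.1 hx).2, ← st.eq _ _ (hj _),
    hew _ _ _ ((hj _).trans (Nat.le_succ _))]
  exact hρ (s, n) hx

theorem isCompanion_coverCompletion [Countable S] [∀ s, Countable (Term L s)]
    [Countable (Primitive L)] {T : Set (Formula L)} (hT : IsUniversalTheory T)
    {c : Primitive L → Formula L} (hc : ∀ P, IsCover T P (c P)) :
    IsCompanion T (coverCompletion T) := by
  refine ⟨fun φ h => h.1, fun φ hφ => ⟨hT.1 φ hφ, fun N hN => hN.1 φ hφ⟩, fun ls hs => ?_⟩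
  obtain ⟨N, hN, v, hv⟩ := exists_coverModel hT hc (isQF_constraint ls) hs
  exact ⟨N, (models_coverCompletion_iff hT.1 N).2 hN, v, hv⟩

end Chain

end ManySorted

namespace ManySorted

/-! ### Closure rules for primitive recursive and computable functions -/

section PrimrecFunProp

attribute [fun_prop] Primrec Computable

variable {α β γ σ : Type} [Primcodable α] [Primcodable β] [Primcodable γ] [Primcodable σ]

@[fun_prop] theorem primrec_id : Primrec (fun a : α => a) := Primrec.id

@[fun_prop] theorem primrec_const (x : σ) : Primrec (fun _ : α => x) := Primrec.const x

@[fun_prop] theorem primrec_comp {f : β → σ} {g : α → β} (hf : Primrec f) (hg : Primrec g) :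
    Primrec fun a => f (g a) := hf.comp hg

@[fun_prop] theorem primrec_fst {f : α → β × γ} (hf : Primrec f) : Primrec fun a => (f a).1 :=
  Primrec.fst.comp hf

@[fun_prop] theorem primrec_snd {f : α → β × γ} (hf : Primrec f) : Primrec fun a => (f a).2 :=
  Primrec.snd.comp hf

@[fun_prop] theorem primrec_mk {f : α → β} {g : α → γ} (hf : Primrec f) (hg : Primrec g) :
    Primrec fun a => (f a, g a) := Primrec.pair hf hg

@[fun_prop] theorem primrec_unpair {f : α → ℕ} (hf : Primrec f) :
    Primrec fun a => (f a).unpair := Primrec.unpair.comp hf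

@[fun_prop] theorem primrec_natPair {f g : α → ℕ} (hf : Primrec f) (hg : Primrec g) :
    Primrec fun a => Nat.pair (f a) (g a) := Primrec₂.natPair.comp hf hg

@[fun_prop] theorem primrec_add {f g : α → ℕ} (hf : Primrec f) (hg : Primrec g) :
    Primrec fun a => f a + g a := Primrec.nat_add.comp hf hg

@[fun_prop] theorem primrec_sub {f g : α → ℕ} (hf : Primrec f) (hg : Primrec g) :
    Primrec fun a => f a - g a := Primrec.nat_sub.comp hf hg

@[fun_prop] theorem primrec_mul {f g : α → ℕ} (hf : Primrec f) (hg : Primrec g) :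
    Primrec fun a => f a * g a := Primrec.nat_mul.comp hf hg

@[fun_prop] theorem primrec_div {f g : α → ℕ} (hf : Primrec f) (hg : Primrec g) :
    Primrec fun a => f a / g a := Primrec.nat_div.comp hf hg

@[fun_prop] theorem primrec_mod {f g : α → ℕ} (hf : Primrec f) (hg : Primrec g) :
    Primrec fun a => f a % g a := Primrec.nat_mod.comp hf hg

@[fun_prop] theorem primrec_beq {f g : α → ℕ} (hf : Primrec f) (hg : Primrec g) :
    Primrec fun a => f a == g a :=
  (Primrec.eq.comp hf hg).decide.of_eq fun a => by simp [BEq.beq]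

@[fun_prop] theorem primrec_ble {f g : α → ℕ} (hf : Primrec f) (hg : Primrec g) :
    Primrec fun a => Nat.ble (f a) (g a) :=
  (Primrec.nat_le.comp hf hg).decide.of_eq fun a => by rw [Bool.eq_iff_iff]; simp

@[fun_prop] theorem primrec_and {f g : α → Bool} (hf : Primrec f) (hg : Primrec g) :
    Primrec fun a => f a && g a := Primrec.and.comp hf hg

@[fun_prop] theorem primrec_cond {c : α → Bool} {f g : α → σ} (hc : Primrec c) (hf : Primrec f)
    (hg : Primrec g) : Primrec fun a => bif c a then f a else g a := Primrec.cond hc hf hg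

@[fun_prop] theorem primrec_some {f : α → β} (hf : Primrec f) : Primrec fun a => some (f a) :=
  Primrec.option_some.comp hf

@[fun_prop] theorem primrec_cons {f : α → β} {g : α → List β} (hf : Primrec f) (hg : Primrec g) :
    Primrec fun a => f a :: g a := Primrec.list_cons.comp hf hg

@[fun_prop] theorem primrec_append {f g : α → List β} (hf : Primrec f) (hg : Primrec g) :
    Primrec fun a => f a ++ g a := Primrec.list_append.comp hf hg

@[fun_prop] theorem primrec_flatten {f : α → List (List β)} (hf : Primrec f) :
    Primrec fun a => (f a).flatten := Primrec.list_flatten.comp hf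

@[fun_prop] theorem primrec_map {f : α → List β} {g : α → β → σ} (hf : Primrec f)
    (hg : Primrec fun p : α × β => g p.1 p.2) : Primrec fun a => (f a).map (g a) :=
  Primrec.list_map hf hg.to₂

@[fun_prop] theorem primrec_flatMap {f : α → List β} {g : α → β → List σ} (hf : Primrec f)
    (hg : Primrec fun p : α × β => g p.1 p.2) : Primrec fun a => (f a).flatMap (g a) :=
  Primrec.list_flatMap hf hg.to₂

@[fun_prop] theorem primrec_filterMap {f : α → List β} {g : α → β → Option σ} (hf : Primrec f)
    (hg : Primrec fun p : α × β => g p.1 p.2) : Primrec fun a => (f a).filterMap (g a) :=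
  Primrec.listFilterMap hf hg.to₂

@[fun_prop] theorem primrec_foldr {f : α → List β} {g : α → σ} {h : α → β → σ → σ}
    (hf : Primrec f) (hg : Primrec g) (hh : Primrec fun p : α × β × σ => h p.1 p.2.1 p.2.2) :
    Primrec fun a => (f a).foldr (h a) (g a) :=
  Primrec.list_foldr hf hg hh.to₂

@[fun_prop] theorem primrec_getD {f : α → List β} {g : α → ℕ} (d : β) (hf : Primrec f)
    (hg : Primrec g) : Primrec fun a => (f a).getD (g a) d := (Primrec.list_getD d).comp hf hg

@[fun_prop] theorem primrec_encode {f : α → List ℕ} (hf : Primrec f) :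
    Primrec fun a => Encodable.encode (f a) := Primrec.encode.comp hf

/-- A computable function can be mapped over a list. -/
theorem computable_map {f : α → List β} {g : α → β → σ} (hf : Computable f)
    (hg : Computable fun p : α × β => g p.1 p.2) : Computable fun a => (f a).map (g a) := by
  -- Recursion on the number of entries already processed; an entry out of range contributes
  -- nothing.
  have h : Computable fun a => Nat.rec (motive := fun _ => List σ) []
      (fun i acc => acc ++ Option.casesOn (motive := fun _ => List σ) ((f a)[i]?) []
        fun b => [g a b]) (f a).length := by
    refine Computable.nat_rec (h := fun a p => p.2 ++ Option.casesOn (motive := fun _ => List σ)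
      ((f a)[p.1]?) [] fun b => [g a b]) (Computable.list_length.comp hf) (Computable.const []) ?_
    refine Computable.list_append.comp (Computable.snd.comp Computable.snd) ?_
    refine Computable.option_casesOn (Computable.list_getElem?.comp (hf.comp Computable.fst)
      (Computable.fst.comp Computable.snd)) (Computable.const []) ?_
    refine Computable.list_cons.comp ?_ (Computable.const [])
    exact hg.comp (Computable.pair (Computable.fst.comp Computable.fst) Computable.snd)
  refine h.of_eq fun a => ?_
  have key : ∀ n, Nat.rec (motive := fun _ => List σ) []
      (fun i acc => acc ++ Option.casesOn (motive := fun _ => List σ) ((f a)[i]?) []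
        fun b => [g a b]) n = ((f a).take n).map (g a) := by
    intro n
    induction n with
    | zero => rfl
    | succ n ih =>
      have e : ∀ o : Option β, o.toList.map (g a) =
          Option.casesOn (motive := fun _ => List σ) o [] fun b => [g a b] := by
        rintro (_ | b) <;> rfl
      rw [List.take_add_one, List.map_append, ← ih, e]
  rw [key, List.take_length]

end PrimrecFunProp

/-! ### Recursion on codes -/

section CodeRec

variable {α σ : Type}

/-- The values of a function defined by course-of-values recursion, below a given number. -/
def recTable (G : α → ℕ → List σ → σ) (a : α) : ℕ → List σ
  | 0 => []
  | n + 1 => recTable G a n ++ [G a n (recTable G a n)]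

/-- Course-of-values recursion. -/
def codeRec (G : α → ℕ → List σ → σ) (a : α) (n : ℕ) : σ := G a n (recTable G a n)

theorem length_recTable (G : α → ℕ → List σ → σ) (a : α) (n : ℕ) :
    (recTable G a n).length = n := by
  induction n with
  | zero => rfl
  | succ n ih => simp [recTable, ih]

theorem getD_recTable (G : α → ℕ → List σ → σ) (a : α) (d : σ) {m n : ℕ} (h : m < n) :
    (recTable G a n).getD m d = codeRec G a m := by
  induction n with
  | zero => omega
  | succ n ih =>
    rw [recTable, List.getD_eq_getElem?_getD]
    rcases Nat.lt_succ_iff_lt_or_eq.1 h with h' | rfl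
    · rw [List.getElem?_append_left (by rw [length_recTable]; exact h'),
        ← List.getD_eq_getElem?_getD, ih h']
    · rw [List.getElem?_append_right (by rw [length_recTable])]
      simp [length_recTable, codeRec]

variable [Primcodable α] [Primcodable σ]

@[fun_prop] theorem primrec_codeRec {G : α → ℕ → List σ → σ}
    (hG : Primrec fun p : α × ℕ × List σ => G p.1 p.2.1 p.2.2) :
    Primrec fun p : α × ℕ => codeRec G p.1 p.2 := by
  have h : Primrec fun p : α × ℕ => recTable G p.1 p.2 := by
    have := Primrec.nat_rec (f := fun _ : α => ([] : List σ))
      (g := fun a (p : ℕ × List σ) => p.2 ++ [G a p.1 p.2]) (Primrec.const [])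
      (Primrec.list_append.comp (Primrec.snd.comp Primrec.snd) (Primrec.list_cons.comp
        hG (Primrec.const [])))
    refine this.of_eq fun a n => ?_
    induction n with
    | zero => rfl
    | succ n ih => simp only [recTable, ← ih]
  exact hG.comp (Primrec.fst.pair (Primrec.snd.pair h))

theorem computable_codeRec {G : α → ℕ → List σ → σ}
    (hG : Computable fun p : α × ℕ × List σ => G p.1 p.2.1 p.2.2) :
    Computable fun p : α × ℕ => codeRec G p.1 p.2 := by
  have h : Computable fun p : α × ℕ => recTable G p.1 p.2 := by
    have := Computable.nat_rec (f := fun p : α × ℕ => p.2) (g := fun _ => ([] : List σ))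
      (h := fun a (p : ℕ × List σ) => p.2 ++ [G a.1 p.1 p.2]) Computable.snd (Computable.const [])
      (Computable.list_append.comp (Computable.snd.comp Computable.snd) (Computable.list_cons.comp
        (hG.comp (Computable.pair (Computable.fst.comp Computable.fst) Computable.snd))
        (Computable.const [])))
    refine this.of_eq fun p => ?_
    obtain ⟨a, n⟩ := p
    induction n with
    | zero => rfl
    | succ n ih => simp only [recTable, ← ih]
  exact hG.comp (Computable.fst.pair (Computable.snd.pair h))

end CodeRec

/-- The list with a given code. -/
def listOf (n : ℕ) : List ℕ := Denumerable.ofNat (List ℕ) n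

@[simp] theorem listOf_encode (l : List ℕ) : listOf (Encodable.encode l) = l :=
  Denumerable.ofNat_encode l

@[fun_prop] theorem primrec_listOf {α : Type} [Primcodable α] {f : α → ℕ} (hf : Primrec f) :
    Primrec fun a => listOf (f a) := (Primrec.ofNat (List ℕ)).comp hf

/-- Needed for course-of-values recursion on terms: the codes of the arguments lie below that of the
application. -/
theorem lt_encode_of_mem {l : List ℕ} {m : ℕ} (h : m ∈ l) : m < Encodable.encode l := by
  induction l with
  | nil => simp at h
  | cons a l ih =>
    rw [Encodable.encode_list_cons]
    rcases List.mem_cons.1 h with rfl | h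
    · exact Nat.lt_succ_of_le (Nat.left_le_pair _ _)
    · exact (ih h).trans_le ((Nat.right_le_pair _ _).trans (Nat.le_succ _))

/-- A positive tag makes the payload strictly smaller. Tag zero does not, since `Nat.pair 0 0 = 0`;
hence falsity is treated apart in `formRec_bot`. -/
theorem lt_pair_of_pos {k : ℕ} (hk : 0 < k) (x : ℕ) : x < Nat.pair k x := by
  unfold Nat.pair
  split_ifs with h
  · have : x ≤ x * x := Nat.le_mul_self x
    omega
  · have : 0 < k * k := Nat.mul_pos hk hk
    omega

section TermRec

variable {σ : Type} [Inhabited σ]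

/-- Recursion on codes of terms: `V` gives the values for variables, `F` those for applications. -/
def termRec (V : ℕ → ℕ → σ) (F : ℕ → ℕ → List σ → σ) : ℕ → ℕ → σ :=
  codeRec fun a n tbl => bif n.unpair.1 == 0 then V a n.unpair.2 else
    F a n.unpair.2 ((listOf n.unpair.2.unpair.2.unpair.2).map fun m => tbl.getD m default)

variable (V : ℕ → ℕ → σ) (F : ℕ → ℕ → List σ → σ)

theorem termRec_var (a x : ℕ) : termRec V F a (Nat.pair 0 x) = V a x := by
  simp [termRec, codeRec]

theorem termRec_app (a s f : ℕ) (l : List ℕ) :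
    termRec V F a (Nat.pair 1 (Nat.pair s (Nat.pair f (Encodable.encode l)))) =
      F a (Nat.pair s (Nat.pair f (Encodable.encode l))) (l.map (termRec V F a)) := by
  rw [termRec, codeRec]
  simp only [Nat.unpair_pair, listOf_encode, Nat.reduceBEq, cond_false]
  congr 1
  refine List.map_congr_left fun m hm => ?_
  refine getD_recTable _ _ _ ((lt_encode_of_mem hm).trans_le ?_)
  exact (Nat.right_le_pair f _).trans ((Nat.right_le_pair s _).trans (Nat.right_le_pair 1 _))

theorem primrec_termRec [Primcodable σ] (hV : Primrec fun p : ℕ × ℕ => V p.1 p.2)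
    (hF : Primrec fun p : ℕ × ℕ × List σ => F p.1 p.2.1 p.2.2) :
    Primrec fun p : ℕ × ℕ => termRec V F p.1 p.2 := by
  unfold termRec
  refine primrec_codeRec ?_
  have h1 : Primrec fun p : ℕ × ℕ × List σ => V p.1 p.2.1.unpair.2 :=
    hV.comp (f := fun p : ℕ × ℕ => V p.1 p.2) (g := fun p : ℕ × ℕ × List σ => (p.1, p.2.1.unpair.2))
      (by fun_prop)
  have h2 : Primrec fun p : ℕ × ℕ × List σ => F p.1 p.2.1.unpair.2
      ((listOf p.2.1.unpair.2.unpair.2.unpair.2).map fun m => p.2.2.getD m default) :=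
    hF.comp (f := fun p : ℕ × ℕ × List σ => F p.1 p.2.1 p.2.2) (g := fun p : ℕ × ℕ × List σ =>
      (p.1, p.2.1.unpair.2,
        (listOf p.2.1.unpair.2.unpair.2.unpair.2).map fun m => p.2.2.getD m default)) (by fun_prop)
  fun_prop

end TermRec

section FormRec

variable {α σ : Type} [Inhabited σ]

/-- Recursion on codes of formulae: the value at `pair k x` is given by `k`, `x` and the values at
`x` and its two components. -/
def formRec (G : α → ℕ → ℕ → σ → σ → σ → σ) : α → ℕ → σ :=
  codeRec fun a n tbl => G a n.unpair.1 n.unpair.2 (tbl.getD n.unpair.2 default)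
    (tbl.getD n.unpair.2.unpair.1 default) (tbl.getD n.unpair.2.unpair.2 default)

/-- The three recursive values are supplied for every tag; `G` uses those that its tag makes
meaningful. -/
theorem formRec_pair (G : α → ℕ → ℕ → σ → σ → σ → σ) (a : α) {k : ℕ} (hk : 0 < k) (x : ℕ) :
    formRec G a (Nat.pair k x) = G a k x (formRec G a x) (formRec G a x.unpair.1)
      (formRec G a x.unpair.2) := by
  have h := lt_pair_of_pos hk x
  rw [formRec, codeRec]
  simp only [Nat.unpair_pair]
  rw [getD_recTable _ _ _ h, getD_recTable _ _ _ ((Nat.unpair_left_le x).trans_lt h),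
    getD_recTable _ _ _ ((Nat.unpair_right_le x).trans_lt h)]

theorem formRec_bot (G : α → ℕ → ℕ → σ → σ → σ → σ) (a : α) :
    formRec G a (Nat.pair 0 0) = G a 0 0 default default default := by
  rw [show Nat.pair 0 0 = 0 from rfl]
  simp [formRec, codeRec, recTable]

theorem primrec_formRec [Primcodable α] [Primcodable σ] {G : α → ℕ → ℕ → σ → σ → σ → σ}
    (hG : Primrec fun p : α × ℕ × ℕ × σ × σ × σ =>
      G p.1 p.2.1 p.2.2.1 p.2.2.2.1 p.2.2.2.2.1 p.2.2.2.2.2) :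
    Primrec fun p : α × ℕ => formRec G p.1 p.2 := by
  unfold formRec
  refine primrec_codeRec ?_
  exact hG.comp (g := fun p : α × ℕ × List σ => (p.1, p.2.1.unpair.1, p.2.1.unpair.2,
    p.2.2.getD p.2.1.unpair.2 default, p.2.2.getD p.2.1.unpair.2.unpair.1 default,
    p.2.2.getD p.2.1.unpair.2.unpair.2 default)) (by fun_prop)

theorem computable_formRec [Primcodable α] [Primcodable σ] {G : α → ℕ → ℕ → σ → σ → σ → σ}
    (hG : Computable fun p : α × ℕ × ℕ × σ × σ × σ =>
      G p.1 p.2.1 p.2.2.1 p.2.2.2.1 p.2.2.2.2.1 p.2.2.2.2.2) :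
    Computable fun p : α × ℕ => formRec G p.1 p.2 := by
  unfold formRec
  refine computable_codeRec ?_
  refine hG.comp (g := fun p : α × ℕ × List σ => (p.1, p.2.1.unpair.1, p.2.1.unpair.2,
    p.2.2.getD p.2.1.unpair.2 default, p.2.2.getD p.2.1.unpair.2.unpair.1 default,
    p.2.2.getD p.2.1.unpair.2.unpair.2 default)) (Primrec.to_comp (by fun_prop))

end FormRec

/-! ### Syntactic operations on codes -/

/-- A sort of the first signature as a sort of the union. -/
def leftSort (s : ℕ) : ℕ := bif s % 2 == 0 then s else 2 * s + 1

/-- A sort of the union as a sort of the first signature. -/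
def unleftSort (s : ℕ) : ℕ := bif s % 2 == 0 then s else s / 2

/-- In a sum type, `Sum.inl` doubles a code and `Sum.inr` doubles it and adds one. Thus parity
distinguishes the two signatures, doubling embeds the symbols of the first, and halving removes the
injection of either. -/
def leftTermCode (n : ℕ) : ℕ :=
  termRec (fun _ x => Nat.pair 0 (Nat.pair (leftSort x.unpair.1) x.unpair.2))
    (fun _ y r => Nat.pair 1 (Nat.pair (leftSort y.unpair.1)
      (Nat.pair (2 * y.unpair.2.unpair.1) (Encodable.encode r)))) 0 n

def unleftTermCode (n : ℕ) : ℕ :=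
  termRec (fun _ x => Nat.pair 0 (Nat.pair (unleftSort x.unpair.1) x.unpair.2))
    (fun _ y r => Nat.pair 1 (Nat.pair (unleftSort y.unpair.1)
      (Nat.pair (y.unpair.2.unpair.1 / 2) (Encodable.encode r)))) 0 n

/-- Replace the maximal terms over the first signature by variables with indices from `N` on. -/
def flatTermCode (N n : ℕ) : ℕ :=
  termRec (fun _ x => Nat.pair 0 (Nat.pair (x.unpair.1 / 2) x.unpair.2))
    (fun N y r => bif y.unpair.2.unpair.1 % 2 == 0 then
        Nat.pair 0 (Nat.pair (y.unpair.1 / 2) (N + 2 * unleftTermCode (Nat.pair 1 y)))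
      else Nat.pair 1 (Nat.pair (y.unpair.1 / 2)
        (Nat.pair (y.unpair.2.unpair.1 / 2) (Encodable.encode r)))) N n

/-- Replace the shared variables with indices from `N` on by the terms they stand for. -/
def substTermCode (N n : ℕ) : ℕ :=
  termRec (fun N x => bif x.unpair.1 % 2 == 1 && Nat.ble N x.unpair.2 then
        leftTermCode ((x.unpair.2 - N) / 2)
      else Nat.pair 0 (Nat.pair (2 * x.unpair.1 + 1) x.unpair.2))
    (fun _ y r => Nat.pair 1 (Nat.pair (2 * y.unpair.1 + 1)
        (Nat.pair (2 * y.unpair.2.unpair.1 + 1) (Encodable.encode r)))) N n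

/-- The variables of a term. -/
def varsTermCode (n : ℕ) : List ℕ :=
  termRec (fun _ x => [x]) (fun _ _ r => r.flatten) 0 n

/-- Apply functions to the sort, the relation symbol and the terms in an atomic formula. -/
def mapAtomCode (S R τ : ℕ → ℕ) (a : ℕ) : ℕ :=
  bif a.unpair.1 == 0 then Nat.pair 0 (Nat.pair (S a.unpair.2.unpair.1)
      (Nat.pair (τ a.unpair.2.unpair.2.unpair.1) (τ a.unpair.2.unpair.2.unpair.2)))
    else Nat.pair 1 (Nat.pair (R a.unpair.2.unpair.1)
      (Encodable.encode ((listOf a.unpair.2.unpair.2).map τ)))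

def leftAtomCode (a : ℕ) : ℕ := mapAtomCode leftSort (fun r => 2 * r) leftTermCode a

def unleftAtomCode (a : ℕ) : ℕ := mapAtomCode unleftSort (fun r => r / 2) unleftTermCode a

def flatAtomCode (N a : ℕ) : ℕ :=
  mapAtomCode (fun s => s / 2) (fun r => r / 2) (fun t => flatTermCode N t) a

def substAtomCode (N a : ℕ) : ℕ :=
  mapAtomCode (fun s => 2 * s + 1) (fun r => 2 * r + 1) (fun t => substTermCode N t) a

/-- The variables of an atomic formula. -/
def varsAtomCode (a : ℕ) : List ℕ :=
  bif a.unpair.1 == 0 then varsTermCode a.unpair.2.unpair.2.unpair.1 ++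
      varsTermCode a.unpair.2.unpair.2.unpair.2
    else (listOf a.unpair.2.unpair.2).flatMap fun t => varsTermCode t

/-- A variable for a term of shared sort `s`: itself, or one with an index from `N` on. -/
def nameCode (N s t : ℕ) : ℕ :=
  bif t.unpair.1 == 0 then t else Nat.pair 0 (Nat.pair s (N + (2 * t + 1)))

def nameAtomCode (N a : ℕ) : ℕ :=
  mapAtomCode (fun s => s) (fun r => r) (fun t => nameCode N a.unpair.2.unpair.1 t) a

/-- Literals are coded as formulae, so in a negated one the atom lies one tag deeper than in a
positive one. -/
def litAtomCode (l : ℕ) : ℕ := bif l.unpair.1 == 1 then l.unpair.2 else l.unpair.2.unpair.2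

def mapLitCode (g : ℕ → ℕ) (l : ℕ) : ℕ :=
  bif l.unpair.1 == 1 then Nat.pair 1 (g l.unpair.2)
    else Nat.pair 2 (Nat.pair 1 (g l.unpair.2.unpair.2))

/-- Does the literal, over the union of the signatures, belong to the first one? -/
def isLeftLitCode (l : ℕ) : Bool := (litAtomCode l).unpair.2.unpair.1 % 2 == 0

/-- Is the literal over the first signature a signed equality of shared sort? -/
def isSharedLitCode (l : ℕ) : Bool :=
  (litAtomCode l).unpair.1 == 0 && (litAtomCode l).unpair.2.unpair.1 % 2 == 1

def conjCode (l : List ℕ) : ℕ :=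
  l.foldr (fun a r => Nat.pair 3 (Nat.pair a r)) (Nat.pair 2 (Nat.pair 0 0))

def disjCode (l : List ℕ) : ℕ :=
  l.foldr (fun a r => Nat.pair 4 (Nat.pair a r)) (Nat.pair 0 0)

def exsCode (l : List ℕ) (n : ℕ) : ℕ := l.foldr (fun a r => Nat.pair 6 (Nat.pair a r)) n

/-- Meant for quantifier-free formulae, so the last case only has to rebuild conjunctions and
disjunctions. -/
def substFormulaCode (N n : ℕ) : ℕ :=
  formRec (fun N k x rx r₁ r₂ => bif k == 1 then Nat.pair 1 (substAtomCode N x) else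
    bif k == 2 then Nat.pair 2 rx else bif k == 0 then Nat.pair 0 0 else
      Nat.pair k (Nat.pair r₁ r₂)) N n

def listProdCode (l l' : List (List ℕ)) : List (List ℕ) := l.flatMap fun a => l'.map fun b => a ++ b

def dnfCode (n : ℕ) : List (List ℕ) × List (List ℕ) :=
  formRec (fun (_ : ℕ) k x rx r₁ r₂ => bif k == 0 then ([], [[]]) else
    bif k == 1 then ([[Nat.pair 1 x]], [[Nat.pair 2 (Nat.pair 1 x)]]) else
    bif k == 2 then (rx.2, rx.1) else
    bif k == 3 then (listProdCode r₁.1 r₂.1, r₁.2 ++ r₂.2) else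
    bif k == 4 then (r₁.1 ++ r₂.1, listProdCode r₁.2 r₂.2) else ([], [])) 0 n

/-- The quantified variables and the literals of a primitive formula. -/
def parseCode (n : ℕ) : List ℕ × List ℕ :=
  formRec (fun (_ : ℕ) k x _ _ r₂ => bif k == 6 then (x.unpair.1 :: r₂.1, r₂.2) else
    bif k == 3 then ([], x.unpair.1 :: r₂.2) else ([], [])) 0 n

/-- Quantifier elimination by means of a function that gives the codes of covers. -/
def qeCode (g : ℕ → ℕ) (n : ℕ) : ℕ :=
  formRec (fun (_ : ℕ) k x rx r₁ r₂ => bif k == 0 then Nat.pair 0 0 else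
    bif k == 1 then Nat.pair 1 x else bif k == 2 then Nat.pair 2 rx else
    bif k == 5 then Nat.pair 2 (disjCode ((dnfCode r₂).2.map fun d =>
      g (exsCode [x.unpair.1] (conjCode d)))) else
    bif k == 6 then disjCode ((dnfCode r₂).1.map fun d =>
      g (exsCode [x.unpair.1] (conjCode d))) else Nat.pair k (Nat.pair r₁ r₂)) 0 n

/-- The quantified variables of sorts of the second signature. -/
def rightBoundCode (p : ℕ) : List ℕ :=
  (parseCode p).1.filterMap fun x => bif x.unpair.1 % 2 == 1 then
    some (Nat.pair (x.unpair.1 / 2) x.unpair.2) else none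

/-- The flattened literals over the second signature. -/
def rightLitsCode (p : ℕ) : List ℕ :=
  (parseCode p).2.filterMap fun l => bif isLeftLitCode l then none else
    some (mapLitCode (fun a => flatAtomCode (p + 1) a) l)

/-- The fresh variables of a flattening. -/
def freshCode (p : ℕ) : List ℕ :=
  ((rightLitsCode p).flatMap fun l => varsAtomCode (litAtomCode l)).filterMap fun x =>
    bif x.unpair.1 % 2 == 1 && Nat.ble (p + 1) x.unpair.2 then some x else none

/-- The primitive formula over the first signature of which a cover is taken. -/
def oneCode (p : ℕ) : ℕ :=
  exsCode ((parseCode p).1.filterMap fun x => bif x.unpair.1 % 2 == 1 then none else some x)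
    (conjCode ((parseCode p).2.filterMap (fun l => bif isLeftLitCode l then
        some (mapLitCode unleftAtomCode l) else none) ++
      (freshCode p).map fun x => Nat.pair 1 (Nat.pair 0 (Nat.pair x.unpair.1
        (Nat.pair (Nat.pair 0 x) ((x.unpair.2 - (p + 1)) / 2))))))

/-- The primitive formula over the second signature of which a cover is taken. -/
def twoCode (p : ℕ) (d : List ℕ) : ℕ :=
  exsCode (rightBoundCode p ++ freshCode p) (conjCode (d.filterMap (fun l =>
    bif isSharedLitCode l then some (mapLitCode (fun a => nameAtomCode (p + 1) a) l) else none) ++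
      rightLitsCode p))

/-- The part of the output for one disjunct. -/
def disjunctCode (p : ℕ) (d : List ℕ) (n : ℕ) : ℕ :=
  Nat.pair 3 (Nat.pair (conjCode (d.filterMap fun l => bif isSharedLitCode l then none else
    some (mapLitCode leftAtomCode l))) (substFormulaCode (p + 1) n))

/-- The three-step algorithm, given functions that compute covers. -/
def threeStepCode (g₁ g₂ : ℕ → ℕ) (p : ℕ) : ℕ :=
  disjCode ((dnfCode (g₁ (oneCode p))).1.map fun d => disjunctCode p d (g₂ (twoCode p d)))

/-! ### Primitive recursiveness of the operations on codes -/

section Primrec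

@[fun_prop] theorem primrec_leftSort : Primrec leftSort := by unfold leftSort; fun_prop

@[fun_prop] theorem primrec_unleftSort : Primrec unleftSort := by unfold unleftSort; fun_prop

@[fun_prop] theorem primrec_leftTermCode : Primrec leftTermCode := by
  unfold leftTermCode
  exact (primrec_termRec _ _ (by fun_prop) (by fun_prop)).comp
    (f := fun p : ℕ × ℕ => termRec _ _ p.1 p.2) (g := fun n => (0, n)) (by fun_prop)

@[fun_prop] theorem primrec_unleftTermCode : Primrec unleftTermCode := by
  unfold unleftTermCode
  exact (primrec_termRec _ _ (by fun_prop) (by fun_prop)).comp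
    (f := fun p : ℕ × ℕ => termRec _ _ p.1 p.2) (g := fun n => (0, n)) (by fun_prop)

@[fun_prop] theorem primrec_flatTermCode : Primrec fun p : ℕ × ℕ => flatTermCode p.1 p.2 := by
  unfold flatTermCode
  exact primrec_termRec _ _ (by fun_prop) (by fun_prop)

@[fun_prop] theorem primrec_substTermCode : Primrec fun p : ℕ × ℕ => substTermCode p.1 p.2 := by
  unfold substTermCode
  exact primrec_termRec _ _ (by fun_prop) (by fun_prop)

@[fun_prop] theorem primrec_varsTermCode : Primrec varsTermCode := by
  unfold varsTermCode
  exact (primrec_termRec _ _ (by fun_prop) (by fun_prop)).comp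
    (f := fun p : ℕ × ℕ => termRec _ _ p.1 p.2) (g := fun n => (0, n)) (by fun_prop)

@[fun_prop] theorem primrec_mapAtomCode {α : Type} [Primcodable α] {S R τ : α → ℕ → ℕ} {f : α → ℕ}
    (hS : Primrec fun p : α × ℕ => S p.1 p.2) (hR : Primrec fun p : α × ℕ => R p.1 p.2)
    (hτ : Primrec fun p : α × ℕ => τ p.1 p.2) (hf : Primrec f) :
    Primrec fun a => mapAtomCode (S a) (R a) (τ a) (f a) := by
  unfold mapAtomCode
  have h : ∀ {g : α → ℕ → ℕ} {x : α → ℕ}, (Primrec fun p : α × ℕ => g p.1 p.2) → Primrec x →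
      Primrec fun a => g a (x a) := fun {g x} hg hx =>
    hg.comp (g := fun a => (a, x a)) (by fun_prop)
  have h1 := h hS (x := fun a => (f a).unpair.2.unpair.1) (by fun_prop)
  have h2 := h hR (x := fun a => (f a).unpair.2.unpair.1) (by fun_prop)
  have h3 := h hτ (x := fun a => (f a).unpair.2.unpair.2.unpair.1) (by fun_prop)
  have h4 := h hτ (x := fun a => (f a).unpair.2.unpair.2.unpair.2) (by fun_prop)
  fun_prop

@[fun_prop] theorem primrec_leftAtomCode : Primrec leftAtomCode := by
  unfold leftAtomCode; fun_prop

@[fun_prop] theorem primrec_unleftAtomCode : Primrec unleftAtomCode := by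
  unfold unleftAtomCode; fun_prop

@[fun_prop] theorem primrec_flatAtomCode : Primrec fun p : ℕ × ℕ => flatAtomCode p.1 p.2 := by
  unfold flatAtomCode; fun_prop

@[fun_prop] theorem primrec_substAtomCode : Primrec fun p : ℕ × ℕ => substAtomCode p.1 p.2 := by
  unfold substAtomCode; fun_prop

@[fun_prop] theorem primrec_varsAtomCode : Primrec varsAtomCode := by
  unfold varsAtomCode; fun_prop

@[fun_prop] theorem primrec_nameAtomCode : Primrec fun p : ℕ × ℕ => nameAtomCode p.1 p.2 := by
  unfold nameAtomCode nameCode; fun_prop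

@[fun_prop] theorem primrec_litAtomCode : Primrec litAtomCode := by
  unfold litAtomCode; fun_prop

@[fun_prop] theorem primrec_mapLitCode {α : Type} [Primcodable α] {g : α → ℕ → ℕ} {f : α → ℕ}
    (hg : Primrec fun p : α × ℕ => g p.1 p.2) (hf : Primrec f) :
    Primrec fun a => mapLitCode (g a) (f a) := by
  unfold mapLitCode
  have h1 : Primrec fun a => g a (f a).unpair.2 :=
    hg.comp (g := fun a => (a, (f a).unpair.2)) (by fun_prop)
  have h2 : Primrec fun a => g a (f a).unpair.2.unpair.2 :=
    hg.comp (g := fun a => (a, (f a).unpair.2.unpair.2)) (by fun_prop)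
  fun_prop

@[fun_prop] theorem primrec_isLeftLitCode : Primrec isLeftLitCode := by
  unfold isLeftLitCode; fun_prop

@[fun_prop] theorem primrec_isSharedLitCode : Primrec isSharedLitCode := by
  unfold isSharedLitCode; fun_prop

@[fun_prop] theorem primrec_conjCode : Primrec conjCode := by unfold conjCode; fun_prop

@[fun_prop] theorem primrec_disjCode : Primrec disjCode := by unfold disjCode; fun_prop

@[fun_prop] theorem primrec_exsCode : Primrec fun p : List ℕ × ℕ => exsCode p.1 p.2 := by
  unfold exsCode; fun_prop

@[fun_prop] theorem primrec_substFormulaCode :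
    Primrec fun p : ℕ × ℕ => substFormulaCode p.1 p.2 := by
  unfold substFormulaCode
  exact primrec_formRec (by fun_prop)

@[fun_prop] theorem primrec_listProdCode :
    Primrec fun p : List (List ℕ) × List (List ℕ) => listProdCode p.1 p.2 := by
  unfold listProdCode; fun_prop

@[fun_prop] theorem primrec_dnfCode : Primrec dnfCode := by
  unfold dnfCode
  exact (primrec_formRec (by fun_prop)).comp (f := fun p : ℕ × ℕ => formRec _ p.1 p.2)
    (g := fun n => (0, n)) (by fun_prop)

@[fun_prop] theorem primrec_parseCode : Primrec parseCode := by
  unfold parseCode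
  exact (primrec_formRec (by fun_prop)).comp (f := fun p : ℕ × ℕ => formRec _ p.1 p.2)
    (g := fun n => (0, n)) (by fun_prop)

@[fun_prop] theorem primrec_rightBoundCode : Primrec rightBoundCode := by
  unfold rightBoundCode; fun_prop

@[fun_prop] theorem primrec_rightLitsCode : Primrec rightLitsCode := by
  unfold rightLitsCode; fun_prop

@[fun_prop] theorem primrec_freshCode : Primrec freshCode := by
  unfold freshCode; fun_prop

@[fun_prop] theorem primrec_oneCode : Primrec oneCode := by
  unfold oneCode; fun_prop

@[fun_prop] theorem primrec_twoCode : Primrec fun p : ℕ × List ℕ => twoCode p.1 p.2 := by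
  unfold twoCode; fun_prop

@[fun_prop] theorem primrec_disjunctCode :
    Primrec fun p : ℕ × List ℕ × ℕ => disjunctCode p.1 p.2.1 p.2.2 := by
  unfold disjunctCode; fun_prop

end Primrec

/-- The given functions enter only at the two places where covers are taken; all else is primitive
recursive. -/
theorem computable_threeStepCode {g₁ g₂ : ℕ → ℕ} (h₁ : Computable g₁) (h₂ : Computable g₂) :
    Computable (threeStepCode g₁ g₂) := by
  unfold threeStepCode
  refine primrec_disjCode.to_comp.comp (computable_map ?_ ?_)
  · exact (Primrec.fst.comp primrec_dnfCode).to_comp.comp (h₁.comp primrec_oneCode.to_comp)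
  · exact primrec_disjunctCode.to_comp.comp (g := fun p : ℕ × List ℕ =>
      (p.1, p.2, g₂ (twoCode p.1 p.2))) (Computable.fst.pair (Computable.snd.pair
        (h₂.comp primrec_twoCode.to_comp)))

theorem computable_qeCode {g : ℕ → ℕ} (hg : Computable g) : Computable (qeCode g) := by
  unfold qeCode
  refine (computable_formRec ?_).comp (f := fun p : ℕ × ℕ => formRec _ p.1 p.2)
    (g := fun n => (0, n)) ((Computable.const 0).pair Computable.id)
  have hm : ∀ {D : ℕ × ℕ × ℕ × ℕ × ℕ × ℕ → List (List ℕ)}, Primrec D → Computable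
      fun p : ℕ × ℕ × ℕ × ℕ × ℕ × ℕ => disjCode ((D p).map fun d =>
        g (exsCode [p.2.2.1.unpair.1] (conjCode d))) := fun {D} hD =>
    primrec_disjCode.to_comp.comp (computable_map hD.to_comp (hg.comp (Primrec.to_comp
      (f := fun p : (ℕ × ℕ × ℕ × ℕ × ℕ × ℕ) × List ℕ =>
        exsCode [p.1.2.2.1.unpair.1] (conjCode p.2)) (by fun_prop))))
  have pc : ∀ {f : ℕ × ℕ × ℕ × ℕ × ℕ × ℕ → ℕ}, Primrec f → Computable f := fun h => h.to_comp
  have bc : ∀ k : ℕ, Computable fun p : ℕ × ℕ × ℕ × ℕ × ℕ × ℕ => p.2.1 == k := fun k =>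
    Primrec.to_comp (by fun_prop)
  refine Computable.cond (bc 0) (pc (by fun_prop)) (Computable.cond (bc 1) (pc (by fun_prop))
    (Computable.cond (bc 2) (pc (by fun_prop)) (Computable.cond (bc 5) ?_
      (Computable.cond (bc 6) (hm (by fun_prop)) (pc (by fun_prop))))))
  exact (Primrec.to_comp (f := fun n : ℕ => Nat.pair 2 n) (by fun_prop)).comp (hm (by fun_prop))

end ManySorted

namespace ManySorted

/-! ### Substitutions that agree, and lists of variables -/

section VarList

variable {S : Type} {L : Signature S}

theorem Term.subst_congr {σ τ : (s : S) → ℕ → Term L s} : ∀ {s : S} (t : Term L s),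
    (∀ x ∈ t.vars, σ x.1 x.2 = τ x.1 x.2) → t.subst σ = t.subst τ
  | _, .var s n, h => h (s, n) rfl
  | _, .app f ts, h => by
    simp only [Term.subst]
    congr 1
    funext i
    exact Term.subst_congr (ts i) fun x hx => h x (Set.mem_iUnion.2 ⟨i, hx⟩)

theorem Atom.subst_congr {σ τ : (s : S) → ℕ → Term L s} (a : Atom L)
    (h : ∀ x ∈ a.vars, σ x.1 x.2 = τ x.1 x.2) : a.subst σ = a.subst τ := by
  cases a with
  | eq s t u =>
    simp only [Atom.subst]
    rw [t.subst_congr fun x hx => h x (Or.inl hx), u.subst_congr fun x hx => h x (Or.inr hx)]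
  | rel r ts =>
    simp only [Atom.subst]
    congr 1
    funext i
    exact (ts i).subst_congr fun x hx => h x (Set.mem_iUnion.2 ⟨i, hx⟩)

/-- The variables that occur in a term, as a list. -/
def Term.varList : {s : S} → Term L s → List (S × ℕ)
  | _, .var s n => [(s, n)]
  | _, .app _ ts => (List.ofFn fun i => (ts i).varList).flatten

def Atom.varList : Atom L → List (S × ℕ)
  | .eq _ t u => t.varList ++ u.varList
  | .rel _ ts => (List.ofFn fun i => (ts i).varList).flatten

theorem Term.mem_varList {x : S × ℕ} : ∀ {s : S} (t : Term L s), x ∈ t.varList ↔ x ∈ t.vars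
  | _, .var s n => by simp [Term.varList, Term.vars]
  | _, .app f ts => by simp [Term.varList, Term.vars, Term.mem_varList (ts _), List.mem_ofFn]

theorem Atom.mem_varList {x : S × ℕ} (a : Atom L) : x ∈ a.varList ↔ x ∈ a.vars := by
  cases a <;> simp [Atom.varList, Atom.vars, Term.mem_varList, List.mem_ofFn]

end VarList

/-! ### Correctness of the operations on codes over one signature -/

section Codes

variable {S : Type} {L : Signature S} [Encodable S]

/-- The code of a variable. -/
def varCode (x : S × ℕ) : ℕ := Nat.pair (Encodable.encode x.1) x.2

variable [Encodable L.Fn] [Encodable L.Rel]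

/-- The code of a literal. -/
def litCode (l : Literal L) : ℕ := (Literal.toFormula l).code

theorem litCode_eq (l : Literal L) : litCode l =
    bif l.2 then Nat.pair 1 l.1.code else Nat.pair 2 (Nat.pair 1 l.1.code) := by
  obtain ⟨a, b⟩ := l
  cases b <;> rfl

theorem litAtomCode_litCode (l : Literal L) : litAtomCode (litCode l) = l.1.code := by
  rw [litCode_eq]
  obtain ⟨a, b⟩ := l
  cases b <;> simp [litAtomCode]

theorem mapLitCode_litCode {S' : Type} {L' : Signature S'} [Encodable S'] [Encodable L'.Fn]
    [Encodable L'.Rel] {g : ℕ → ℕ} {l : Literal L} {a : Atom L'} (h : g l.1.code = a.code) :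
    mapLitCode g (litCode l) = litCode (a, l.2) := by
  rw [litCode_eq, litCode_eq, ← h]
  obtain ⟨a, b⟩ := l
  cases b <;> simp [mapLitCode]

theorem conjCode_map (ls : List (Literal L)) :
    conjCode (ls.map litCode) = (constraint ls).code := by
  induction ls with
  | nil => rfl
  | cons l ls ih =>
    change Nat.pair 3 (Nat.pair (litCode l) (conjCode (ls.map litCode))) = _
    rw [ih]
    rfl

theorem disjCode_map (l : List (Formula L)) :
    disjCode (l.map Formula.code) = (Formula.disj l).code := by
  induction l with
  | nil => rfl
  | cons φ l ih =>
    change Nat.pair 4 (Nat.pair φ.code (disjCode (l.map Formula.code))) = _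
    rw [ih]
    rfl

theorem exsCode_map (xs : List (S × ℕ)) (φ : Formula L) :
    exsCode (xs.map varCode) φ.code = (Formula.exs xs φ).code := by
  induction xs with
  | nil => rfl
  | cons x xs ih =>
    change Nat.pair 6 (Nat.pair (varCode x) (exsCode (xs.map varCode) φ.code)) = _
    rw [ih]
    rfl

theorem exsCode_primitive (P : Primitive L) :
    exsCode (P.bv.map varCode) (conjCode (P.lits.map litCode)) = P.formula.code := by
  rw [conjCode_map, exsCode_map]
  rfl

theorem parseCode_conj (ls : List (Literal L)) :
    parseCode (constraint ls).code = ([], ls.map litCode) := by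
  induction ls with
  | nil =>
    change parseCode (Nat.pair 2 (Nat.pair 0 0)) = _
    rw [parseCode, formRec_pair _ _ (by norm_num)]
    simp
  | cons l ls ih =>
    change parseCode (Nat.pair 3 (Nat.pair (litCode l) (constraint ls).code)) = _
    rw [parseCode, formRec_pair _ _ (by norm_num)]
    rw [parseCode] at ih
    simp only [Nat.unpair_pair, ih]
    simp

/-- The tags separate the quantifier block from the conjunction, and the conjunction ends in the
negation of falsity, so the code of a primitive formula determines both of its lists. -/
theorem parseCode_formula (P : Primitive L) :
    parseCode P.formula.code = (P.bv.map varCode, P.lits.map litCode) := by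
  obtain ⟨bv, lits⟩ := P
  induction bv with
  | nil => exact parseCode_conj lits
  | cons x bv ih =>
    change parseCode (Nat.pair 6 (Nat.pair (varCode x) (Primitive.formula ⟨bv, lits⟩).code)) = _
    rw [parseCode, formRec_pair _ _ (by norm_num)]
    rw [parseCode] at ih
    simp only [Nat.unpair_pair, ih]
    simp

theorem listProdCode_map {α : Type} (f : α → ℕ) (l l' : List (List α)) :
    listProdCode (l.map (List.map f)) (l'.map (List.map f)) =
      (listProd l l').map (List.map f) := by
  simp only [listProdCode, listProd, List.flatMap_map, List.map_flatMap, List.map_map]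
  congr 1
  funext a
  refine List.map_congr_left fun b _ => ?_
  simp

theorem dnfCode_code : ∀ φ : Formula L, dnfCode φ.code =
    (φ.dnfPair.1.map (List.map litCode), φ.dnfPair.2.map (List.map litCode))
  | .bot => by
    change dnfCode (Nat.pair 0 0) = _
    rw [dnfCode, formRec_bot]
    rfl
  | .atom a => by
    change dnfCode (Nat.pair 1 a.code) = _
    rw [dnfCode, formRec_pair _ _ (by norm_num)]
    rfl
  | .not φ => by
    change dnfCode (Nat.pair 2 φ.code) = _
    have ih := dnfCode_code φ
    rw [dnfCode] at ih ⊢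
    rw [formRec_pair _ _ (by norm_num), ih]
    rfl
  | .and φ χ => by
    change dnfCode (Nat.pair 3 (Nat.pair φ.code χ.code)) = _
    have ih₁ := dnfCode_code φ
    have ih₂ := dnfCode_code χ
    rw [dnfCode] at ih₁ ih₂ ⊢
    rw [formRec_pair _ _ (by norm_num)]
    simp only [Nat.unpair_pair, ih₁, ih₂, listProdCode_map, ← List.map_append]
    rfl
  | .or φ χ => by
    change dnfCode (Nat.pair 4 (Nat.pair φ.code χ.code)) = _
    have ih₁ := dnfCode_code φ
    have ih₂ := dnfCode_code χ
    rw [dnfCode] at ih₁ ih₂ ⊢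
    rw [formRec_pair _ _ (by norm_num)]
    simp only [Nat.unpair_pair, ih₁, ih₂, listProdCode_map, ← List.map_append]
    rfl
  | .all s n φ => by
    change dnfCode (Nat.pair 5 _) = _
    rw [dnfCode, formRec_pair _ _ (by norm_num)]
    rfl
  | .ex s n φ => by
    change dnfCode (Nat.pair 6 _) = _
    rw [dnfCode, formRec_pair _ _ (by norm_num)]
    rfl

/-- It suffices to control `g` on codes of primitive formulae, since the elimination calls it on no
others. -/
theorem qeCode_code {c : Primitive L → Formula L} {g : ℕ → ℕ}
    (hg : ∀ P, g P.formula.code = (c P).code) :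
    ∀ φ : Formula L, qeCode g φ.code = (φ.qe c).code
  | .bot => by
    change qeCode g (Nat.pair 0 0) = _
    rw [qeCode, formRec_bot]
    rfl
  | .atom a => by
    change qeCode g (Nat.pair 1 a.code) = _
    rw [qeCode, formRec_pair _ _ (by norm_num)]
    rfl
  | .not φ => by
    change qeCode g (Nat.pair 2 φ.code) = _
    have ih := qeCode_code hg φ
    rw [qeCode] at ih ⊢
    rw [formRec_pair _ _ (by norm_num), ih]
    rfl
  | .and φ χ => by
    change qeCode g (Nat.pair 3 (Nat.pair φ.code χ.code)) = _
    have ih₁ := qeCode_code hg φ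
    have ih₂ := qeCode_code hg χ
    rw [qeCode] at ih₁ ih₂ ⊢
    rw [formRec_pair _ _ (by norm_num)]
    simp only [Nat.unpair_pair, ih₁, ih₂]
    rfl
  | .or φ χ => by
    change qeCode g (Nat.pair 4 (Nat.pair φ.code χ.code)) = _
    have ih₁ := qeCode_code hg φ
    have ih₂ := qeCode_code hg χ
    rw [qeCode] at ih₁ ih₂ ⊢
    rw [formRec_pair _ _ (by norm_num)]
    simp only [Nat.unpair_pair, ih₁, ih₂]
    rfl
  | .all s n φ => by
    change qeCode g (Nat.pair 5 (Nat.pair (varCode (s, n)) φ.code)) = _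
    have ih := qeCode_code hg φ
    rw [qeCode] at ih ⊢
    rw [formRec_pair _ _ (by norm_num)]
    simp only [Nat.unpair_pair, ih, dnfCode_code, List.map_map]
    rw [List.map_congr_left (g := Formula.code ∘ fun d => c ⟨[(s, n)], d⟩) (fun d _ => by
      simp only [Function.comp, ← hg, ← exsCode_primitive, List.map_cons, List.map_nil]),
      ← List.map_map, disjCode_map]
    rfl
  | .ex s n φ => by
    change qeCode g (Nat.pair 6 (Nat.pair (varCode (s, n)) φ.code)) = _
    have ih := qeCode_code hg φ
    rw [qeCode] at ih ⊢
    rw [formRec_pair _ _ (by norm_num)]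
    simp only [Nat.unpair_pair, ih, dnfCode_code, List.map_map, Nat.reduceBEq, cond_true, cond_false]
    rw [List.map_congr_left (g := Formula.code ∘ fun d => c ⟨[(s, n)], d⟩) (fun d _ => by
      simp only [Function.comp, ← hg, ← exsCode_primitive, List.map_cons, List.map_nil]),
      ← List.map_map, disjCode_map]
    rfl

/-! ### Variables and codes -/

omit [Encodable L.Rel] in
theorem Term.index_le_code {x : S × ℕ} : ∀ {s : S} (t : Term L s), x ∈ t.vars → x.2 ≤ t.code
  | _, .var s n, h => by
    rw [Set.mem_singleton_iff.1 h]
    exact (Nat.right_le_pair _ _).trans (Nat.right_le_pair _ _)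
  | _, .app f ts, h => by
    obtain ⟨i, hi⟩ := Set.mem_iUnion.1 h
    refine (Term.index_le_code (ts i) hi).trans (le_trans ?_ ((Nat.right_le_pair _ _).trans
      ((Nat.right_le_pair _ _).trans (Nat.right_le_pair _ _))))
    have hm : (ts i).code ∈ List.ofFn fun i => (ts i).code := List.mem_ofFn.2 ⟨i, rfl⟩
    exact (lt_encode_of_mem hm).le

theorem Atom.index_le_code {x : S × ℕ} (a : Atom L) (h : x ∈ a.vars) : x.2 ≤ a.code := by
  cases a with
  | eq s t u =>
    rcases h with h | h
    · exact (t.index_le_code h).trans ((Nat.left_le_pair _ _).trans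
        ((Nat.right_le_pair _ _).trans (Nat.right_le_pair _ _)))
    · exact (u.index_le_code h).trans ((Nat.right_le_pair _ _).trans
        ((Nat.right_le_pair _ _).trans (Nat.right_le_pair _ _)))
  | rel r ts =>
    obtain ⟨i, hi⟩ := Set.mem_iUnion.1 h
    refine ((ts i).index_le_code hi).trans (le_trans ?_ ((Nat.right_le_pair _ _).trans
      (Nat.right_le_pair _ _)))
    have hm : (ts i).code ∈ List.ofFn fun i => (ts i).code := List.mem_ofFn.2 ⟨i, rfl⟩
    exact (lt_encode_of_mem hm).le

/-- The source of freshness: indices above the code of a primitive formula do not occur in it, and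
this bound is computable. -/
theorem Primitive.index_le_code {P : Primitive L} {x : S × ℕ} (h : x ∈ P.vars) :
    x.2 ≤ P.formula.code := by
  obtain ⟨bv, lits⟩ := P
  induction bv with
  | nil =>
    rcases h with h | ⟨l, hl, hx⟩
    · simp at h
    · change l ∈ lits at hl
      change x.2 ≤ (constraint lits).code
      induction lits with
      | nil => simp at hl
      | cons l' ls ih =>
        change _ ≤ Nat.pair 3 (Nat.pair (litCode l') (constraint ls).code)
        rcases List.mem_cons.1 hl with rfl | hl
        · refine (l.1.index_le_code hx).trans (le_trans ?_
            ((Nat.left_le_pair _ _).trans (Nat.right_le_pair _ _)))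
          rw [litCode_eq]
          obtain ⟨a, b⟩ := l
          cases b
          · exact (Nat.right_le_pair _ _).trans (Nat.right_le_pair _ _)
          · exact Nat.right_le_pair _ _
        · exact (ih hl).trans ((Nat.right_le_pair _ _).trans (Nat.right_le_pair _ _))
  | cons y bv ih =>
    change _ ≤ Nat.pair 6 (Nat.pair (varCode y) (Primitive.formula ⟨bv, lits⟩).code)
    by_cases hy : x = y
    · rw [hy]
      exact (Nat.right_le_pair _ _).trans ((Nat.left_le_pair _ _).trans (Nat.right_le_pair _ _))
    · refine (ih ?_).trans ((Nat.right_le_pair _ _).trans (Nat.right_le_pair _ _))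
      rcases h with h | h
      · exact Or.inl ((List.mem_cons.1 h).resolve_left hy)
      · exact Or.inr h

omit [Encodable L.Rel] in
theorem varsTermCode_code : ∀ {s : S} (t : Term L s), varsTermCode t.code = t.varList.map varCode
  | _, .var s n => by
    rw [Term.code, varsTermCode, termRec_var]
    rfl
  | _, .app f ts => by
    rw [Term.code, varsTermCode, termRec_app]
    simp only [Term.varList, List.map_flatten, List.map_ofFn, Function.comp_def]
    congr 2
    funext i
    exact varsTermCode_code (ts i)

theorem varsAtomCode_code (a : Atom L) : varsAtomCode a.code = a.varList.map varCode := by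
  cases a with
  | eq s t u => simp [Atom.code, varsAtomCode, Atom.varList, varsTermCode_code]
  | rel r ts =>
    simp only [Atom.code, varsAtomCode, Nat.unpair_pair, Nat.reduceBEq, cond_false,
      listOf_encode, Atom.varList, List.map_flatten, List.map_ofFn, Function.comp_def,
      List.flatMap, varsTermCode_code]

theorem mapAtomCode_eq (S' R τ : ℕ → ℕ) (s : S) (t u : Term L s) :
    mapAtomCode S' R τ (Atom.eq s t u).code =
      Nat.pair 0 (Nat.pair (S' (Encodable.encode s)) (Nat.pair (τ t.code) (τ u.code))) := by
  simp [mapAtomCode, Atom.code]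

theorem mapAtomCode_rel (S' R τ : ℕ → ℕ) (r : L.Rel) (ts) :
    mapAtomCode S' R τ (Atom.rel (L := L) r ts).code =
      Nat.pair 1 (Nat.pair (R (Encodable.encode r))
        (Encodable.encode (List.ofFn fun i => τ (ts i).code))) := by
  simp [mapAtomCode, Atom.code, List.map_ofFn, Function.comp_def]

end Codes

/-! ### Codes over the union of two signatures -/

section CombinedCodes

variable {A B C : Type} [Encodable A] [Encodable B] [Encodable C]
  {L₁ : Signature (A ⊕ C)} {L₂ : Signature (B ⊕ C)}

theorem encode_sortLeft (s : A ⊕ C) :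
    Encodable.encode (sortLeft s : A ⊕ (B ⊕ C)) = leftSort (Encodable.encode s) := by
  rcases s with a | c <;>
    simp [sortLeft, leftSort, Nat.add_mod]

theorem unleftSort_leftSort (s : A ⊕ C) :
    unleftSort (leftSort (Encodable.encode s)) = Encodable.encode s := by
  rcases s with a | c
  · simp [unleftSort, leftSort]
  · have h1 : (2 * Encodable.encode c + 1) % 2 = 1 := by omega
    simp only [leftSort, unleftSort, Encodable.encode_inr, h1]
    simp
    omega

theorem encode_sortRight (s : B ⊕ C) :
    Encodable.encode (sortRight s : A ⊕ (B ⊕ C)) = 2 * Encodable.encode s + 1 := by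
  simp [sortRight]

variable [Encodable L₁.Fn] [Encodable L₁.Rel] [Encodable L₂.Fn] [Encodable L₂.Rel]

omit [Encodable A] [Encodable B] [Encodable C] [Encodable L₁.Rel] [Encodable L₂.Rel] in
theorem encode_fn_inl (f : L₁.Fn) :
    Encodable.encode (α := (combine L₁ L₂).Fn) (Sum.inl f) = 2 * Encodable.encode f :=
  Encodable.encode_inl f

omit [Encodable A] [Encodable B] [Encodable C] [Encodable L₁.Rel] [Encodable L₂.Rel] in
theorem encode_fn_inr (f : L₂.Fn) :
    Encodable.encode (α := (combine L₁ L₂).Fn) (Sum.inr f) = 2 * Encodable.encode f + 1 :=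
  Encodable.encode_inr f

omit [Encodable A] [Encodable B] [Encodable C] [Encodable L₁.Fn] [Encodable L₂.Fn] in
theorem encode_rel_inl (r : L₁.Rel) :
    Encodable.encode (α := (combine L₁ L₂).Rel) (Sum.inl r) = 2 * Encodable.encode r :=
  Encodable.encode_inl r

omit [Encodable A] [Encodable B] [Encodable C] [Encodable L₁.Fn] [Encodable L₂.Fn] in
theorem encode_rel_inr (r : L₂.Rel) :
    Encodable.encode (α := (combine L₁ L₂).Rel) (Sum.inr r) = 2 * Encodable.encode r + 1 :=
  Encodable.encode_inr r

omit [Encodable L₁.Rel] [Encodable L₂.Rel] in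
theorem code_app_inl (f : L₁.Fn)
    (ts : (i : Fin (L₁.fnArity f)) → Term (combine L₁ L₂) (sortLeft (L₁.dom f i))) :
    Term.code (Term.app (L := combine L₁ L₂) (Sum.inl f) ts) =
      Nat.pair 1 (Nat.pair (leftSort (Encodable.encode (L₁.cod f)))
        (Nat.pair (2 * Encodable.encode f) (Encodable.encode (List.ofFn fun i => (ts i).code)))) := by
  rw [← encode_fn_inl (L₂ := L₂), ← encode_sortLeft (B := B)]
  rfl

omit [Encodable L₁.Rel] [Encodable L₂.Rel] in
theorem code_app_inr (f : L₂.Fn)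
    (ts : (i : Fin (L₂.fnArity f)) → Term (combine L₁ L₂) (sortRight (L₂.dom f i))) :
    Term.code (Term.app (L := combine L₁ L₂) (Sum.inr f) ts) =
      Nat.pair 1 (Nat.pair (2 * Encodable.encode (L₂.cod f) + 1)
        (Nat.pair (2 * Encodable.encode f + 1)
          (Encodable.encode (List.ofFn fun i => (ts i).code)))) := by
  rw [← encode_fn_inr (L₁ := L₁), ← encode_sortRight (A := A)]
  rfl

omit [Encodable L₁.Rel] [Encodable L₂.Rel] in
theorem leftTermCode_code : ∀ {s} (t : Term L₁ s), leftTermCode t.code = (t.left L₂).code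
  | _, .var s n => by
    rw [Term.code, leftTermCode, termRec_var, Term.left, Term.code, encode_sortLeft]
    simp
  | _, .app f ts => by
    refine Eq.trans ?_ (code_app_inl (L₂ := L₂) f fun i => (ts i).left L₂).symm
    rw [Term.code, leftTermCode, termRec_app]
    simp only [Nat.unpair_pair, List.map_ofFn, Function.comp_def]
    simp only [← leftTermCode_code (ts _)]
    rfl

omit [Encodable L₁.Rel] [Encodable L₂.Rel] in
theorem unleftTermCode_code : ∀ {s} (t : Term L₁ s), unleftTermCode (t.left L₂).code = t.code
  | _, .var s n => by
    rw [Term.left, Term.code, Term.code, unleftTermCode, termRec_var, encode_sortLeft]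
    simp [unleftSort_leftSort]
  | _, .app f ts => by
    refine (congrArg unleftTermCode (code_app_inl (L₂ := L₂) f fun i => (ts i).left L₂)).trans ?_
    rw [Term.code, unleftTermCode, termRec_app]
    simp only [Nat.unpair_pair, List.map_ofFn, Function.comp_def, unleftSort_leftSort]
    rw [Nat.mul_div_cancel_left _ (by norm_num : 0 < 2)]
    simp only [← unleftTermCode_code (ts _)]
    rfl

theorem leftAtomCode_code (a : Atom L₁) : leftAtomCode a.code = (a.left L₂).code := by
  cases a with
  | eq s t u =>
    rw [leftAtomCode, mapAtomCode_eq, leftTermCode_code (L₂ := L₂), leftTermCode_code (L₂ := L₂),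
      ← encode_sortLeft (B := B)]
    rfl
  | rel r ts =>
    rw [leftAtomCode, mapAtomCode_rel]
    simp only [leftTermCode_code (L₂ := L₂)]
    rw [← encode_rel_inl (L₂ := L₂)]
    rfl

theorem unleftAtomCode_code (a : Atom L₁) : unleftAtomCode (a.left L₂).code = a.code := by
  cases a with
  | eq s t u =>
    rw [Atom.left, unleftAtomCode, mapAtomCode_eq, unleftTermCode_code, unleftTermCode_code,
      encode_sortLeft, unleftSort_leftSort]
    rfl
  | rel r ts =>
    refine (mapAtomCode_rel (L := combine L₁ L₂) unleftSort (fun r => r / 2) unleftTermCode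
      (Sum.inl r) fun i => (ts i).left L₂).trans ?_
    rw [encode_rel_inl,
      Nat.mul_div_cancel_left _ (by norm_num : 0 < 2)]
    have : ∀ i, unleftTermCode ((ts i).left L₂).code = (ts i).code := fun i =>
      unleftTermCode_code (ts i)
    exact congrArg (fun h => Nat.pair 1 (Nat.pair (Encodable.encode r)
      (Encodable.encode (List.ofFn h)))) (funext this)

end CombinedCodes

end ManySorted

namespace ManySorted

/-- Split a list into the images of two lists, with control over the codes. -/
theorem exists_perm_append_map {α β γ : Type} {f : β → α} {g : γ → α} {cα : α → ℕ} {cβ : β → ℕ}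
    {cγ : γ → ℕ} {F G : ℕ → Option ℕ} {p : β → Prop} {q : γ → Prop} (l : List α)
    (h : ∀ a ∈ l, (∃ b, p b ∧ a = f b ∧ F (cα a) = some (cβ b) ∧ G (cα a) = none) ∨
      ∃ c, q c ∧ a = g c ∧ F (cα a) = none ∧ G (cα a) = some (cγ c)) :
    ∃ (bs : List β) (cs : List γ), (∀ b ∈ bs, p b) ∧ (∀ c ∈ cs, q c) ∧
      l.Perm (bs.map f ++ cs.map g) ∧ bs.map cβ = (l.map cα).filterMap F ∧
      cs.map cγ = (l.map cα).filterMap G := by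
  induction l with
  | nil => exact ⟨[], [], by simp, by simp, by simp, by simp, by simp⟩
  | cons a l ih =>
    obtain ⟨bs, cs, hb, hc, hp, eb, ec⟩ := ih fun a ha => h a (List.mem_cons_of_mem _ ha)
    rcases h a List.mem_cons_self with ⟨b, hpb, rfl, h1, h2⟩ | ⟨c, hqc, rfl, h1, h2⟩
    · refine ⟨b :: bs, cs, List.forall_mem_cons.2 ⟨hpb, hb⟩, hc, hp.cons _, ?_, ?_⟩
      · rw [List.map_cons, List.map_cons, List.filterMap_cons_some h1, eb]
      · rw [List.map_cons, List.filterMap_cons_none h2, ec]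
    · refine ⟨bs, c :: cs, hb, List.forall_mem_cons.2 ⟨hqc, hc⟩, ?_, ?_, ?_⟩
      · exact (hp.cons _).trans List.perm_middle.symm
      · rw [List.map_cons, List.filterMap_cons_none h1, eb]
      · rw [List.map_cons, List.map_cons, List.filterMap_cons_some h2, ec]

theorem flatTermCode_app (N s f : ℕ) (l : List ℕ) :
    flatTermCode N (Nat.pair 1 (Nat.pair (2 * s + 1) (Nat.pair (2 * f + 1) (Encodable.encode l)))) =
      Nat.pair 1 (Nat.pair s (Nat.pair f (Encodable.encode (l.map (flatTermCode N))))) := by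
  have h1 : ∀ k, (2 * k + 1) / 2 = k := by omega
  have h2 : ∀ k, (2 * k + 1) % 2 = 1 := by omega
  rw [flatTermCode, termRec_app]
  simp only [Nat.unpair_pair, h1, h2]
  rfl

/-! ### Flattening of terms, with indices of variables as names of terms -/

section Names

variable {A B C : Type} [Encodable A] [Encodable B] [Encodable C]
  {L₁ : Signature (A ⊕ C)} {L₂ : Signature (B ⊕ C)}

omit [Encodable A] [Encodable B] [Encodable C] in
-- By tameness one can never return from a shared sort to a private one within the first signature.
theorem Term.privateVars (tame : Tame L₁ L₂) : ∀ {s : A ⊕ C} (t : Term L₁ s),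
    (∀ c, s ≠ Sum.inr c) → PrivateVars t.vars
  | _, .var s n, h => by
    rintro x rfl
    rcases s with a | c
    · exact ⟨a, rfl⟩
    · exact (h c rfl).elim
  | _, .app f ts, _ => fun x hx => by
    obtain ⟨i, hi⟩ := Set.mem_iUnion.1 hx
    exact Term.privateVars tame (ts i) (tame.1 f i) x hi

omit [Encodable A] [Encodable B] [Encodable C] in
-- The codomain may be shared here, but the arguments may not. So a term of shared sort is a
-- variable or has private variables only.
theorem Term.privateVars_app (tame : Tame L₁ L₂) (f : L₁.Fn) (ts) :
    PrivateVars (Term.app f ts : Term L₁ _).vars := fun x hx => by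
  obtain ⟨i, hi⟩ := Set.mem_iUnion.1 hx
  exact (ts i).privateVars tame (tame.1 f i) x hi

variable [Encodable L₁.Fn] [Encodable L₂.Fn]

open Classical in
/-- The term of a given shared sort with a given code. -/
noncomputable def termOfCode (c : C) (m : ℕ) : Term L₁ (Sum.inr c) :=
  if h : ∃ t : Term L₁ (Sum.inr c), t.code = m then h.choose else .var (Sum.inr c) 0

theorem termOfCode_code {c : C} (t : Term L₁ (Sum.inr c)) : termOfCode c t.code = t := by
  have h : ∃ t' : Term L₁ (Sum.inr c), t'.code = t.code := ⟨t, rfl⟩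
  rw [termOfCode, dif_pos h]
  exact Term.code_injective _ h.choose_spec

/-- The term of shared sort for which the variable with index `n ≥ N` stands. -/
noncomputable def namedTerm (N : ℕ) (c : C) (n : ℕ) : Term L₁ (Sum.inr c) :=
  termOfCode c ((n - N) / 2)

theorem namedTerm_even (N : ℕ) {c : C} (t : Term L₁ (Sum.inr c)) :
    namedTerm N c (N + 2 * t.code) = t := by
  rw [namedTerm, show (N + 2 * t.code - N) / 2 = t.code by omega, termOfCode_code]

/-- Even and odd offsets decode to the same term: halving drops the last bit, whose only purpose is
to keep the `ξ'` apart from the `η'`. -/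
theorem namedTerm_odd (N : ℕ) {c : C} (t : Term L₁ (Sum.inr c)) :
    namedTerm N c (N + (2 * t.code + 1)) = t := by
  rw [namedTerm, show (N + (2 * t.code + 1) - N) / 2 = t.code by omega, termOfCode_code]

/-- The substitution, for the shared variables with indices from `N` on, of the terms for which they
stand. -/
noncomputable def nameSubst (L₁ : Signature (A ⊕ C)) (L₂ : Signature (B ⊕ C)) [Encodable L₁.Fn]
    (N : ℕ) : (s : A ⊕ (B ⊕ C)) → ℕ → Term (combine L₁ L₂) s
  | Sum.inl a, n => .var (Sum.inl a) n
  | Sum.inr (Sum.inl b), n => .var (Sum.inr (Sum.inl b)) n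
  | Sum.inr (Sum.inr c), n =>
    if N ≤ n then (namedTerm N c n).left L₂ else .var (Sum.inr (Sum.inr c)) n

omit [Encodable B] [Encodable L₂.Fn] in
theorem nameSubst_of_lt {N : ℕ} (s : A ⊕ (B ⊕ C)) {n : ℕ} (h : n < N) :
    nameSubst L₁ L₂ N s n = .var s n := by
  rcases s with a | b | c
  · rfl
  · rfl
  · exact if_neg (by omega)

omit [Encodable B] [Encodable L₂.Fn] in
theorem nameSubst_name (N : ℕ) {c : C} (t : Term L₁ (Sum.inr c)) :
    nameSubst L₁ L₂ N (Sum.inr (Sum.inr c)) (N + 2 * t.code) = t.left L₂ := by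
  refine (if_pos (by omega)).trans ?_
  rw [namedTerm_even]

/-- The variables from index `N` on in `V` are names of terms. -/
def NamedVars (L₁ : Signature (A ⊕ C)) [Encodable L₁.Fn] (N : ℕ) (V : Set ((B ⊕ C) × ℕ)) : Prop :=
  ∀ x ∈ V, N ≤ x.2 → ∃ (c : C) (t : Term L₁ (Sum.inr c)),
    x = (Sum.inr c, N + 2 * t.code) ∧ PrivateVars t.vars

/-- A term over the union of the signatures can be flattened. -/
def FlatTerm (N : ℕ) : {s : A ⊕ (B ⊕ C)} → Term (combine L₁ L₂) s → Prop
  | Sum.inl a, t => ∃ t₀ : Term L₁ (Sum.inl a), t = t₀.left L₂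
  | Sum.inr s, t => ∃ u : Term L₂ s, t = (u.right L₁).subst (nameSubst L₁ L₂ N) ∧
      flatTermCode N t.code = u.code ∧ NamedVars L₁ N u.vars

theorem FlatTerm.exists_left {N : ℕ} {s : A ⊕ C} (hs : ∀ c, s ≠ Sum.inr c)
    {t : Term (combine L₁ L₂) (sortLeft s)} (h : FlatTerm N t) :
    ∃ t₀ : Term L₁ s, t = t₀.left L₂ := by
  rcases s with a | c
  · exact h
  · exact (hs c rfl).elim

theorem flatTermCode_left (N : ℕ) (f : L₁.Fn) (ts) :
    flatTermCode N ((Term.app f ts : Term L₁ _).left L₂).code = Nat.pair 0 (Nat.pair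
      (leftSort (Encodable.encode (L₁.cod f)) / 2) (N + 2 * (Term.app f ts : Term L₁ _).code)) := by
  rw [← unleftTermCode_code (L₂ := L₂) (Term.app f ts)]
  have h := code_app_inl (L₂ := L₂) f fun i => (ts i).left L₂
  change Term.code (Term.left L₂ (Term.app f ts)) = _ at h
  rw [h, flatTermCode, termRec_app]
  simp [Nat.unpair_pair]

/-- A first-signature term of private sort needs no change; one of shared sort becomes the single
variable whose index records its code. -/
theorem FlatTerm.left {N : ℕ} {s : A ⊕ C} (t : Term L₁ s) (ht : PrivateVars t.vars)
    (h : flatTermCode N (t.left L₂).code =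
      Nat.pair 0 (Nat.pair (leftSort (Encodable.encode s) / 2) (N + 2 * t.code))) :
    FlatTerm N (t.left L₂) := by
  rcases s with a | c
  · exact ⟨t, rfl⟩
  · refine ⟨.var (Sum.inr c) (N + 2 * t.code), (nameSubst_name N t).symm, h.trans ?_, ?_⟩
    · rw [Term.code]
      simp [leftSort]
      omega
    · rintro x rfl _
      exact ⟨c, t, rfl, ht⟩

/-- By tameness, below a first-signature symbol everything is first-signature, so such a subterm can
be replaced as a whole; below a second-signature symbol the recursion continues. -/
theorem Term.flatTerm (tame : Tame L₁ L₂) {N : ℕ} {s : A ⊕ (B ⊕ C)} (t : Term (combine L₁ L₂) s)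
    (hN : ∀ x ∈ t.vars, x.2 < N) : FlatTerm N t := by
  induction t with
  | var s n =>
    have hn : n < N := hN _ rfl
    rcases s with a | s
    · exact ⟨.var (Sum.inl a) n, rfl⟩
    · refine ⟨.var s n, (nameSubst_of_lt (Sum.inr s) hn).symm, ?_, ?_⟩
      · rw [Term.code, flatTermCode, termRec_var, Term.code]
        simp [Nat.unpair_pair]
        omega
      · rintro x rfl h
        exact absurd hn (not_lt.2 h)
  | app f ts ih =>
    have ih' := fun i => ih i fun x hx => hN x (Set.mem_iUnion.2 ⟨i, hx⟩)
    rcases f with f | f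
    · choose t₀ ht₀ using fun i : Fin (L₁.fnArity f) =>
        FlatTerm.exists_left (tame.1 f i) (ih' i)
      obtain rfl : ts = fun i : Fin (L₁.fnArity f) => (t₀ i).left L₂ := funext ht₀
      exact FlatTerm.left (Term.app f t₀) (Term.privateVars_app tame f t₀)
        (flatTermCode_left N f t₀)
    · choose u hu hc hv using ih'
      refine ⟨Term.app f u, ?_, ?_, ?_⟩
      · exact congrArg (Term.app (L := combine L₁ L₂) (Sum.inr f)) (funext hu)
      · refine (congrArg (flatTermCode N) (code_app_inr f ts)).trans ?_
        refine (flatTermCode_app N _ _ _).trans ?_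
        rw [List.map_ofFn]
        exact congrArg (fun h => Nat.pair 1 (Nat.pair (Encodable.encode (L₂.cod f))
          (Nat.pair (Encodable.encode f) (Encodable.encode (List.ofFn h))))) (funext hc)
      · intro x hx
        obtain ⟨i, hi⟩ := Set.mem_iUnion.1 hx
        exact hv i x hi

end Names

end ManySorted

namespace ManySorted

theorem unpair_code_rel {S : Type} {L : Signature S} [Encodable S] [Encodable L.Fn]
    [Encodable L.Rel] (r : L.Rel) (ts) :
    (Atom.rel (L := L) r ts).code.unpair.2.unpair.1 = Encodable.encode r := by
  simp [Atom.code]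

/-! ### Flattenings with known codes -/

section Flatten

variable {A B C : Type} [Encodable A] [Encodable B] [Encodable C]
  {L₁ : Signature (A ⊕ C)} {L₂ : Signature (B ⊕ C)}
  [Encodable L₁.Fn] [Encodable L₁.Rel] [Encodable L₂.Fn] [Encodable L₂.Rel]

/-- Equalities of shared sort are always assigned to the second signature, even between two
first-signature terms, which then become names. This leaves only private variables in the first
part. -/
theorem Atom.flat (tame : Tame L₁ L₂) {N : ℕ} (a : Atom (combine L₁ L₂))
    (hN : ∀ x ∈ a.vars, x.2 < N) :
    (∃ a₀ : Atom L₁, PrivateVars a₀.vars ∧ a = a₀.left L₂ ∧ a.code.unpair.2.unpair.1 % 2 = 0) ∨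
      ∃ a₀ : Atom L₂, NamedVars L₁ N a₀.vars ∧
        a = (a₀.right L₁).subst (nameSubst L₁ L₂ N) ∧ a.code.unpair.2.unpair.1 % 2 = 1 ∧
        flatAtomCode N a.code = a₀.code := by
  have h2 : ∀ k, (2 * k + 1) % 2 = 1 := by omega
  have h1 : ∀ k, (2 * k + 1) / 2 = k := by omega
  cases a with
  | eq s t u =>
    have ht := t.flatTerm tame fun x hx => hN x (Or.inl hx)
    have hu := u.flatTerm tame fun x hx => hN x (Or.inr hx)
    rcases s with a | s
    · obtain ⟨t₀, rfl⟩ := ht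
      obtain ⟨u₀, rfl⟩ := hu
      refine Or.inl ⟨.eq (Sum.inl a) t₀ u₀, ?_, rfl, ?_⟩
      · rintro x (hx | hx)
        · exact t₀.privateVars tame (by simp) x hx
        · exact u₀.privateVars tame (by simp) x hx
      · simp [Atom.code]
    · obtain ⟨t₀, et, ct, vt⟩ := ht
      obtain ⟨u₀, eu, cu, vu⟩ := hu
      refine Or.inr ⟨.eq s t₀ u₀, ?_, ?_, ?_, ?_⟩
      · rintro x (hx | hx)
        · exact vt x hx
        · exact vu x hx
      · rw [et, eu]
        rfl
      · simp [Atom.code, h2]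
      · rw [flatAtomCode, mapAtomCode_eq, ct, cu, Encodable.encode_inr, h1]
        rfl
  | rel r ts =>
    have hts := fun i => (ts i).flatTerm tame fun x hx => hN x (Set.mem_iUnion.2 ⟨i, hx⟩)
    rcases r with r | r
    · choose t₀ ht₀ using fun i : Fin (L₁.relArity r) =>
        FlatTerm.exists_left (tame.2 r i) (hts i)
      obtain rfl : ts = fun i : Fin (L₁.relArity r) => (t₀ i).left L₂ := funext ht₀
      refine Or.inl ⟨.rel r t₀, ?_, rfl, ?_⟩
      · intro x hx
        obtain ⟨i, hi⟩ := Set.mem_iUnion.1 hx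
        exact (t₀ i).privateVars tame (tame.2 r i) x hi
      · refine (congrArg (· % 2) ((unpair_code_rel (L := combine L₁ L₂) (Sum.inl r) _).trans
          (encode_rel_inl r))).trans ?_
        simp
    · choose u hu hc hv using hts
      refine Or.inr ⟨.rel r u, ?_, ?_, ?_, ?_⟩
      · intro x hx
        obtain ⟨i, hi⟩ := Set.mem_iUnion.1 hx
        exact hv i x hi
      · exact congrArg (Atom.rel (L := combine L₁ L₂) (Sum.inr r)) (funext hu)
      · exact (congrArg (· % 2) ((unpair_code_rel (L := combine L₁ L₂) (Sum.inr r) _).trans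
          (encode_rel_inr r))).trans (h2 _)
      · refine (mapAtomCode_rel (L := combine L₁ L₂) _ _ _ (Sum.inr r) ts).trans ?_
        rw [encode_rel_inr, h1]
        exact congrArg (fun h => Nat.pair 1 (Nat.pair (Encodable.encode r)
          (Encodable.encode (List.ofFn h)))) (funext hc)

/-- Flatten a list of literals. -/
theorem exists_flat_lits (tame : Tame L₁ L₂) {N : ℕ} (ls : List (Literal (combine L₁ L₂)))
    (hN : ∀ x ∈ litVars ls, x.2 < N) : ∃ (φ : List (Literal L₁)) (ψ : List (Literal L₂)),
      (∀ l ∈ φ, PrivateVars l.1.vars) ∧ (∀ l ∈ ψ, NamedVars L₁ N l.1.vars) ∧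
      ls.Perm (φ.map (fun l => (l.1.left L₂, l.2)) ++
        ψ.map (fun l => ((l.1.right L₁).subst (nameSubst L₁ L₂ N), l.2))) ∧
      φ.map litCode = (ls.map litCode).filterMap (fun l => bif isLeftLitCode l then
        some (mapLitCode unleftAtomCode l) else none) ∧
      ψ.map litCode = (ls.map litCode).filterMap (fun l => bif isLeftLitCode l then none else
        some (mapLitCode (fun a => flatAtomCode N a) l)) := by
  refine exists_perm_append_map ls fun l hl => ?_
  rcases l.1.flat tame fun x hx => hN x ⟨l, hl, hx⟩ with
    ⟨a₀, hp, e, he⟩ | ⟨a₀, hv, e, he, hc⟩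
  · refine Or.inl ⟨(a₀, l.2), hp, Prod.ext e rfl, ?_⟩
    have h : isLeftLitCode (litCode l) = true := by
      rw [isLeftLitCode, litAtomCode_litCode, he]
      rfl
    rw [h]
    have h' : unleftAtomCode l.1.code = a₀.code := by rw [e, unleftAtomCode_code]
    exact ⟨congrArg some (mapLitCode_litCode h'), rfl⟩
  · refine Or.inr ⟨(a₀, l.2), hv, Prod.ext e rfl, ?_⟩
    have h : isLeftLitCode (litCode l) = false := by
      rw [isLeftLitCode, litAtomCode_litCode, he]
      rfl
    rw [h]
    exact ⟨rfl, congrArg some (mapLitCode_litCode hc)⟩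

omit [Encodable L₁.Fn] [Encodable L₁.Rel] [Encodable L₂.Fn] [Encodable L₂.Rel] in
/-- Separate the variables by their sorts. -/
theorem exists_split_vars (xs : List ((A ⊕ (B ⊕ C)) × ℕ)) :
    ∃ (e : List (A × ℕ)) (η : List ((B ⊕ C) × ℕ)),
      xs.Perm (e.map (fun x => (Sum.inl x.1, x.2)) ++ η.map (fun x => (sortRight x.1, x.2))) ∧
      e.map (fun x => varCode ((Sum.inl x.1 : A ⊕ C), x.2)) = (xs.map varCode).filterMap
        (fun x => bif x.unpair.1 % 2 == 1 then none else some x) ∧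
      η.map varCode = (xs.map varCode).filterMap (fun x => bif x.unpair.1 % 2 == 1 then
        some (Nat.pair (x.unpair.1 / 2) x.unpair.2) else none) := by
  have h1 : ∀ k, (2 * k + 1) / 2 = k := by omega
  have h2 : ∀ k, (2 * k + 1) % 2 = 1 := by omega
  obtain ⟨e, η, -, -, h⟩ := exists_perm_append_map (p := fun _ => True) (q := fun _ => True)
    (f := fun x : A × ℕ => ((Sum.inl x.1 : A ⊕ (B ⊕ C)), x.2))
    (g := fun x : (B ⊕ C) × ℕ => ((sortRight x.1 : A ⊕ (B ⊕ C)), x.2)) (cα := varCode)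
    (cβ := fun x => varCode ((Sum.inl x.1 : A ⊕ C), x.2)) (cγ := varCode)
    (F := fun x => bif x.unpair.1 % 2 == 1 then none else some x)
    (G := fun x => bif x.unpair.1 % 2 == 1 then
        some (Nat.pair (x.unpair.1 / 2) x.unpair.2) else none) xs (by
      rintro ⟨a | s, n⟩ -
      · exact Or.inl ⟨(a, n), trivial, rfl, by simp [varCode], by simp [varCode]⟩
      · exact Or.inr ⟨(s, n), trivial, rfl, by simp [varCode, h2], by simp [varCode, h1, h2]⟩)
  exact ⟨e, η, h⟩

/-- The shared variables with indices from `N` on. -/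
def freshVar (N : ℕ) : (B ⊕ C) × ℕ → Option (C × ℕ)
  | (Sum.inl _, _) => none
  | (Sum.inr c, n) => if N ≤ n then some (c, n) else none

omit [Encodable B] [Encodable C] in
theorem freshVar_eq_some {N : ℕ} {x : (B ⊕ C) × ℕ} {y : C × ℕ} :
    freshVar N x = some y ↔ x = (Sum.inr y.1, y.2) ∧ N ≤ y.2 := by
  obtain ⟨b | c, n⟩ := x <;> obtain ⟨c', m⟩ := y <;> simp [freshVar]
  grind

omit [Encodable L₁.Rel] in
theorem NamedVars.map_freshVar {N : ℕ} {xs : List ((B ⊕ C) × ℕ)}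
    (h : NamedVars L₁ N {x | x ∈ xs}) :
    (xs.filterMap (freshVar N)).map (fun y => varCode ((Sum.inr y.1 : B ⊕ C), y.2)) =
      (xs.map varCode).filterMap fun x =>
        bif x.unpair.1 % 2 == 1 && Nat.ble N x.unpair.2 then some x else none := by
  induction xs with
  | nil => rfl
  | cons x xs ih =>
    specialize ih fun y hy => h y (List.mem_cons_of_mem _ hy)
    by_cases hx : N ≤ x.2
    · obtain ⟨c, t, rfl, -⟩ := h x List.mem_cons_self hx
      have h1 : freshVar N ((Sum.inr c : B ⊕ C), N + 2 * t.code) = some (c, N + 2 * t.code) :=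
        if_pos hx
      rw [List.filterMap_cons_some h1, List.map_cons, List.map_cons, ih,
        List.filterMap_cons_some (b := varCode ((Sum.inr c : B ⊕ C), N + 2 * t.code))]
      have h2 : ∀ k, (2 * k + 1) % 2 = 1 := by omega
      have h3 : Nat.ble N (N + 2 * t.code) = true := by simp
      simp [varCode, h2, h3]
    · have h1 : freshVar N x = none := by
        obtain ⟨b | c, n⟩ := x
        · rfl
        · exact if_neg hx
      rw [List.filterMap_cons_none h1, List.map_cons, List.filterMap_cons_none, ih]
      have : Nat.ble N x.2 = false := by
        rw [Bool.eq_false_iff]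
        simpa using hx
      simp [varCode, this]

/-- A flattening of which the codes are known. -/
structure CodedFlattening (P : Primitive (combine L₁ L₂)) extends Flattening P where
  named : ∀ y ∈ η', ∃ s : Term L₁ (Sum.inr y.1), y.2 = P.formula.code + 1 + 2 * s.code
  code_η : η.map varCode = rightBoundCode P.formula.code
  code_η' : η'.map (fun y => varCode ((Sum.inr y.1 : B ⊕ C), y.2)) = freshCode P.formula.code
  code_ψ : ψ.map litCode = rightLitsCode P.formula.code
  code_one : toFlattening.primitiveOne.formula.code = oneCode P.formula.code

theorem exists_codedFlattening (tame : Tame L₁ L₂) (P : Primitive (combine L₁ L₂)) :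
    Nonempty (CodedFlattening P) := by
  have hN : ∀ x ∈ litVars P.lits, x.2 < P.formula.code + 1 := fun x hx =>
    Nat.lt_succ_of_le (P.index_le_code (Or.inr hx))
  obtain ⟨e, η, hbv, ce, cη⟩ := exists_split_vars P.bv
  obtain ⟨φ, ψ, hφ, hψ, hlits, cφ, cψ⟩ := exists_flat_lits tame P.lits hN
  have hnam : NamedVars L₁ (P.formula.code + 1) {x | x ∈ ψ.flatMap fun l => l.1.varList} := by
    intro x hx
    obtain ⟨l, hl, hx⟩ := List.mem_flatMap.1 hx
    exact hψ l hl x (l.1.mem_varList.1 hx)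
  have hmem : ∀ y : C × ℕ, y ∈ (ψ.flatMap fun l => l.1.varList).filterMap
      (freshVar (P.formula.code + 1)) ↔
      (Sum.inr y.1, y.2) ∈ litVars ψ ∧ P.formula.code + 1 ≤ y.2 := by
    intro y
    simp only [List.mem_filterMap, freshVar_eq_some, List.mem_flatMap, Atom.mem_varList, litVars,
      Set.mem_ofPred_eq]
    constructor
    · rintro ⟨x, h, rfl, h'⟩
      exact ⟨h, h'⟩
    · rintro ⟨h, h'⟩
      exact ⟨_, h, rfl, h'⟩
  have hname : ∀ y : C × ℕ, y ∈ (ψ.flatMap fun l => l.1.varList).filterMap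
      (freshVar (P.formula.code + 1)) → ∃ s : Term L₁ (Sum.inr y.1),
        y.2 = P.formula.code + 1 + 2 * s.code ∧ PrivateVars s.vars := by
    intro y hy
    obtain ⟨⟨l, hl, hx⟩, hy⟩ := (hmem y).1 hy
    obtain ⟨c, s, h, hp⟩ := hψ l hl _ hx hy
    obtain ⟨c', m⟩ := y
    simp only [Prod.mk.injEq, Sum.inr.injEq] at h
    obtain ⟨rfl, rfl⟩ := h
    exact ⟨s, rfl, hp⟩
  let F : Flattening P :=
    { e := e
      η := η
      φ := φ
      ψ := ψ
      -- The list follows occurrences in `ψ` and may contain repetitions, which do no harm.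
      η' := (ψ.flatMap fun l => l.1.varList).filterMap (freshVar (P.formula.code + 1))
      t := namedTerm (P.formula.code + 1)
      bv_perm := hbv
      lits_perm := by
        classical
        refine hlits.trans (List.Perm.of_eq (congrArg _
          (List.map_congr_left fun l hl => Prod.ext (Eq.symm ?_) rfl)))
        -- Among the variables that occur in `ψ`, those of shared sort with an index past the code
        -- of the input are exactly the `η'`, so substitution by names is substitution for `η'`.
        refine Atom.subst_congr _ fun x hx => ?_
        rw [Atom.vars_right] at hx
        obtain ⟨⟨s, n⟩, hx, rfl⟩ := hx
        rcases s with b | c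
        · rfl
        · refine if_congr ?_ rfl rfl
          rw [hmem]
          exact and_iff_right ⟨l, hl, hx⟩
      φ_private := by
        rintro x ⟨l, hl, hx⟩
        exact hφ l hl x hx
      t_private := by
        rintro ⟨c, n⟩ hy
        obtain ⟨s, h, hp⟩ := hname _ hy
        change n = _ at h
        change PrivateVars (namedTerm (P.formula.code + 1) c n).vars
        rw [h, namedTerm_even]
        exact hp
      fresh := fun y hy h => by
        have h1 := P.index_le_code h
        have h2 := ((hmem y).1 hy).2
        exact absurd (h2.trans h1) (by simp)
      used := fun y hy => ((hmem y).1 hy).1 }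
  have hψc : ψ.map litCode = rightLitsCode P.formula.code := by
    rw [rightLitsCode, parseCode_formula]
    exact cψ
  have hη' : F.η'.map (fun y => varCode ((Sum.inr y.1 : B ⊕ C), y.2)) =
      freshCode P.formula.code := by
    rw [freshCode, ← hψc]
    refine hnam.map_freshVar.trans ?_
    rw [List.map_flatMap, List.flatMap_map]
    simp only [litAtomCode_litCode, varsAtomCode_code]
  refine ⟨⟨F, fun y hy => ?_, ?_, hη', hψc, ?_⟩⟩
  · obtain ⟨s, h, -⟩ := hname y hy
    exact ⟨s, h⟩
  · rw [rightBoundCode, parseCode_formula]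
    exact cη
  · rw [← exsCode_primitive, oneCode, parseCode_formula, ← hη']
    rw [Flattening.primitiveOne, List.map_map, List.map_append, List.map_map, List.map_map]
    refine congrArg₂ exsCode ?_ (congrArg conjCode (congrArg₂ (· ++ ·) cφ ?_))
    · exact ce
    · refine List.map_congr_left fun y hy => ?_
      obtain ⟨c, n⟩ := y
      obtain ⟨s, h, -⟩ : ∃ s : Term L₁ (Sum.inr c),
        n = P.formula.code + 1 + 2 * s.code ∧ _ := hname _ hy
      subst h
      change Nat.pair 1 (Nat.pair 0 (Nat.pair (Encodable.encode (Sum.inr c : A ⊕ C))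
        (Nat.pair (Nat.pair 0 (Nat.pair (Encodable.encode (Sum.inr c : A ⊕ C)) _))
          (namedTerm (P.formula.code + 1) c (P.formula.code + 1 + 2 * s.code)).code))) = _
      rw [namedTerm_even]
      simp [varCode]

end Flatten

end ManySorted

namespace ManySorted

theorem substTermCode_app (N s f : ℕ) (l : List ℕ) :
    substTermCode N (Nat.pair 1 (Nat.pair s (Nat.pair f (Encodable.encode l)))) =
      Nat.pair 1 (Nat.pair (2 * s + 1) (Nat.pair (2 * f + 1)
        (Encodable.encode (l.map (substTermCode N))))) := by
  rw [substTermCode, termRec_app]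
  simp only [Nat.unpair_pair]
  rfl

/-! ### Separations of disjuncts with known codes -/

section Separate

variable {A B C : Type} [Encodable A] [Encodable B] [Encodable C]
  {L₁ : Signature (A ⊕ C)} {L₂ : Signature (B ⊕ C)}
  [Encodable L₁.Fn] [Encodable L₁.Rel] [Encodable L₂.Fn] [Encodable L₂.Rel]

section Subst

variable {N : ℕ} {σ : (s : A ⊕ (B ⊕ C)) → ℕ → Term (combine L₁ L₂) s}

omit [Encodable L₁.Rel] [Encodable L₂.Rel] in
theorem substTermCode_code : ∀ {s : B ⊕ C} (u : Term L₂ s), (∀ x ∈ u.vars,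
    substTermCode N (Term.var (L := L₂) x.1 x.2).code = (σ (Sum.inr x.1) x.2).code) →
    substTermCode N u.code = ((u.right L₁).subst σ).code
  | _, .var s n, h => h (s, n) rfl
  | _, .app f ts, h => by
    refine Eq.trans ?_ (code_app_inr (L₁ := L₁) f fun i => ((ts i).right L₁).subst σ).symm
    rw [Term.code, substTermCode_app, List.map_ofFn]
    exact congrArg (fun h => Nat.pair 1 (Nat.pair _ (Nat.pair _
      (Encodable.encode (List.ofFn h))))) (funext fun i =>
        substTermCode_code (ts i) fun x hx => h x (Set.mem_iUnion.2 ⟨i, hx⟩))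

theorem substAtomCode_code (a : Atom L₂) (h : ∀ x ∈ a.vars,
    substTermCode N (Term.var (L := L₂) x.1 x.2).code = (σ (Sum.inr x.1) x.2).code) :
    substAtomCode N a.code = ((a.right L₁).subst σ).code := by
  cases a with
  | eq s t u =>
    rw [substAtomCode, mapAtomCode_eq, substTermCode_code t fun x hx => h x (Or.inl hx),
      substTermCode_code u fun x hx => h x (Or.inr hx), ← encode_sortRight (A := A)]
    rfl
  | rel r ts =>
    rw [substAtomCode, mapAtomCode_rel, ← encode_rel_inr (L₁ := L₁)]
    exact congrArg (fun h => Nat.pair 1 (Nat.pair _ (Encodable.encode (List.ofFn h))))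
      (funext fun i => substTermCode_code (ts i) fun x hx => h x (Set.mem_iUnion.2 ⟨i, hx⟩))

theorem substFormulaCode_code : ∀ φ : Formula L₂, φ.IsQF → (∀ x ∈ φ.fv,
    substTermCode N (Term.var (L := L₂) x.1 x.2).code = (σ (Sum.inr x.1) x.2).code) →
    substFormulaCode N φ.code = ((φ.right L₁).subst σ).code
  | .bot, _, _ => by
    change substFormulaCode N (Nat.pair 0 0) = Nat.pair 0 0
    rw [substFormulaCode, formRec_bot]
    rfl
  | .atom a, _, h => by
    change substFormulaCode N (Nat.pair 1 a.code) = Nat.pair 1 _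
    rw [substFormulaCode, formRec_pair _ _ (by norm_num), ← substAtomCode_code a h]
    rfl
  | .not φ, hq, h => by
    change substFormulaCode N (Nat.pair 2 φ.code) = Nat.pair 2 _
    have ih := substFormulaCode_code φ hq h
    rw [substFormulaCode] at ih ⊢
    rw [formRec_pair _ _ (by norm_num), ih]
    rfl
  | .and φ χ, hq, h => by
    change substFormulaCode N (Nat.pair 3 (Nat.pair φ.code χ.code)) = Nat.pair 3 (Nat.pair _ _)
    have ih := substFormulaCode_code φ hq.1 fun x hx => h x (Or.inl hx)
    have ih' := substFormulaCode_code χ hq.2 fun x hx => h x (Or.inr hx)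
    rw [substFormulaCode] at ih ih' ⊢
    rw [formRec_pair _ _ (by norm_num), Nat.unpair_pair, ih, ih']
    rfl
  | .or φ χ, hq, h => by
    change substFormulaCode N (Nat.pair 4 (Nat.pair φ.code χ.code)) = Nat.pair 4 (Nat.pair _ _)
    have ih := substFormulaCode_code φ hq.1 fun x hx => h x (Or.inl hx)
    have ih' := substFormulaCode_code χ hq.2 fun x hx => h x (Or.inr hx)
    rw [substFormulaCode] at ih ih' ⊢
    rw [formRec_pair _ _ (by norm_num), Nat.unpair_pair, ih, ih']
    rfl

end Subst

omit [Encodable A] [Encodable B] [Encodable C] [Encodable L₁.Fn] [Encodable L₁.Rel]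
  [Encodable L₂.Fn] [Encodable L₂.Rel] in
theorem constraint_left (ls : List (Literal L₁)) : (constraint ls).left L₂ =
    constraint (ls.map fun l => (l.1.left L₂, l.2)) := by
  induction ls with
  | nil => rfl
  | cons l ls ih =>
    change Formula.and _ _ = Formula.and _ _
    congr 1
    obtain ⟨a, b⟩ := l
    cases b <;> rfl

/-- The number `n` is an index of a variable of sort `c` in `ys`, or it is an odd name of a term. -/
def IsName (L₁ : Signature (A ⊕ C)) [Encodable L₁.Fn] (N : ℕ) (ys : List (C × ℕ)) (c : C)
    (n : ℕ) : Prop :=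
  (c, n) ∈ ys ∨ ∃ t : Term L₁ (Sum.inr c), PrivateVars t.vars ∧ n = N + (2 * t.code + 1)

/-- The term that a variable stands for, in the separation of a disjunct. -/
noncomputable def sepTerm (N : ℕ) (c : C) (n : ℕ) : Term L₁ (Sum.inr c) :=
  if N ≤ n ∧ (n - N) % 2 = 1 then namedTerm N c n else .var (Sum.inr c) n

omit [Encodable A] [Encodable B] [Encodable C] [Encodable L₁.Fn] [Encodable L₁.Rel]
  [Encodable L₂.Fn] [Encodable L₂.Rel] in
theorem Term.var_or_private (tame : Tame L₁ L₂) [Encodable (A ⊕ C)] [Encodable L₁.Fn] {s : A ⊕ C}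
    (t : Term L₁ s) :
    (∃ n, t = .var s n) ∨ PrivateVars t.vars ∧ t.code.unpair.1 = 1 := by
  cases t with
  | var s n => exact Or.inl ⟨n, rfl⟩
  | app f ts => exact Or.inr ⟨Term.privateVars_app tame f ts, by simp [Term.code]⟩

omit [Encodable B] [Encodable L₁.Rel] [Encodable L₂.Fn] [Encodable L₂.Rel] in
-- A term of shared sort in a disjunct is either an `η'`, which stands for itself because its offset
-- is even or absent, or an application with private variables, which receives its odd name.
theorem exists_sepTerm (tame : Tame L₁ L₂) {N : ℕ} {ys : List (C × ℕ)}
    (hys : ∀ y ∈ ys, ¬ (N ≤ y.2 ∧ (y.2 - N) % 2 = 1)) {c : C} (t : Term L₁ (Sum.inr c))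
    (ht : ∀ x ∈ t.vars, (∃ a : A, x.1 = Sum.inl a) ∨ ∃ y ∈ ys, x = (Sum.inr y.1, y.2)) :
    ∃ n, IsName L₁ N ys c n ∧ t = sepTerm N c n ∧
      nameCode N (Encodable.encode (Sum.inr c : A ⊕ C)) t.code =
        Nat.pair 0 (Nat.pair (Encodable.encode (Sum.inr c : A ⊕ C)) n) := by
  rcases t.var_or_private tame with ⟨n, rfl⟩ | ⟨hp, h1⟩
  · rcases ht _ rfl with ⟨a, ha⟩ | ⟨⟨c', m⟩, hy, h⟩
    · cases ha
    · simp only [Prod.mk.injEq, Sum.inr.injEq] at h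
      obtain ⟨rfl, rfl⟩ := h
      refine ⟨n, Or.inl hy, (if_neg (hys _ hy)).symm, ?_⟩
      simp [nameCode, Term.code]
  · refine ⟨N + (2 * t.code + 1), Or.inr ⟨t, hp, rfl⟩, ?_, ?_⟩
    · rw [sepTerm, if_pos (by omega), namedTerm_odd]
    · simp [nameCode, h1]

/-- The literal that a signed equality stands for, in the separation of a disjunct. -/
noncomputable def VarEq.sep (L₁ : Signature (A ⊕ C)) [Encodable L₁.Fn] (N : ℕ) (q : VarEq C) :
    Literal L₁ :=
  (.eq (Sum.inr q.sort) (sepTerm N q.sort q.n) (sepTerm N q.sort q.m), q.sign)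

/-- By tameness a first-signature literal that is not a signed equality of shared sort has only
private variables, so the parity of the sort of an equality decides the separation. -/
theorem exists_separate (tame : Tame L₁ L₂) {N : ℕ} {ys : List (C × ℕ)}
    (hys : ∀ y ∈ ys, ¬ (N ≤ y.2 ∧ (y.2 - N) % 2 = 1)) (d : List (Literal L₁))
    (hd : ∀ x ∈ litVars d, (∃ a : A, x.1 = Sum.inl a) ∨ ∃ y ∈ ys, x = (Sum.inr y.1, y.2)) :
    ∃ (φ₁ : List (Literal L₁)) (φ₂ : List (VarEq C)), (∀ l ∈ φ₁, PrivateVars l.1.vars) ∧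
      (∀ q ∈ φ₂, IsName L₁ N ys q.sort q.n ∧ IsName L₁ N ys q.sort q.m) ∧
      d.Perm (φ₁.map id ++ φ₂.map (VarEq.sep L₁ N)) ∧
      φ₁.map (fun l => litCode (l.1.left L₂, l.2)) = (d.map litCode).filterMap (fun l =>
        bif isSharedLitCode l then none else some (mapLitCode leftAtomCode l)) ∧
      φ₂.map (fun q => litCode (q.toRight L₂)) = (d.map litCode).filterMap (fun l =>
        bif isSharedLitCode l then some (mapLitCode (fun a => nameAtomCode N a) l) else none) := by
  refine exists_perm_append_map d fun l hl => ?_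
  have hv : ∀ x ∈ l.1.vars, (∃ a : A, x.1 = Sum.inl a) ∨ ∃ y ∈ ys, x = (Sum.inr y.1, y.2) :=
    fun x hx => hd x ⟨l, hl, hx⟩
  have left : PrivateVars l.1.vars → isSharedLitCode (litCode l) = false → ∃ l₁ : Literal L₁,
      PrivateVars l₁.1.vars ∧ l = id l₁ ∧ (bif isSharedLitCode (litCode l) then none else
        some (mapLitCode leftAtomCode (litCode l))) = some (litCode (l₁.1.left L₂, l₁.2)) ∧
      (bif isSharedLitCode (litCode l) then
        some (mapLitCode (fun a => nameAtomCode N a) (litCode l)) else none) = none := by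
    intro hp h
    refine ⟨l, hp, rfl, ?_⟩
    rw [h]
    exact ⟨congrArg some (mapLitCode_litCode (leftAtomCode_code l.1)), rfl⟩
  have h2 : ∀ k, (2 * k + 1) % 2 = 1 := by omega
  obtain ⟨a, b⟩ := l
  cases a with
  | eq s t u =>
    rcases s with a | c
    · refine Or.inl (left ?_ ?_)
      · rintro x (hx | hx)
        · exact t.privateVars tame (by simp) x hx
        · exact u.privateVars tame (by simp) x hx
      · rw [isSharedLitCode, litAtomCode_litCode]
        simp [Atom.code]
    · obtain ⟨n, hn, et, ct⟩ := exists_sepTerm tame hys t fun x hx => hv x (Or.inl hx)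
      obtain ⟨m, hm, eu, cu⟩ := exists_sepTerm tame hys u fun x hx => hv x (Or.inr hx)
      refine Or.inr ⟨⟨c, n, m, b⟩, ⟨hn, hm⟩, ?_, ?_⟩
      · rw [et, eu]
        rfl
      · have h : isSharedLitCode (litCode (Atom.eq (Sum.inr c) t u, b)) = true := by
          rw [isSharedLitCode, litAtomCode_litCode]
          simp [Atom.code, h2]
        rw [h]
        refine ⟨rfl, congrArg some (mapLitCode_litCode (L' := L₂) (a := .eq (Sum.inr c)
          (.var (Sum.inr c) n) (.var (Sum.inr c) m)) ?_)⟩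
        have hs : (Atom.eq (Sum.inr c) t u).code.unpair.2.unpair.1 =
          Encodable.encode (Sum.inr c : A ⊕ C) := by simp [Atom.code]
        rw [nameAtomCode, mapAtomCode_eq, hs, ct, cu]
        rfl
  | rel r ts =>
    refine Or.inl (left ?_ ?_)
    · intro x hx
      obtain ⟨i, hi⟩ := Set.mem_iUnion.1 hx
      exact (ts i).privateVars tame (tame.2 r i) x hi
    · rw [isSharedLitCode, litAtomCode_litCode]
      simp [Atom.code]

/-- The condition on `ψ₁` says that it mentions only parameters of the second primitive formula.
Then replacing all shared variables from `N` on by the terms they name affects exactly the `ξ'`, as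
`disjunctCode` requires. -/
theorem CodedFlattening.exists_separation (tame : Tame L₁ L₂) {P : Primitive (combine L₁ L₂)}
    (F : CodedFlattening P) {d : List (Literal L₁)}
    (hd : litVars d ⊆ F.primitiveOne.formula.fv) :
    ∃ G : Separation F.toFlattening d,
      G.primitiveTwo.formula.code = twoCode P.formula.code (d.map litCode) ∧
      ∀ ψ₁ : Formula L₂, ψ₁.IsQF → ψ₁.fv ⊆ G.primitiveTwo.formula.fv →
        (G.output ψ₁).code = disjunctCode P.formula.code (d.map litCode) ψ₁.code := by
  set N := P.formula.code + 1 with hN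
  have hys : ∀ y ∈ F.η', ¬ (N ≤ y.2 ∧ (y.2 - N) % 2 = 1) := by
    intro y hy
    obtain ⟨s, h⟩ := F.named y hy
    omega
  obtain ⟨φ₁, φ₂, hφ₁, hφ₂, hp, c₁, c₂⟩ := exists_separate tame hys d fun x hx => by
    rcases F.mem_fv_primitiveOne (hd hx) with ⟨a, n, rfl, -⟩ | ⟨c, n, rfl, h⟩
    · exact Or.inl ⟨a, rfl⟩
    · exact Or.inr ⟨(c, n), h, rfl⟩
  let ξ' := (φ₂.flatMap fun q => [(q.sort, q.n), (q.sort, q.m)]).filter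
    fun y => decide (N ≤ y.2 ∧ (y.2 - N) % 2 = 1)
  -- The fresh `ξ'` are recognized by their odd offset; the `η'` in `φ₂` have even offsets and are
  -- left alone.
  have hmem : ∀ y, y ∈ ξ' ↔ y ∈ varEqVars φ₂ ∧ N ≤ y.2 ∧ (y.2 - N) % 2 = 1 := by
    intro y
    simp [ξ', varEqVars]
  have hname : ∀ y ∈ ξ', ∃ t : Term L₁ (Sum.inr y.1),
      PrivateVars t.vars ∧ y.2 = N + (2 * t.code + 1) := by
    intro y hy
    obtain ⟨⟨q, hq, h⟩, hy⟩ := (hmem y).1 hy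
    have : IsName L₁ N F.η' y.1 y.2 := by
      rcases h with rfl | rfl
      · exact (hφ₂ q hq).1
      · exact (hφ₂ q hq).2
    exact this.resolve_left fun h => hys y h hy
  let G : Separation F.toFlattening d :=
    { φ₁ := φ₁
      φ₂ := φ₂
      ξ' := ξ'
      t' := namedTerm N
      perm := by
        classical
        rw [List.map_id] at hp
        refine hp.trans (List.Perm.of_eq (congrArg _ (List.map_congr_left fun q hq => ?_)))
        have e : ∀ n, (q.sort, n) ∈ varEqVars φ₂ → (sepTerm N q.sort n : Term L₁ _) =
            if (q.sort, n) ∈ ξ' then namedTerm N q.sort n else .var (Sum.inr q.sort) n :=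
          fun n hn => if_congr (by rw [hmem, and_iff_right hn]) rfl rfl
        rw [VarEq.sep, e q.n ⟨q, hq, Or.inl rfl⟩, e q.m ⟨q, hq, Or.inr rfl⟩, VarEq.instLeft]
      φ₁_private := by
        rintro x ⟨l, hl, hx⟩
        exact hφ₁ l hl x hx
      t'_private := by
        rintro ⟨c, n⟩ hy
        obtain ⟨s, h, e⟩ := hname _ hy
        change n = _ at e
        change PrivateVars (namedTerm N c n).vars
        rw [e, namedTerm_odd]
        exact h
      fresh := fun y hy => by
        have h := ((hmem y).1 hy).2
        refine ⟨fun h' => ?_, fun h' => hys y h' h⟩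
        have := P.index_le_code h'
        change y.2 ≤ _ at this
        omega
      used := fun y hy => ((hmem y).1 hy).1 }
  refine ⟨G, ?_, fun ψ₁ hq hfv => ?_⟩
  · rw [← exsCode_primitive, twoCode, ← F.code_η, ← F.code_η', ← F.code_ψ, ← hN, ← c₂]
    rw [Separation.primitiveTwo, List.map_append, List.map_append, List.map_map, List.map_map]
    rfl
  · change Nat.pair 3 (Nat.pair _ _) = _
    rw [disjunctCode, ← hN, ← c₁]
    refine congrArg (Nat.pair 3) (congrArg₂ Nat.pair ?_ ?_)
    · rw [constraint_left, ← conjCode_map, List.map_map]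
      rfl
    · refine (substFormulaCode_code ψ₁ hq fun x hx => ?_).symm
      obtain ⟨s, n⟩ := x
      rw [Term.code, substTermCode, termRec_var]
      simp only [Nat.unpair_pair]
      rcases G.mem_fv_primitiveTwo hd (hfv hx) with ⟨c, rfl, hc⟩ | ⟨hξ, -, hP⟩
      · obtain ⟨t, -, e⟩ : ∃ t : Term L₁ (Sum.inr c), _ ∧ n = N + (2 * t.code + 1) := hname _ hc
        rw [substShared_of_mem _ _ hc]
        change _ = ((namedTerm N c n : Term L₁ _).left L₂).code
        have h1 : (n - N) / 2 = t.code := by omega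
        have h2 : ∀ k, (2 * k + 1) % 2 = 1 := by omega
        have h3 : Nat.ble N n = true := by
          rw [Nat.ble_eq]
          omega
        rw [h1, leftTermCode_code (L₂ := L₂), e, namedTerm_odd, ← e, h3]
        simp [h2]
      -- The remaining parameters occur in the input, so their indices lie below `N` and the test on
      -- codes leaves them unchanged.
      · rw [substShared_of_forall_ne _ _ hξ]
        have h1 : Nat.ble N n = false := by
          have hn := P.index_le_code (Or.inr (Primitive.mem_fv_formula.1 hP).1)
          change n ≤ _ at hn
          refine Bool.eq_false_iff.2 fun h => ?_
          rw [Nat.ble_eq] at h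
          omega
        rw [h1, Bool.and_false, cond_false]
        rfl

end Separate

end ManySorted

namespace ManySorted

/-! ### Existence and computation of outputs, and the main theorem -/

section Main

variable {A B C : Type} [Encodable A] [Encodable B] [Encodable C]
  {L₁ : Signature (A ⊕ C)} {L₂ : Signature (B ⊕ C)}
  [Encodable L₁.Fn] [Encodable L₁.Rel] [Encodable L₂.Fn] [Encodable L₂.Rel]
  {T₁ : Set (Formula L₁)} {T₂ : Set (Formula L₂)}

/-- The three-step algorithm has an output, which can be computed from codes of covers. -/
theorem exists_isThreeStepOutput (tame : Tame L₁ L₂) {c₁ : Primitive L₁ → Formula L₁}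
    {c₂ : Primitive L₂ → Formula L₂} (h₁ : ∀ P, IsCover T₁ P (c₁ P))
    (h₂ : ∀ P, IsCover T₂ P (c₂ P)) (P : Primitive (combine L₁ L₂)) :
    ∃ out, IsThreeStepOutput T₁ T₂ P out ∧ ∀ g₁ g₂ : ℕ → ℕ,
      (∀ Q, g₁ Q.formula.code = (c₁ Q).code) → (∀ Q, g₂ Q.formula.code = (c₂ Q).code) →
        threeStepCode g₁ g₂ P.formula.code = out.code := by
  obtain ⟨F⟩ := exists_codedFlattening tame P
  have hφ := h₁ F.primitiveOne
  have hD := Formula.isDNF_dnf hφ.1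
  have hd : ∀ d ∈ (c₁ F.primitiveOne).dnf, litVars d ⊆ F.primitiveOne.formula.fv :=
    fun d hd => (hD.1 d hd).trans hφ.2.1
  -- The output is fixed before any function on codes is considered, so existence needs no
  -- effectiveness, and every function that computes the chosen covers computes the same output.
  have key : ∀ d ∈ (c₁ F.primitiveOne).dnf, ∃ o, (∃ (G : Separation F.toFlattening d)
      (ψ₁ : Formula L₂), IsCover T₂ G.primitiveTwo ψ₁ ∧ o = G.output ψ₁) ∧
      ∀ g₂ : ℕ → ℕ, (∀ Q, g₂ Q.formula.code = (c₂ Q).code) →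
        disjunctCode P.formula.code (d.map litCode)
          (g₂ (twoCode P.formula.code (d.map litCode))) = o.code := fun d hd' => by
    obtain ⟨G, hG, hout⟩ := F.exists_separation tame (hd d hd')
    have hc := h₂ G.primitiveTwo
    exact ⟨_, ⟨G, _, hc, rfl⟩, fun g₂ e₂ => by rw [← hG, e₂, hout _ hc.1 hc.2.1]⟩
  have : Nonempty (Formula (combine L₁ L₂)) := ⟨.bot⟩
  choose! o ho hcode using key
  refine ⟨.disj ((c₁ F.primitiveOne).dnf.map o), ⟨F.toFlattening, _, _, _, hφ, hD, ?_, rfl⟩,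
    fun g₁ g₂ e₁ e₂ => ?_⟩
  · rw [List.forall₂_map_right_iff, List.forall₂_same]
    exact ho
  · rw [threeStepCode, ← F.code_one, e₁, dnfCode_code, ← disjCode_map, List.map_map, List.map_map]
    exact congrArg disjCode (List.map_congr_left fun d hd' => hcode d hd' g₂ e₂)

theorem exists_cover {S : Type} {L : Signature S} {T U : Set (Formula L)} (h : IsCompanion T U)
    (hU : HasQE U) : ∃ c : Primitive L → Formula L, ∀ P, IsCover T P (c P) := by
  choose q hq using hU
  exact ⟨fun P => q P.formula, fun P => h.isCover (hq P.formula)⟩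

/-- Effective elimination, restricted to codes of primitive formulae, computes a choice of covers.
-/
theorem exists_computable_cover {S : Type} {L : Signature S} [Encodable S] [Encodable L.Fn]
    [Encodable L.Rel] {T : Set (Formula L)} (h : HasEffectiveModelCompletion T) :
    ∃ (c : Primitive L → Formula L) (g : ℕ → ℕ), Computable g ∧ ∀ P, IsCover T P (c P) ∧
      g P.formula.code = (c P).code := by
  obtain ⟨U, hU, g, hg, hq⟩ := h
  choose q hq hc using hq
  exact ⟨fun P => q P.formula, g, hg, fun P => ⟨hU.isCover (hq P.formula), hc _⟩⟩

end Main

end ManySorted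

theorem mainTheorem4 {A B C : Type} [Encodable A] [Encodable B] [Encodable C]
    (L₁ : Signature (A ⊕ C)) (L₂ : Signature (B ⊕ C))
    [Encodable L₁.Fn] [Encodable L₁.Rel] [Encodable L₂.Fn] [Encodable L₂.Rel]
    (T₁ : Set (ManySorted.Formula L₁)) (T₂ : Set (ManySorted.Formula L₂))
    (tame : Tame L₁ L₂)
    (univ₁ : IsUniversalTheory T₁) (univ₂ : IsUniversalTheory T₂)
    (mc₁ : HasModelCompletion T₁) (mc₂ : HasModelCompletion T₂)
    (si₁ : StablyInfinite T₁ (Set.range Sum.inr)) (si₂ : StablyInfinite T₂ (Set.range Sum.inr)) :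
    HasModelCompletion (unionTheory T₁ T₂) ∧
    (∀ P : Primitive (combine L₁ L₂), ∃ out, IsThreeStepOutput T₁ T₂ P out) ∧
    (∀ (P : Primitive (combine L₁ L₂)) (out : ManySorted.Formula (combine L₁ L₂)),
      IsThreeStepOutput T₁ T₂ P out → IsCover (unionTheory T₁ T₂) P out) ∧
    (HasEffectiveModelCompletion T₁ → HasEffectiveModelCompletion T₂ →
      HasEffectiveModelCompletion (unionTheory T₁ T₂) ∧
      ∃ g : ℕ → ℕ, Computable g ∧ ∀ P : Primitive (combine L₁ L₂),
        ∃ out, IsThreeStepOutput T₁ T₂ P out ∧ g P.formula.code = out.code) := by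
  have cover := fun (P : Primitive (combine L₁ L₂)) out =>
    IsThreeStepOutput.isCover (P := P) (out := out) tame univ₁ univ₂ si₁ si₂
  have univ := isUniversalTheory_union univ₁ univ₂
  have outputs : ∀ P : Primitive (combine L₁ L₂), ∃ out, IsThreeStepOutput T₁ T₂ P out := by
    obtain ⟨U₁, hU₁, qe₁⟩ := mc₁
    obtain ⟨U₂, hU₂, qe₂⟩ := mc₂
    obtain ⟨c₁, h₁⟩ := exists_cover hU₁ qe₁
    obtain ⟨c₂, h₂⟩ := exists_cover hU₂ qe₂
    exact fun P => (exists_isThreeStepOutput tame h₁ h₂ P).imp fun _ h => h.1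
  refine ⟨?_, outputs, cover, fun emc₁ emc₂ => ?_⟩
  -- Outputs are covers, so every primitive formula over the union has one, and the completion built
  -- from covers is a model completion.
  · choose c hc using outputs
    have hc' := fun P => cover P (c P) (hc P)
    exact ⟨_, isCompanion_coverCompletion univ hc',
      fun φ => ⟨_, Formula.isQFEquivalent_qe hc' univ.1 φ⟩⟩
  · obtain ⟨c₁, g₁, hg₁, h₁⟩ := exists_computable_cover emc₁
    obtain ⟨c₂, g₂, hg₂, h₂⟩ := exists_computable_cover emc₂
    choose c hc hcode using exists_isThreeStepOutput tame (fun P => (h₁ P).1) fun P => (h₂ P).1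
    have hc' := fun P => cover P (c P) (hc P)
    have hg := fun P => hcode P g₁ g₂ (fun Q => (h₁ Q).2) fun Q => (h₂ Q).2
    have hcomp := computable_threeStepCode hg₁ hg₂
    -- The function that computes outputs serves twice: as the second witness, and as the source of
    -- covers for effective quantifier elimination.
    exact ⟨⟨_, isCompanion_coverCompletion univ hc', qeCode (threeStepCode g₁ g₂),
      computable_qeCode hcomp, fun φ => ⟨_, Formula.isQFEquivalent_qe hc' univ.1 φ,
        qeCode_code hg φ⟩⟩, _, hcomp, fun P => ⟨c P, hc P, hg P⟩⟩
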